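/- Let $\Sigma$ be a smooth surface diffeomorphic to the $2$-sphere, $\gamma$ a smooth Riemannian metric on $\Sigma$ with scalar curvature $R_\gamma$, and $H_o,P_o$ real constants with $H_o\ge|P_o|>0$. Put $\mathcal H_o=\sqrt{H_o^2-P_o^2}$ and assume that $R_\gamma>\tfrac32\mathcal H_o^2$ everywhere on $\Sigma$ (in particular $R_\gamma>0$). Then there is $\epsilon_0>0$ such that for every $\epsilon>0$ with $$\epsilon<\epsilon_0\qquad\text{or}\qquad R_\gamma\ge\tfrac32(1+\epsilon)^2\mathcal H_o^2\ \text{ everywhere on }\Sigma$$ there is a smooth initial data set $(g,K)$ on $\Sigma\times[0,1]$ ($g$ a Riemannian metric, $K$ a symmetric $2$-tensor) such that: 1. $(g,K)$ satisfies the dominant energy condition $\mu\ge|J|_g$ on $\Sigma\times[0,1]$, where $2\mu=R_g+(\operatorname{tr}_gK)^2-|K|_g^2$ and $J=\operatorname{div}_g(K-(\operatorname{tr}_gK)g)$; 2. the Bartnik data of $\Sigma\times\{0\}$ are $(\Sigma,\gamma,H_o,P_o,0)$, and the Bartnik data of $\Sigma\times\{1\}$ are the time-symmetric data $(\Sigma,(1+\epsilon)^2\gamma,\mathcal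 H_o,0,0)$. Here the Bartnik data of a slice $\Sigma\times\{t\}$ are its induced metric, its mean curvature $H$, the trace $P$ of $K$ along the slice, and the one-form $\omega^\perp=K(\nu,\cdot)$ on the slice, where $\nu$ is the unit normal in the direction of increasing $t$, and $H$ is the divergence of $\nu$ along the slice (so that round spheres in Euclidean space have positive mean curvature with respect to the outward normal); 3. $(g,K)$ contains no MOTS (marginally outer trapped surface), except possibly in the boundary when $\mathcal H_o=0$: if $N$ is a non-empty closed surface, smoothly immersed in $\Sigma\times[0,1]$ with a continuous unit normal field $\nu$ such that $H+P=0$ everywhere on $N$ (where $H$ is the mean curvature of $N$ with respect to $\nu$ and $P$ is the trace of $K$ along $N$), then $H_o=|P_o|$ and the image of $N$ lies in $\Sigma\times\{0,1\}$. -/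

import Mathlib

open scoped Manifold ContDiff Bundle
open Module (Basis)

universe u

noncomputable section

namespace BartnikCollar

/-! ### Tensor calculus in a coordinate domain

`G` and `K` are the component functions of a metric and of a symmetric `2`-tensor with respect to
a basis `b` of the coordinate space `E`. -/

section Coordinates

variable {E : Type*} [NormedAddCommGroup E] [NormedSpace ℝ E]
  {ι : Type*} [Fintype ι] [DecidableEq ι] (b : Basis ι ℝ E)

/-- The coordinate derivative `∂ₖ f` at `y`. -/
def pd (f : E → ℝ) (k : ι) (y : E) : ℝ := fderiv ℝ f y (b k)

/-- The Christoffel symbol `Γᵏᵢⱼ = ½ Gᵏˡ (∂ᵢ Gₗⱼ + ∂ⱼ Gₗᵢ - ∂ₗ Gᵢⱼ)`. -/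
def christoffel (G : E → Matrix ι ι ℝ) (k i j : ι) (y : E) : ℝ :=
  (1 / 2) * ∑ l, (G y)⁻¹ k l *
    (pd b (fun z => G z l j) i y + pd b (fun z => G z l i) j y - pd b (fun z => G z i j) l y)

/-- The Ricci tensor
`Rᵢⱼ = ∂ₖ Γᵏᵢⱼ - ∂ⱼ Γᵏᵢₖ + Γᵏₖₗ Γˡᵢⱼ - Γᵏⱼₗ Γˡᵢₖ`. -/
def ricci (G : E → Matrix ι ι ℝ) (i j : ι) (y : E) : ℝ :=
  ∑ k, (pd b (christoffel b G k i j) k y - pd b (christoffel b G k i k) j y) +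
    ∑ k, ∑ l, (christoffel b G k k l y * christoffel b G l i j y -
      christoffel b G k j l y * christoffel b G l i k y)

/-- The trace `Gⁱʲ Kᵢⱼ`. -/
def trace (G K : Matrix ι ι ℝ) : ℝ := ∑ i, ∑ j, G⁻¹ i j * K i j

/-- The squared norm `Gⁱᵏ Gʲˡ Kᵢⱼ Kₖₗ`. -/
def normSq (G K : Matrix ι ι ℝ) : ℝ :=
  ∑ i, ∑ j, ∑ k, ∑ l, G⁻¹ i k * G⁻¹ j l * K i j * K k l

/-- The scalar curvature `Gⁱʲ Rᵢⱼ`. -/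
def scalar (G : E → Matrix ι ι ℝ) (y : E) : ℝ := trace (G y) (fun i j => ricci b G i j y)

/-- The components `Kᵢⱼ - (tr K) Gᵢⱼ`. -/
def momentumTensor (G K : E → Matrix ι ι ℝ) (i j : ι) (y : E) : ℝ :=
  K y i j - trace (G y) (K y) * G y i j

/-- The divergence `Jᵢ = ∇ʲ (Kᵢⱼ - (tr K) Gᵢⱼ)`. -/
def momentum (G K : E → Matrix ι ι ℝ) (i : ι) (y : E) : ℝ :=
  ∑ j, ∑ k, (G y)⁻¹ j k *
    (pd b (momentumTensor G K i j) k y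
      - ∑ l, christoffel b G l k i y * momentumTensor G K l j y
      - ∑ l, christoffel b G l k j y * momentumTensor G K i l y)

/-- The vector `Γ(v, w)` with components `Γᵏᵢⱼ vⁱ wʲ`. -/
def christoffelVec (G : E → Matrix ι ι ℝ) (y v w : E) : E :=
  ∑ k, (∑ i, ∑ j, christoffel b G k i j y * b.repr v i * b.repr w j) • b k

end Coordinates

/-! ### Tensors on manifolds without boundary -/

section Tensors

variable {E : Type*} [NormedAddCommGroup E] [NormedSpace ℝ E]
  {H : Type*} [TopologicalSpace H] (I : ModelWithCorners ℝ E H)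

/-- A field of bilinear forms on the tangent spaces. -/
abbrev Tensor₂ (M : Type*) [TopologicalSpace M] [ChartedSpace H M] :=
  ∀ x : M, TangentSpace I x →L[ℝ] TangentSpace I x →L[ℝ] ℝ

variable {M : Type*} [TopologicalSpace M] [ChartedSpace H M] {I}

/-- The components of `T` in the chart at `p`, with respect to the basis `b` of the coordinate
space, at the point of `M` with coordinates `y`. -/
def coords {ι : Type*} (b : Basis ι ℝ E) (T : Tensor₂ I M) (p : M) (y : E) : Matrix ι ι ℝ :=
  fun i j => T ((extChartAt I p).symm y)
    (mfderiv 𝓘(ℝ, E) I (extChartAt I p).symm y (b i))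
    (mfderiv 𝓘(ℝ, E) I (extChartAt I p).symm y (b j))

/-- The scalar curvature `R_g` at `p`, computed in the chart at `p` (it does not depend on the
basis `b`). -/
def scalarCurvature {ι : Type*} [Fintype ι] [DecidableEq ι] (b : Basis ι ℝ E) (g : Tensor₂ I M)
    (p : M) : ℝ :=
  scalar b (coords b g p) (extChartAt I p p)

end Tensors

/-! ### Initial data sets -/

section InitialData

variable {E : Type*} [NormedAddCommGroup E] [NormedSpace ℝ E]
  {H : Type*} [TopologicalSpace H]

/-- A smooth Riemannian metric `g` and a smooth symmetric `2`-tensor `K`. -/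
structure InitialData (I : ModelWithCorners ℝ E H) (M : Type*) [TopologicalSpace M]
    [ChartedSpace H M] [IsManifold I ∞ M] where
  g : Bundle.ContMDiffRiemannianMetric I ∞ E (fun x : M => TangentSpace I x)
  K : Tensor₂ I M
  symm : ∀ (x : M) (v w : TangentSpace I x), K x v w = K x w v
  smooth : ContMDiff I (I.prod 𝓘(ℝ, E →L[ℝ] E →L[ℝ] ℝ)) ∞
    (fun x : M => Bundle.TotalSpace.mk' (E →L[ℝ] E →L[ℝ] ℝ)
      (E := fun x : M => TangentSpace I x →L[ℝ] TangentSpace I x →L[ℝ] ℝ) x (K x))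

variable {I : ModelWithCorners ℝ E H} {M : Type*} [TopologicalSpace M] [ChartedSpace H M]
  [IsManifold I ∞ M] {ι : Type*} [Fintype ι] [DecidableEq ι]

/-- The energy density `μ`, where `2 μ = R_g + (tr K)² - |K|²`. -/
def InitialData.energyDensity (D : InitialData I M) (b : Basis ι ℝ E) (p : M) : ℝ :=
  let y := extChartAt I p p
  let G := coords b D.g.inner p y
  let K := coords b D.K p y
  (1 / 2) * (scalarCurvature b D.g.inner p + trace G K ^ 2 - normSq G K)

/-- The norm `|J|` of the momentum density `J = div (K - (tr K) g)`. -/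
def InitialData.momentumNorm (D : InitialData I M) (b : Basis ι ℝ E) (p : M) : ℝ :=
  let y := extChartAt I p p
  let G := coords b D.g.inner p
  let J := fun i => momentum b G (coords b D.K p) i y
  √(∑ i, ∑ j, (G y)⁻¹ i j * J i * J j)

/-- The dominant energy condition `μ ≥ |J|` at every point of the region `U`. -/
def InitialData.DEC (D : InitialData I M) (b : Basis ι ℝ E) (U : Set M) : Prop :=
  ∀ p ∈ U, D.momentumNorm b p ≤ D.energyDensity b p

/-! ### Hypersurfaces

`F : N → M` is an immersed hypersurface and `ν` a vector field along `F`. -/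

variable {E' : Type*} [NormedAddCommGroup E'] [NormedSpace ℝ E']
  {H' : Type*} [TopologicalSpace H'] (I' : ModelWithCorners ℝ E' H')
  {N : Type*} [TopologicalSpace N] [ChartedSpace H' N]
  {κ : Type*} [Fintype κ] [DecidableEq κ]

/-- The pullback `F^* T` of a field of bilinear forms. -/
def pullback (T : Tensor₂ I M) (F : N → M) : Tensor₂ I' N :=
  fun s =>
    let t : E →L[ℝ] E →L[ℝ] ℝ := T (F s)
    let dF : E' →L[ℝ] E := mfderiv I' I F s
    let r : E' →L[ℝ] E' →L[ℝ] ℝ := t.bilinearComp dF dF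
    r

/-- `ν` is a unit normal field along `F`. -/
def InitialData.IsUnitNormal (D : InitialData I M) (F : N → M)
    (ν : ∀ s : N, TangentSpace I (F s)) : Prop :=
  ∀ s, D.g.inner (F s) (ν s) (ν s) = 1 ∧
    ∀ v : TangentSpace I' s, D.g.inner (F s) (ν s) (mfderiv I' I F s v) = 0

/-- The components `A(∂ₐ, ∂_c) = -g(ν, ∇_{∂ₐ} ∂_c F)` of the second fundamental form of `F` at `s`,
in the charts at `s` and at `F s`. With this sign, round spheres in Euclidean space have positive
mean curvature with respect to the outward normal. -/
def InitialData.secondForm (D : InitialData I M) (b : Basis ι ℝ E) (b' : Basis κ ℝ E')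
    (F : N → M) (ν : ∀ s : N, TangentSpace I (F s)) (s : N) : Matrix κ κ ℝ :=
  fun a c =>
    let f : E' → E := writtenInExtChartAt I' I s F
    let y₀ : E' := extChartAt I' s s
    let y : E := extChartAt I (F s) (F s)
    let X : E := fderiv ℝ (fun z => fderiv ℝ f z (b' c)) y₀ (b' a) +
      christoffelVec b (coords b D.g.inner (F s)) y (fderiv ℝ f y₀ (b' a)) (fderiv ℝ f y₀ (b' c));
    -D.g.inner (F s) (ν s) (mfderiv 𝓘(ℝ, E) I (extChartAt I (F s)).symm y X)

/-- The trace of the bilinear form with components `A` (in the chart at `s`) with respect to the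
induced metric `F^* g`. -/
def InitialData.traceAlong (D : InitialData I M) (b' : Basis κ ℝ E') (F : N → M) (s : N)
    (A : Matrix κ κ ℝ) : ℝ :=
  trace (coords b' (pullback I' D.g.inner F) s (extChartAt I' s s)) A

/-- The mean curvature `H` of `F` with respect to `ν`. -/
def InitialData.meanCurvature (D : InitialData I M) (b : Basis ι ℝ E) (b' : Basis κ ℝ E')
    (F : N → M) (ν : ∀ s : N, TangentSpace I (F s)) (s : N) : ℝ :=
  D.traceAlong I' b' F s (D.secondForm I' b b' F ν s)

/-- The trace `P` of `K` along `F`, with respect to the induced metric. -/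
def InitialData.traceK (D : InitialData I M) (b' : Basis κ ℝ E') (F : N → M) (s : N) : ℝ :=
  D.traceAlong I' b' F s (coords b' (pullback I' D.K F) s (extChartAt I' s s))

/-- `F` with the unit normal `ν` is an immersed two-sided marginally outer trapped surface:
`θ₊ = H + P = 0` everywhere. As `ν` may be replaced by `-ν`, which turns `θ₊` into `-θ₋`, excluding
these for all `ν` also excludes surfaces with `θ₋ = H - P = 0`. -/
structure InitialData.IsMOTS (D : InitialData I M) (b : Basis ι ℝ E) (b' : Basis κ ℝ E')
    (F : N → M) (ν : ∀ s : N, TangentSpace I (F s)) : Prop where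
  smooth : ContMDiff I' I ∞ F
  immersion : ∀ s, Function.Injective (mfderiv I' I F s)
  continuous_normal : Continuous fun s =>
    Bundle.TotalSpace.mk' E (E := fun x : M => TangentSpace I x) (F s) (ν s)
  unit_normal : D.IsUnitNormal I' F ν
  null_expansion : ∀ s, D.meanCurvature I' b b' F ν s + D.traceK I' b' F s = 0

/-- `F` with the unit normal `ν` has induced metric `γ`, mean curvature `h`, `tr K = P` along `F`,
and `K(ν, ·) = α`. -/
structure InitialData.Induces (D : InitialData I M) (b : Basis ι ℝ E) (b' : Basis κ ℝ E')
    (F : N → M) (ν : ∀ s : N, TangentSpace I (F s))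
    (γ : Tensor₂ I' N) (h P : N → ℝ) (α : ∀ s : N, TangentSpace I' s →L[ℝ] ℝ) : Prop where
  unit_normal : D.IsUnitNormal I' F ν
  metric : ∀ (s : N) (v w : TangentSpace I' s), pullback I' D.g.inner F s v w = γ s v w
  meanCurvature : ∀ s, D.meanCurvature I' b b' F ν s = h s
  traceK : ∀ s, D.traceK I' b' F s = P s
  normal_part : ∀ (s : N) (v : TangentSpace I' s), D.K (F s) (ν s) (mfderiv I' I F s v) = α s v

end InitialData

/-! ### The cylinder `S × [0, 1]`

Smooth objects on the manifold with boundary `S × [0, 1]` are the restrictions of smooth objects on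
`S × ℝ`, so data on the cylinder are given by data on `S × ℝ`, and all conditions concern the region
`S × [0, 1]` only. -/

section Cylinder

/-- The coordinate plane. -/
abbrev Plane : Type := EuclideanSpace ℝ (Fin 2)

/-- The model of `S × ℝ` for a surface `S`. -/
abbrev cylModel : ModelWithCorners ℝ (Plane × ℝ) (ModelProd Plane ℝ) :=
  (𝓡 2).prod 𝓘(ℝ, ℝ)

/-- The standard basis of the plane. -/
def planeBasis : Basis (Fin 2) ℝ Plane := (EuclideanSpace.basisFun (Fin 2) ℝ).toBasis

/-- The standard basis of `Plane × ℝ`. -/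
def cylBasis : Basis (Fin 2 ⊕ Unit) ℝ (Plane × ℝ) :=
  planeBasis.prod (Basis.singleton Unit ℝ)

variable {S : Type*} [TopologicalSpace S] [ChartedSpace Plane S] [IsManifold (𝓡 2) ∞ S]

/-- The region `S × [0, 1]`. -/
def cylinder (S : Type*) : Set (S × ℝ) := {x | 0 ≤ x.2 ∧ x.2 ≤ 1}

/-- The Bartnik data of the slice `S × {t}`, with respect to the unit normal that points in the
direction of increasing `t`, are `(S, γ, h, P, α)`. -/
def SliceData (D : InitialData cylModel (S × ℝ)) (t : ℝ) (γ : Tensor₂ (𝓡 2) S) (h P : S → ℝ)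
    (α : ∀ s : S, TangentSpace (𝓡 2) s →L[ℝ] ℝ) : Prop :=
  ∃ ν : ∀ s : S, TangentSpace cylModel ((s, t) : S × ℝ),
    (∀ s : S, let r : ℝ := mfderiv cylModel 𝓘(ℝ, ℝ) (Prod.snd : S × ℝ → ℝ) (s, t) (ν s); 0 < r) ∧
    D.Induces (𝓡 2) cylBasis planeBasis (fun s : S => (s, t)) ν γ h P α

end Cylinder

end BartnikCollar

end

/-! The data have the warped form `g = L² dt² + r(t)² γ`, `K = L² q(t) dt² + ½ r(t)² p(t) γ` with
`L` constant. If `r' = ½ L h r`, the slice at height `t` has mean curvature `h`, trace `p` and `ω^⊥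
= 0`, while `2μ = R_γ / r² - 2h'/L - (3/2) h² + 2qp + p²/2` and `|J| = |hq - hp/2 - p'/L|`. The
theorem thus becomes a choice of `h`, `p`, `q` on `[0, 1]`. The value `L = 2 log(1 + ε) / ∫ h` makes
`r` grow from `1` to `1 + ε`.

Case `H_o > |P_o|` (`exists_collar_of_pos`), with `m = 𝓗_o`. Take `p = P_o (1 - t)` and `h = √(m² +
p²)`, so that `h² - p²` is constant, and choose `q` to make `J = 0`. The terms in `h'` and `q` then
cancel and `2μ = R_γ / r² - (3/2) m²`, which is nonnegative since `r ≤ 1 + ε`.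

Case `H_o = |P_o|` (`exists_collar_of_abs`). Let `χ` be a cutoff decreasing from `1` to `0` and
vanishing for `t ≥ 1/2`; take `p = P_o χ`, `q = p/2` and `h = |P_o| χ + η t(1 - t)`. The term
`-2h'/L` contains `-2|P_o| χ'/L`, which is exactly `2|J|`; what remains is of order `η` and is
absorbed by the positive minimum of `R_γ` once `η` is small.

Exclusion of MOTS is a maximum principle for the height `t` restricted to `N`. By
`laplacian_height`, the equation `H + P = 0` turns its Laplacian into an expression in `h`, `p`, `q`
and the normal. At a local maximum the normal is vertical and this expression is `(h ± p)/L`, so `h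
≤ |p|` there (`le_abs_of_isLocalMax`). In the first case `h > |p|` everywhere, which is absurd on a
compact `N`. In the second case `h > |p|` only for `0 < t < 1`. For `t > 1/2` the height is
subharmonic because `p = q = 0`, so by Hopf's strong maximum principle
(`eventually_eq_of_laplacian_nonneg`) the part of `N` at height `1` is open as well as closed. On
the rest a maximum at a height in `(0, 1)` is impossible, which leaves only height `0`.

The geometric groundwork serves two ends: the curvature of warped products, and invariance under
change of chart. The latter is needed because the quantities at a point are computed in the chart of
that very point, whereas continuity of `R_γ` and the strong maximum principle require one chart for
a whole neighbourhood. -/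

set_option linter.unusedSectionVars false

noncomputable section

namespace BartnikCollar

attribute [-instance]
  Bundle.instNormedAddCommGroupOfRiemannianBundleOfIsTopologicalAddGroupOfContinuousConstSMulReal
  Bundle.instInnerProductSpaceReal

open Filter Topology


/-! ### Linear algebra of traces -/

section LinearAlgebra

variable {E : Type*} [NormedAddCommGroup E] [NormedSpace ℝ E]
  {ι ι' : Type*} [Fintype ι] [DecidableEq ι] [Fintype ι'] [DecidableEq ι']

/-- The matrix of a bilinear form. -/
def mat {ι : Type*} (b : Basis ι ℝ E) (B : E →L[ℝ] E →L[ℝ] ℝ) : Matrix ι ι ℝ :=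
  fun i j => B (b i) (b j)

theorem mat_apply {ι : Type*} (b : Basis ι ℝ E) (B : E →L[ℝ] E →L[ℝ] ℝ) (i j : ι) :
    mat b B i j = B (b i) (b j) := rfl

/-- In this form the cyclicity of the matrix trace becomes available. -/
theorem trace_eq_matrix_trace (G K : Matrix ι ι ℝ) :
    trace G K = Matrix.trace (G⁻¹ * K.transpose) := by
  simp [trace, Matrix.trace, Matrix.mul_apply]

theorem apply_eq_sum (b : Basis ι ℝ E) (B : E →L[ℝ] E →L[ℝ] ℝ) (v w : E) :
    B v w = ∑ i, ∑ j, b.repr v i * b.repr w j * B (b i) (b j) := by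
  conv_lhs => rw [← b.sum_repr v, ← b.sum_repr w]
  simp only [map_sum, map_smul, sum_apply, smul_apply,
    smul_eq_mul, Finset.mul_sum]
  rw [Finset.sum_comm]
  exact Finset.sum_congr rfl fun i _ => Finset.sum_congr rfl fun j _ => by ring

theorem mat_basis_change (b : Basis ι ℝ E) (b' : Basis ι' ℝ E) (B : E →L[ℝ] E →L[ℝ] ℝ) :
    mat b' B = (b.toMatrix b').transpose * mat b B * b.toMatrix b' := by
  ext i j
  simp only [mat, Matrix.mul_apply, Matrix.transpose_apply, Finset.sum_mul, Basis.toMatrix_apply]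
  rw [apply_eq_sum b, Finset.sum_comm]
  exact Finset.sum_congr rfl fun i _ => Finset.sum_congr rfl fun j _ => by ring

theorem inv_mat_basis_change (b : Basis ι ℝ E) (b' : Basis ι' ℝ E) (B : E →L[ℝ] E →L[ℝ] ℝ)
    (h : IsUnit (mat b B).det) :
    (mat b' B)⁻¹ = b'.toMatrix b * (mat b B)⁻¹ * (b'.toMatrix b).transpose := by
  apply Matrix.inv_eq_right_inv
  have h1 : b.toMatrix b' * b'.toMatrix b = 1 := b.toMatrix_mul_toMatrix_flip b'
  have h2 : b'.toMatrix b * b.toMatrix b' = 1 := b'.toMatrix_mul_toMatrix_flip b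
  have h3 : (b.toMatrix b').transpose * (b'.toMatrix b).transpose = 1 := by
    rw [← Matrix.transpose_mul, h2, Matrix.transpose_one]
  rw [mat_basis_change b b']
  calc _ = (b.toMatrix b').transpose * (mat b B * (b.toMatrix b' * b'.toMatrix b) * (mat b B)⁻¹) *
        (b'.toMatrix b).transpose := by simp only [Matrix.mul_assoc]
    _ = 1 := by rw [h1, Matrix.mul_one, Matrix.mul_nonsing_inv _ h, Matrix.mul_one, h3]

/-- The inverse Gram matrix transforms contragrediently, so the transition matrices cancel under the
trace. The two index types may differ, which allows passing to orthogonal bases and to bases adapted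
to a hypersurface. -/
theorem trace_basis_change (b : Basis ι ℝ E) (b' : Basis ι' ℝ E) (B C : E →L[ℝ] E →L[ℝ] ℝ)
    (h : IsUnit (mat b B).det) :
    trace (mat b' B) (mat b' C) = trace (mat b B) (mat b C) := by
  have h1 : b.toMatrix b' * b'.toMatrix b = 1 := b.toMatrix_mul_toMatrix_flip b'
  have h3 : (b'.toMatrix b).transpose * (b.toMatrix b').transpose = 1 := by
    rw [← Matrix.transpose_mul, h1, Matrix.transpose_one]
  rw [trace_eq_matrix_trace, trace_eq_matrix_trace, inv_mat_basis_change b b' B h,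
    mat_basis_change b b' C]
  simp only [Matrix.transpose_mul, Matrix.transpose_transpose]
  calc _ = Matrix.trace (b'.toMatrix b * ((mat b B)⁻¹ *
        (((b'.toMatrix b).transpose * (b.toMatrix b').transpose) *
          ((mat b C).transpose * b.toMatrix b')))) := by simp only [Matrix.mul_assoc]
    _ = _ := by
      rw [h3, Matrix.one_mul, Matrix.trace_mul_comm]
      simp only [Matrix.mul_assoc, h1, Matrix.mul_one]

/-- A form is nondegenerate if no nonzero vector pairs to zero with all vectors. -/
theorem isUnit_det_mat (b : Basis ι ℝ E) (B : E →L[ℝ] E →L[ℝ] ℝ)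
    (h : ∀ v, (∀ w, B w v = 0) → v = 0) : IsUnit (mat b B).det := by
  rw [isUnit_iff_ne_zero]
  intro h0
  obtain ⟨v, hv, hv'⟩ := Matrix.exists_mulVec_eq_zero_iff.2 h0
  apply hv
  have key : ∑ j, v j • b j = 0 := by
    apply h
    intro w
    rw [← b.sum_repr w]
    simp only [map_sum, map_smul, sum_apply, smul_apply,
      smul_eq_mul]
    simp only [Finset.mul_sum]
    rw [Finset.sum_comm]
    refine Finset.sum_eq_zero fun i _ => ?_
    have := congrFun hv' i
    simp only [Matrix.mulVec, dotProduct, mat, Pi.zero_apply] at this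
    rw [← mul_zero (b.repr w i), ← this, Finset.mul_sum]
    exact Finset.sum_congr rfl fun j _ => by ring
  exact funext fun j => Fintype.linearIndependent_iff.1 b.linearIndependent v key j

theorem isUnit_det_mat_of_pos (b : Basis ι ℝ E) (B : E →L[ℝ] E →L[ℝ] ℝ)
    (h : ∀ v, v ≠ 0 → 0 < B v v) : IsUnit (mat b B).det :=
  isUnit_det_mat b B fun v hv => by
    by_contra h0
    exact (h v h0).ne' (hv v)

theorem inv_mul_mat {b : Basis ι ℝ E} {B : E →L[ℝ] E →L[ℝ] ℝ} (h : IsUnit (mat b B).det)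
    (i j : ι) : ∑ k, (mat b B)⁻¹ i k * B (b k) (b j) = if i = j then 1 else 0 := by
  have := congrFun (congrFun (Matrix.nonsing_inv_mul _ h) i) j
  rwa [Matrix.mul_apply, Matrix.one_apply] at this

theorem mat_mul_inv {b : Basis ι ℝ E} {B : E →L[ℝ] E →L[ℝ] ℝ} (h : IsUnit (mat b B).det)
    (i j : ι) : ∑ k, B (b i) (b k) * (mat b B)⁻¹ k j = if i = j then 1 else 0 := by
  have := congrFun (congrFun (Matrix.mul_nonsing_inv _ h) i) j
  rwa [Matrix.mul_apply, Matrix.one_apply] at this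

end LinearAlgebra

/-! ### Regularity of the coordinate expressions -/

section Regularity

variable {E : Type*} [NormedAddCommGroup E] [NormedSpace ℝ E]
  {ι : Type*} [Fintype ι] [DecidableEq ι]

theorem contDiffAt_det {n : WithTop ℕ∞} {G : E → Matrix ι ι ℝ} {y : E}
    (hG : ∀ i j, ContDiffAt ℝ n (fun z => G z i j) y) :
    ContDiffAt ℝ n (fun z => (G z).det) y := by
  simp only [Matrix.det_apply]
  refine ContDiffAt.sum fun σ _ => ?_
  refine ContDiffAt.const_smul _ ?_
  exact contDiffAt_prod fun i _ => hG _ _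

/-- Cramer's rule: each entry is a quotient of determinants, which are polynomials in the entries of
`G`. -/
theorem contDiffAt_inv {n : WithTop ℕ∞} {G : E → Matrix ι ι ℝ} {y : E}
    (hG : ∀ i j, ContDiffAt ℝ n (fun z => G z i j) y) (h : IsUnit (G y).det) (i j : ι) :
    ContDiffAt ℝ n (fun z => (G z)⁻¹ i j) y := by
  have : (fun z => (G z)⁻¹ i j) = fun z => ((G z).det)⁻¹ *
      ((G z).updateRow j (Pi.single i 1)).det := by
    funext z
    rw [Matrix.inv_def, Matrix.smul_apply, Ring.inverse_eq_inv', Matrix.adjugate_apply, smul_eq_mul]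
  rw [this]
  refine ((contDiffAt_det hG).inv h.ne_zero).mul (contDiffAt_det fun k l => ?_)
  by_cases hk : k = j
  · subst hk; simpa using contDiffAt_const
  · simpa [Matrix.updateRow_ne hk] using hG k l

variable [FiniteDimensional ℝ E] (b : Basis ι ℝ E)

theorem contDiffAt_pd {f : E → ℝ} {y : E} (hf : ContDiffAt ℝ ∞ f y) (k : ι) :
    ContDiffAt ℝ ∞ (pd b f k) y :=
  (hf.fderiv_right (m := ∞) le_rfl).clm_apply contDiffAt_const

theorem contDiffAt_christoffel {G : E → Matrix ι ι ℝ} {y : E}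
    (hG : ∀ i j, ContDiffAt ℝ ∞ (fun z => G z i j) y) (h : IsUnit (G y).det) (k i j : ι) :
    ContDiffAt ℝ ∞ (christoffel b G k i j) y := by
  unfold christoffel
  refine contDiffAt_const.mul (ContDiffAt.sum fun l _ => ?_)
  exact (contDiffAt_inv hG h k l).mul
    (((contDiffAt_pd b (hG l j) i).add (contDiffAt_pd b (hG l i) j)).sub
      (contDiffAt_pd b (hG i j) l))

theorem contDiffAt_ricci {G : E → Matrix ι ι ℝ} {y : E}
    (hG : ∀ i j, ContDiffAt ℝ ∞ (fun z => G z i j) y) (h : IsUnit (G y).det) (i j : ι) :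
    ContDiffAt ℝ ∞ (ricci b G i j) y := by
  have hc := contDiffAt_christoffel b hG h
  unfold ricci
  refine (ContDiffAt.sum fun k _ => ?_).add (ContDiffAt.sum fun k _ => ContDiffAt.sum fun l _ => ?_)
  · exact (contDiffAt_pd b (hc k i j) k).sub (contDiffAt_pd b (hc k i k) j)
  · exact ((hc k k l).mul (hc l i j)).sub ((hc k j l).mul (hc l i k))

theorem contDiffAt_scalar {G : E → Matrix ι ι ℝ} {y : E}
    (hG : ∀ i j, ContDiffAt ℝ ∞ (fun z => G z i j) y) (h : IsUnit (G y).det) :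
    ContDiffAt ℝ ∞ (scalar b G) y := by
  unfold scalar trace
  refine ContDiffAt.sum fun i _ => ContDiffAt.sum fun j _ => ?_
  exact (contDiffAt_inv hG h i j).mul (contDiffAt_ricci b hG h i j)

end Regularity

/-! ### Coordinate-free form of the Christoffel symbols and of the curvature -/

section Connection

variable {E : Type*} [NormedAddCommGroup E] [NormedSpace ℝ E] [FiniteDimensional ℝ E]
  {ι : Type*} [Fintype ι] [DecidableEq ι] (b : Basis ι ℝ E)

/-- Reduces identities linear in a vector to the basis vectors, where the component formulas apply.
-/
theorem basis_induction {P : E → Prop} (hb : ∀ i, P (b i)) (h0 : P 0)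
    (ha : ∀ x y, P x → P y → P (x + y)) (hs : ∀ (c : ℝ) x, P x → P (c • x)) (x : E) : P x := by
  refine Submodule.span_induction (p := fun x _ => P x) ?_ h0 (fun x y _ _ => ha x y)
    (fun c x _ => hs c x) (b.mem_span x)
  rintro _ ⟨i, rfl⟩
  exact hb i

/-- The coordinate functional of a basis vector. -/
def coordL (i : ι) : E →L[ℝ] ℝ := LinearMap.toContinuousLinearMap (b.coord i)

@[simp] theorem coordL_apply (i : ι) (v : E) : coordL b i v = b.repr v i := rfl

/-- The bilinear map `Γ` at `y`. -/
def gammaL (G : E → Matrix ι ι ℝ) (y : E) : E →L[ℝ] E →L[ℝ] E :=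
  ∑ k, ∑ i, ∑ j, christoffel b G k i j y •
    (coordL b i).smulRight ((coordL b j).smulRight (b k))

theorem gammaL_apply (G : E → Matrix ι ι ℝ) (y v w : E) :
    gammaL b G y v w = christoffelVec b G y v w := by
  simp only [gammaL, christoffelVec, sum_apply, smul_apply,
    ContinuousLinearMap.smulRight_apply, coordL_apply, Finset.sum_smul, smul_smul]

theorem repr_gammaL_basis (G : E → Matrix ι ι ℝ) (y : E) (k i j : ι) :
    b.repr (gammaL b G y (b i) (b j)) k = christoffel b G k i j y := by
  simp [gammaL_apply, christoffelVec, Finsupp.single_apply]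

theorem contDiffAt_gammaL {G : E → Matrix ι ι ℝ} {y : E}
    (hG : ∀ i j, ContDiffAt ℝ ∞ (fun z => G z i j) y) (h : IsUnit (G y).det) :
    ContDiffAt ℝ ∞ (gammaL b G) y := by
  unfold gammaL
  exact ContDiffAt.sum fun k _ => ContDiffAt.sum fun i _ => ContDiffAt.sum fun j _ =>
    ContDiffAt.comp (f := christoffel b G k i j) (g := ContinuousLinearMap.smulRight
      (1 : ℝ →L[ℝ] ℝ) ((coordL b i).smulRight ((coordL b j).smulRight (b k)))) y
        (ContinuousLinearMap.contDiff _).contDiffAt (contDiffAt_christoffel b hG h k i j)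

/-- A smooth Riemannian metric on an open set of coordinates. -/
structure MetricOn (U : Set E) (g : E → E →L[ℝ] E →L[ℝ] ℝ) : Prop where
  isOpen : IsOpen U
  smooth : ∀ y ∈ U, ContDiffAt ℝ ∞ g y
  symm : ∀ y ∈ U, ∀ v w, g y v w = g y w v
  pos : ∀ y ∈ U, ∀ v, v ≠ 0 → 0 < g y v v

variable {b} {U V : Set E} {g g' : E → E →L[ℝ] E →L[ℝ] ℝ}

theorem MetricOn.isUnit (hg : MetricOn U g) {y : E} (hy : y ∈ U) : IsUnit (mat b (g y)).det :=
  isUnit_det_mat_of_pos b _ (hg.pos y hy)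

theorem MetricOn.contDiffAt_mat (hg : MetricOn U g) {y : E} (hy : y ∈ U) (i j : ι) :
    ContDiffAt ℝ ∞ (fun z => mat b (g z) i j) y :=
  ((hg.smooth y hy).clm_apply contDiffAt_const).clm_apply contDiffAt_const

theorem MetricOn.contDiffAt_gammaL (hg : MetricOn U g) {y : E} (hy : y ∈ U) :
    ContDiffAt ℝ ∞ (gammaL b fun z => mat b (g z)) y :=
  BartnikCollar.contDiffAt_gammaL b (hg.contDiffAt_mat hy) (hg.isUnit hy)

theorem MetricOn.ext_right (hg : MetricOn U g) {y : E} (hy : y ∈ U) {v w : E}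
    (h : ∀ u, g y u v = g y u w) : v = w := by
  by_contra hne
  have := hg.pos y hy (v - w) (sub_ne_zero.2 hne)
  rw [map_sub, h, sub_self] at this
  exact this.false

theorem fderiv_apply₂ (hg : DifferentiableAt ℝ g y) (u v w : E) :
    fderiv ℝ (fun z => g z v w) y u = fderiv ℝ g y u v w := by
  have h := (hg.hasFDerivAt.clm_apply (hasFDerivAt_const v y)).clm_apply (hasFDerivAt_const w y)
  rw [h.fderiv]
  simp

/-- The Koszul formula. -/
theorem MetricOn.koszul (hg : MetricOn U g) {y : E} (hy : y ∈ U) (u v w : E) :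
    g y w (gammaL b (fun z => mat b (g z)) y u v) =
      (1 / 2) * (fderiv ℝ g y u w v + fderiv ℝ g y v w u - fderiv ℝ g y w u v) := by
  have hd : DifferentiableAt ℝ g y := (hg.smooth y hy).differentiableAt (by simp)
  induction u using basis_induction b with
  | h0 => simp
  | ha x z hx hz => simp only [map_add, add_apply, hx, hz]; ring
  | hs c x hx => simp only [map_smul, smul_apply, hx, smul_eq_mul]; ring
  | hb i =>
  induction v using basis_induction b with
  | h0 => simp
  | ha x z hx hz => simp only [map_add, add_apply, hx, hz]; ring
  | hs c x hx => simp only [map_smul, smul_apply, hx, smul_eq_mul]; ring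
  | hb j =>
  induction w using basis_induction b with
  | h0 => simp
  | ha x z hx hz => simp only [map_add, add_apply, hx, hz]; ring
  | hs c x hx => simp only [map_smul, smul_apply, hx, smul_eq_mul]; ring
  | hb m =>
  have h1 : gammaL b (fun z => mat b (g z)) y (b i) (b j) =
      ∑ k, christoffel b (fun z => mat b (g z)) k i j y • b k := by
    rw [← b.sum_repr (gammaL b (fun z => mat b (g z)) y (b i) (b j))]
    simp only [repr_gammaL_basis]
  have h2 := fun l => mat_mul_inv (b := b) (hg.isUnit hy) m l
  simp only [h1, map_sum, map_smul, smul_eq_mul, christoffel, pd, mat_apply, fderiv_apply₂ hd]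
  -- Lowering the upper index of `Γ` contracts the inverse metric with the metric and leaves only
  -- the term `l = m`.
  calc _ = (1 / 2) * ∑ l, (∑ k, g y (b m) (b k) * (mat b (g y))⁻¹ k l) *
        (fderiv ℝ g y (b i) (b l) (b j) + fderiv ℝ g y (b j) (b l) (b i)
          - fderiv ℝ g y (b l) (b i) (b j)) := by
        simp only [Finset.mul_sum, Finset.sum_mul]
        rw [Finset.sum_comm]
        exact Finset.sum_congr rfl fun k _ => Finset.sum_congr rfl fun l _ => by
          ring
    _ = _ := by
      simp only [h2]
      simp

/-- The curvature operator of a connection with Christoffel symbols `Γ`. -/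
def riem (Γ : E → E →L[ℝ] E →L[ℝ] E) (y u v w : E) : E :=
  fderiv ℝ Γ y u w v - fderiv ℝ Γ y v w u + Γ y u (Γ y w v) - Γ y v (Γ y w u)

/-- `u ↦ Rm(u, v) w` as a linear map. -/
def riemL (Γ : E → E →L[ℝ] E →L[ℝ] E) (y v w : E) : E →ₗ[ℝ] E where
  toFun u := riem Γ y u v w
  map_add' u u' := by simp only [riem, map_add, add_apply]; abel
  map_smul' c u := by
    simp only [riem, map_smul, smul_apply, smul_sub, smul_add, RingHom.id_apply]

/-- The trace of an endomorphism involves no basis, so tensoriality of the Ricci tensor follows from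
that of the curvature operator. -/
theorem ricci_eq_trace {y : E} {G : E → Matrix ι ι ℝ}
    (hΓ : DifferentiableAt ℝ (gammaL b G) y) (i j : ι) :
    ricci b G i j y = LinearMap.trace ℝ E (riemL (gammaL b G) y (b j) (b i)) := by
  have h1 : ∀ k i j l, pd b (christoffel b G k i j) l y =
      b.repr (fderiv ℝ (gammaL b G) y (b l) (b i) (b j)) k := by
    intro k i j l
    have h : christoffel b G k i j = fun z => coordL b k (gammaL b G z (b i) (b j)) := by
      funext z
      rw [coordL_apply, repr_gammaL_basis]
    have h' := (coordL b k).hasFDerivAt.comp y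
      ((hΓ.hasFDerivAt.clm_apply (hasFDerivAt_const (b i) y)).clm_apply (hasFDerivAt_const (b j) y))
    rw [pd, h]
    erw [h'.fderiv]
    simp
  have h2 : ∀ k (v : E) (l : ι), b.repr (gammaL b G y (b l) v) k =
      ∑ m, christoffel b G k l m y * b.repr v m := by
    intro k v l
    conv_lhs => rw [← b.sum_repr v]
    simp only [map_sum, map_smul, Finsupp.coe_finsetSum, Finset.sum_apply, Finsupp.coe_smul,
      Pi.smul_apply, smul_eq_mul, repr_gammaL_basis]
    exact Finset.sum_congr rfl fun m _ => mul_comm _ _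
  rw [LinearMap.trace_eq_matrix_trace ℝ b, Matrix.trace]
  simp only [Matrix.diag_apply, LinearMap.toMatrix_apply]
  simp only [riemL, riem, LinearMap.coe_mk, AddHom.coe_mk, map_sub, map_add, Finsupp.coe_sub,
    Finsupp.coe_add, Pi.sub_apply, Pi.add_apply, h2, Basis.repr_self, Finsupp.single_apply, mul_ite, mul_one, mul_zero,
    Finset.sum_ite_eq, Finset.mem_univ, if_true]
  rw [ricci, ← Finset.sum_add_distrib]
  refine Finset.sum_congr rfl fun k _ => ?_
  rw [h1, h1, Finset.sum_sub_distrib]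
  ring

end Connection

/-! ### Change of coordinates -/

section Transition

variable {E : Type*} [NormedAddCommGroup E] [NormedSpace ℝ E] [FiniteDimensional ℝ E]
  {ι : Type*} [Fintype ι] [DecidableEq ι] {b : Basis ι ℝ E}
  {U V : Set E} {g g' : E → E →L[ℝ] E →L[ℝ] ℝ} {φ : E → E} {y : E}

theorem minSmoothness_two_le : minSmoothness ℝ 2 ≤ ∞ := by
  simp only [minSmoothness_of_isRCLikeNormedField]
  exact WithTop.coe_le_coe.2 (le_top : (2 : ℕ∞) ≤ ⊤)

/-- `φ : U → V` is a smooth local isometry from `g` to `g'`. -/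
structure IsTransition (U V : Set E) (φ : E → E) (g g' : E → E →L[ℝ] E →L[ℝ] ℝ) : Prop where
  mapsTo : ∀ y ∈ U, φ y ∈ V
  smooth : ∀ y ∈ U, ContDiffAt ℝ ∞ φ y
  bijective : ∀ y ∈ U, Function.Bijective (fderiv ℝ φ y)
  pullback : ∀ y ∈ U, ∀ v w, g y v w = g' (φ y) (fderiv ℝ φ y v) (fderiv ℝ φ y w)

theorem MetricOn.fderiv_symm (hg : MetricOn U g) (hy : y ∈ U) (u v w : E) :
    fderiv ℝ g y u v w = fderiv ℝ g y u w v := by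
  have hd : DifferentiableAt ℝ g y := (hg.smooth y hy).differentiableAt (by simp)
  rw [← fderiv_apply₂ hd, ← fderiv_apply₂ hd]
  have : (fun z => g z v w) =ᶠ[𝓝 y] fun z => g z w v := by
    filter_upwards [hg.isOpen.mem_nhds hy] with z hz using hg.symm z hz v w
  rw [this.fderiv_eq]

theorem MetricOn.gammaL_symm (hg : MetricOn U g) (hy : y ∈ U) (u v : E) :
    gammaL b (fun z => mat b (g z)) y u v = gammaL b (fun z => mat b (g z)) y v u := by
  refine hg.ext_right hy fun w => ?_
  rw [hg.koszul hy, hg.koszul hy, hg.fderiv_symm hy w u v]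
  ring

section Pullback

variable {E' : Type*} [NormedAddCommGroup E'] [NormedSpace ℝ E'] [FiniteDimensional ℝ E']
  {ι' : Type*} [Fintype ι'] [DecidableEq ι'] {b' : Basis ι' ℝ E'} {U' : Set E'}
  {h : E' → E' →L[ℝ] E' →L[ℝ] ℝ} {f : E' → E} {z : E'}

/-- The product rule for `g(f)(df v, df w)`. Besides the derivative of `g` it produces two terms
with second derivatives of `f`, whose combination in the Koszul formula gives the Gauss formula. -/
theorem fderiv_pullback (hh : DifferentiableAt ℝ h z) (hg : DifferentiableAt ℝ g (f z))
    (hf : ContDiffAt ℝ ∞ f z)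
    (hp : ∀ᶠ x in 𝓝 z, ∀ v w, h x v w = g (f x) (fderiv ℝ f x v) (fderiv ℝ f x w)) (u v w : E') :
    fderiv ℝ h z u v w = fderiv ℝ g (f z) (fderiv ℝ f z u) (fderiv ℝ f z v) (fderiv ℝ f z w) +
      g (f z) (fderiv ℝ (fderiv ℝ f) z u v) (fderiv ℝ f z w) +
      g (f z) (fderiv ℝ f z v) (fderiv ℝ (fderiv ℝ f) z u w) := by
  have hφ : DifferentiableAt ℝ f z := hf.differentiableAt (by simp)
  have hφ' : DifferentiableAt ℝ (fderiv ℝ f) z :=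
    (hf.fderiv_right (m := ∞) le_rfl).differentiableAt (by simp)
  rw [← fderiv_apply₂ hh]
  have h1 : (fun x => h x v w) =ᶠ[𝓝 z]
      fun x => g (f x) (fderiv ℝ f x v) (fderiv ℝ f x w) := by
    filter_upwards [hp] with x hx using hx v w
  rw [h1.fderiv_eq]
  have h2 : ∀ v, HasFDerivAt (fun x => fderiv ℝ f x v) _ z := fun v =>
    hφ'.hasFDerivAt.clm_apply (hasFDerivAt_const v z)
  have h3 : HasFDerivAt (fun x => g (f x)) _ z :=
    HasFDerivAt.comp (g := g) (f := f) z hg.hasFDerivAt hφ.hasFDerivAt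
  rw [((h3.clm_apply (h2 v)).clm_apply (h2 w)).fderiv]
  simp only [add_apply, ContinuousLinearMap.comp_apply, ContinuousLinearMap.flip_apply,
    zero_apply, map_zero, zero_add]
  ring

/-- The Gauss formula: the tangential part of the second derivative of an isometric immersion is
given by the Christoffel symbols of the induced metric. -/
theorem MetricOn.gauss (hh : MetricOn U' h) (hz : z ∈ U') (hg : MetricOn U g) (hfz : f z ∈ U)
    (hf : ContDiffAt ℝ ∞ f z)
    (hp : ∀ᶠ x in 𝓝 z, ∀ v w, h x v w = g (f x) (fderiv ℝ f x v) (fderiv ℝ f x w)) (u v w : E') :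
    h z w (gammaL b' (fun x => mat b' (h x)) z u v) =
      g (f z) (fderiv ℝ f z w) (gammaL b (fun x => mat b (g x)) (f z) (fderiv ℝ f z u)
        (fderiv ℝ f z v) + fderiv ℝ (fderiv ℝ f) z u v) := by
  have hs : ∀ a c, fderiv ℝ (fderiv ℝ f) z a c = fderiv ℝ (fderiv ℝ f) z c a := fun a c =>
    (hf.isSymmSndFDerivAt minSmoothness_two_le) a c
  rw [hh.koszul hz, map_add, hg.koszul hfz]
  simp only [fderiv_pullback ((hh.smooth z hz).differentiableAt (by simp))
    ((hg.smooth _ hfz).differentiableAt (by simp)) hf hp]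
  -- By symmetry of the second derivatives, the six second-order terms of the Koszul formula cancel
  -- except for the two equal to `g(df w, d²f(u, v))`.
  rw [hs v u, hs w u, hs w v, hg.symm _ hfz (fderiv ℝ (fderiv ℝ f) z u w),
    hg.symm _ hfz (fderiv ℝ (fderiv ℝ f) z v w)]
  ring

end Pullback

/-- The transformation law of the Christoffel symbols. -/
theorem IsTransition.gammaL_eq (ht : IsTransition U V φ g g') (hg : MetricOn U g)
    (hg' : MetricOn V g') (hy : y ∈ U) (u v : E) :
    fderiv ℝ φ y (gammaL b (fun z => mat b (g z)) y u v) =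
      gammaL b (fun z => mat b (g' z)) (φ y) (fderiv ℝ φ y u) (fderiv ℝ φ y v) +
        fderiv ℝ (fderiv ℝ φ) y u v := by
  have hy' := ht.mapsTo y hy
  -- The derivative of `φ` is onto, so every vector is tangential and the Gauss formula determines
  -- the whole vector.
  refine hg'.ext_right hy' fun w' => ?_
  obtain ⟨w, rfl⟩ := (ht.bijective y hy).2 w'
  rw [← ht.pullback y hy]
  refine hg.gauss hy hg' hy' (ht.smooth y hy) ?_ u v w
  filter_upwards [hg.isOpen.mem_nhds hy] with z hz using ht.pullback z hz

/-- The curvature operator is a tensor. -/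
theorem IsTransition.riem_eq (ht : IsTransition U V φ g g') (hg : MetricOn U g)
    (hg' : MetricOn V g') (hy : y ∈ U) (u v w : E) :
    fderiv ℝ φ y (riem (gammaL b fun z => mat b (g z)) y u v w) =
      riem (gammaL b fun z => mat b (g' z)) (φ y) (fderiv ℝ φ y u) (fderiv ℝ φ y v)
        (fderiv ℝ φ y w) := by
  have hy' := ht.mapsTo y hy
  have hφ : DifferentiableAt ℝ φ y := (ht.smooth y hy).differentiableAt (by simp)
  have hφ1 : ContDiffAt ℝ ∞ (fderiv ℝ φ) y := (ht.smooth y hy).fderiv_right le_rfl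
  have hφ2 : ContDiffAt ℝ ∞ (fderiv ℝ (fderiv ℝ φ)) y := hφ1.fderiv_right le_rfl
  have hd1 := (hφ1.differentiableAt (by simp)).hasFDerivAt
  have hd2 := (hφ2.differentiableAt (by simp)).hasFDerivAt
  have hΓ := ((hg.contDiffAt_gammaL (b := b) hy).differentiableAt (by simp)).hasFDerivAt
  have hΓ' := ((hg'.contDiffAt_gammaL (b := b) hy').differentiableAt (by simp)).hasFDerivAt
  have hs : ∀ z ∈ U, ∀ a c, fderiv ℝ (fderiv ℝ φ) z a c = fderiv ℝ (fderiv ℝ φ) z c a :=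
    fun z hz a c => ((ht.smooth z hz).isSymmSndFDerivAt minSmoothness_two_le) a c
  -- Total symmetry of the third derivative, from symmetry of the second derivatives of `φ` on `U`
  -- and of the map `fderiv ℝ φ`.
  have hs3 : ∀ a c e, fderiv ℝ (fderiv ℝ (fderiv ℝ φ)) y a c e =
      fderiv ℝ (fderiv ℝ (fderiv ℝ φ)) y e c a := by
    have h1 : ∀ a c e, fderiv ℝ (fderiv ℝ (fderiv ℝ φ)) y a c e =
        fderiv ℝ (fderiv ℝ (fderiv ℝ φ)) y a e c := by
      intro a c e
      have hev : (fun z => fderiv ℝ (fderiv ℝ φ) z c e) =ᶠ[𝓝 y]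
          fun z => fderiv ℝ (fderiv ℝ φ) z e c := by
        filter_upwards [hg.isOpen.mem_nhds hy] with z hz using hs z hz c e
      have h := hev.fderiv_eq (𝕜 := ℝ)
      have h2 : ∀ c e, HasFDerivAt (fun z => fderiv ℝ (fderiv ℝ φ) z c e) _ y := fun c e =>
        (hd2.clm_apply (hasFDerivAt_const c y)).clm_apply (hasFDerivAt_const e y)
      rw [(h2 c e).fderiv, (h2 e c).fderiv] at h
      simpa using congrArg (fun L => L a) h
    have h2 : ∀ a c, fderiv ℝ (fderiv ℝ (fderiv ℝ φ)) y a c =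
        fderiv ℝ (fderiv ℝ (fderiv ℝ φ)) y c a := fun a c =>
      (hφ1.isSymmSndFDerivAt minSmoothness_two_le) a c
    intro a c e
    rw [h1, h2, h1]
  -- Differentiating the transformation law of the Christoffel symbols in the direction `a`.
  have key : ∀ a c e, fderiv ℝ φ y (fderiv ℝ (gammaL b fun z => mat b (g z)) y a c e) =
      fderiv ℝ (gammaL b fun z => mat b (g' z)) (φ y) (fderiv ℝ φ y a) (fderiv ℝ φ y c)
        (fderiv ℝ φ y e) +
      gammaL b (fun z => mat b (g' z)) (φ y) (fderiv ℝ (fderiv ℝ φ) y a c) (fderiv ℝ φ y e) +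
      gammaL b (fun z => mat b (g' z)) (φ y) (fderiv ℝ φ y c) (fderiv ℝ (fderiv ℝ φ) y a e) +
      fderiv ℝ (fderiv ℝ (fderiv ℝ φ)) y a c e -
      fderiv ℝ (fderiv ℝ φ) y a (gammaL b (fun z => mat b (g z)) y c e) := by
    intro a c e
    have hev : (fun z => fderiv ℝ φ z (gammaL b (fun z => mat b (g z)) z c e)) =ᶠ[𝓝 y] fun z =>
        gammaL b (fun z => mat b (g' z)) (φ z) (fderiv ℝ φ z c) (fderiv ℝ φ z e) +
          fderiv ℝ (fderiv ℝ φ) z c e := by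
      filter_upwards [hg.isOpen.mem_nhds hy] with z hz using ht.gammaL_eq hg hg' hz c e
    have h := hev.fderiv_eq (𝕜 := ℝ)
    have hl : HasFDerivAt (fun z => fderiv ℝ φ z (gammaL b (fun z => mat b (g z)) z c e)) _ y :=
      hd1.clm_apply ((hΓ.clm_apply (hasFDerivAt_const c y)).clm_apply (hasFDerivAt_const e y))
    have hφv : ∀ v, HasFDerivAt (fun z => fderiv ℝ φ z v) _ y := fun v =>
      hd1.clm_apply (hasFDerivAt_const v y)
    have hΓφ : HasFDerivAt (fun z => gammaL b (fun z => mat b (g' z)) (φ z)) _ y :=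
      hΓ'.comp y hφ.hasFDerivAt
    have hr : HasFDerivAt (fun z =>
        gammaL b (fun z => mat b (g' z)) (φ z) (fderiv ℝ φ z c) (fderiv ℝ φ z e) +
          fderiv ℝ (fderiv ℝ φ) z c e) _ y :=
      ((hΓφ.clm_apply (hφv c)).clm_apply (hφv e)).add
        ((hd2.clm_apply (hasFDerivAt_const c y)).clm_apply (hasFDerivAt_const e y))
    rw [hl.fderiv, hr.fderiv] at h
    have h' := congrArg (fun L => L a) h
    simp only [add_apply, ContinuousLinearMap.comp_apply, ContinuousLinearMap.flip_apply,
      zero_apply, map_zero, zero_add] at h'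
    rw [eq_sub_iff_add_eq, h']
    abel
  -- Antisymmetrizing in `u` and `v` removes the third derivatives; the terms pairing `Γ` with
  -- second derivatives of `φ` cancel by symmetry.
  simp only [riem, map_sub, map_add, key, ht.gammaL_eq hg hg' hy]
  rw [hs y hy v u, hs3 v w u, hs y hy v w, hs y hy u w, hs y hy u (gammaL _ _ _ _ _),
    hs y hy v (gammaL _ _ _ _ _),
    hg'.gammaL_symm hy' (fderiv ℝ (fderiv ℝ φ) y w u), hg'.gammaL_symm hy' (fderiv ℝ (fderiv ℝ φ) y w v)]
  abel

end Transition

/-! ### Invariance of traces, scalar curvature and Hessians -/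

section Invariants

variable {E : Type*} [NormedAddCommGroup E] [NormedSpace ℝ E] [FiniteDimensional ℝ E]
  {ι : Type*} [Fintype ι] [DecidableEq ι] {b : Basis ι ℝ E}
  {U V : Set E} {g g' : E → E →L[ℝ] E →L[ℝ] ℝ} {φ : E → E} {y : E}

/-- The bilinear form with a given matrix. -/
def ofMat (b : Basis ι ℝ E) (R : Matrix ι ι ℝ) : E →L[ℝ] E →L[ℝ] ℝ :=
  ∑ i, ∑ j, R i j • (coordL b i).smulRight (coordL b j)

theorem ofMat_apply (R : Matrix ι ι ℝ) (v w : E) :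
    ofMat b R v w = ∑ i, ∑ j, R i j * (b.repr v i * b.repr w j) := by
  simp [ofMat, sum_apply, smul_apply]

@[simp] theorem mat_ofMat (R : Matrix ι ι ℝ) : mat b (ofMat b R) = R := by
  ext i j
  simp [mat_apply, ofMat_apply, Finsupp.single_apply]

/-- Extends the trace formula for the Ricci components from basis vectors to all vectors, as needed
for comparison along a transition map that does not preserve the basis. -/
theorem ofMat_ricci_apply (hg : MetricOn U g) (hy : y ∈ U) (v w : E) :
    ofMat b (fun i j => ricci b (fun z => mat b (g z)) i j y) v w =
      LinearMap.trace ℝ E (riemL (gammaL b fun z => mat b (g z)) y w v) := by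
  have hd := (hg.contDiffAt_gammaL (b := b) hy).differentiableAt (by simp)
  induction v using basis_induction b with
  | h0 =>
    have : riemL (gammaL b fun z => mat b (g z)) y w 0 = 0 := by
      ext u; simp [riemL, riem]
    simp [this]
  | ha x z hx hz =>
    have : riemL (gammaL b fun z => mat b (g z)) y w (x + z) =
      riemL (gammaL b fun z => mat b (g z)) y w x +
        riemL (gammaL b fun z => mat b (g z)) y w z := by
      ext u; simp [riemL, riem]; abel
    simp only [map_add, add_apply, hx, hz, this]
  | hs c x hx =>
    have : riemL (gammaL b fun z => mat b (g z)) y w (c • x) =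
      c • riemL (gammaL b fun z => mat b (g z)) y w x := by
      ext u; simp [riemL, riem, smul_sub, smul_add]
    simp only [map_smul, smul_apply, hx, this]
  | hb i =>
  induction w using basis_induction b with
  | h0 =>
    have : riemL (gammaL b fun z => mat b (g z)) y 0 (b i) = 0 := by
      ext u; simp [riemL, riem]
    simp [this]
  | ha x z hx hz =>
    have : riemL (gammaL b fun z => mat b (g z)) y (x + z) (b i) =
      riemL (gammaL b fun z => mat b (g z)) y x (b i) +
        riemL (gammaL b fun z => mat b (g z)) y z (b i) := by
      ext u; simp [riemL, riem]; abel
    simp only [map_add, hx, hz, this]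
  | hs c x hx =>
    have : riemL (gammaL b fun z => mat b (g z)) y (c • x) (b i) =
      c • riemL (gammaL b fun z => mat b (g z)) y x (b i) := by
      ext u; simp [riemL, riem, smul_sub, smul_add]
    simp only [map_smul, hx, this]
  | hb j =>
  rw [← ricci_eq_trace hd]
  exact congrFun (congrFun (mat_ofMat (b := b) fun i j => ricci b (fun z => mat b (g z)) i j y) i) j

/-- The derivative of a transition map as a linear equivalence. -/
def IsTransition.equiv (ht : IsTransition U V φ g g') (hy : y ∈ U) : E ≃ₗ[ℝ] E :=
  LinearEquiv.ofBijective (fderiv ℝ φ y : E →ₗ[ℝ] E) (ht.bijective y hy)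

theorem IsTransition.equiv_apply (ht : IsTransition U V φ g g') (hy : y ∈ U) (v : E) :
    ht.equiv hy v = fderiv ℝ φ y v := rfl

/-- The two curvature endomorphisms are conjugate by the derivative of `φ`, and conjugate
endomorphisms have equal traces. -/
theorem IsTransition.ricci_eq (ht : IsTransition U V φ g g') (hg : MetricOn U g)
    (hg' : MetricOn V g') (hy : y ∈ U) (v w : E) :
    LinearMap.trace ℝ E (riemL (gammaL b fun z => mat b (g z)) y v w) =
      LinearMap.trace ℝ E (riemL (gammaL b fun z => mat b (g' z)) (φ y) (fderiv ℝ φ y v)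
        (fderiv ℝ φ y w)) := by
  rw [← LinearMap.trace_conj' _ (ht.equiv hy)]
  congr 1
  ext u
  obtain ⟨u, rfl⟩ := (ht.equiv hy).surjective u
  rw [LinearEquiv.conj_apply_apply, LinearEquiv.symm_apply_apply]
  exact ht.riem_eq hg hg' hy u v w

/-- Both matrices at `y` are those of the forms at `φ y` in the image basis, so this is a change of
basis. -/
theorem IsTransition.trace_eq (ht : IsTransition U V φ g g') (hg' : MetricOn V g') (hy : y ∈ U)
    {B B' : E →L[ℝ] E →L[ℝ] ℝ} (hB : ∀ v w, B v w = B' (fderiv ℝ φ y v) (fderiv ℝ φ y w)) :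
    trace (mat b (g y)) (mat b B) = trace (mat b (g' (φ y))) (mat b B') := by
  have h1 : mat b (g y) = mat (b.map (ht.equiv hy)) (g' (φ y)) := by
    ext i j
    simp [mat_apply, ht.equiv_apply, ht.pullback y hy]
  have h2 : mat b B = mat (b.map (ht.equiv hy)) B' := by
    ext i j
    simp [mat_apply, ht.equiv_apply, hB]
  rw [h1, h2, trace_basis_change b _ _ _ (hg'.isUnit (ht.mapsTo y hy))]

/-- The scalar curvature is invariant under changes of coordinates. -/
theorem IsTransition.scalar_eq (ht : IsTransition U V φ g g') (hg : MetricOn U g)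
    (hg' : MetricOn V g') (hy : y ∈ U) :
    scalar b (fun z => mat b (g z)) y = scalar b (fun z => mat b (g' z)) (φ y) := by
  unfold scalar
  rw [← mat_ofMat (b := b) (fun i j => ricci b (fun z => mat b (g z)) i j y),
    ← mat_ofMat (b := b) (fun i j => ricci b (fun z => mat b (g' z)) i j (φ y))]
  refine ht.trace_eq hg' hy fun v w => ?_
  rw [ofMat_ricci_apply hg hy, ofMat_ricci_apply hg' (ht.mapsTo y hy), ht.ricci_eq hg hg' hy]

/-- The covariant Hessian of a function. -/
def hess (b : Basis ι ℝ E) (G : E → Matrix ι ι ℝ) (q : E → ℝ) (y : E) : E →L[ℝ] E →L[ℝ] ℝ :=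
  fderiv ℝ (fderiv ℝ q) y - (ContinuousLinearMap.compL ℝ E E ℝ (fderiv ℝ q y)).comp (gammaL b G y)

theorem hess_apply (G : E → Matrix ι ι ℝ) (q : E → ℝ) (y v w : E) :
    hess b G q y v w = fderiv ℝ (fderiv ℝ q) y v w - fderiv ℝ q y (gammaL b G y v w) := rfl

theorem fderiv_comp_of_contDiffAt {E' : Type*} [NormedAddCommGroup E'] [NormedSpace ℝ E']
    {φ : E' → E} {q : E → ℝ} {z : E'} (hφ : DifferentiableAt ℝ φ z)
    (hq : DifferentiableAt ℝ q (φ z)) (v : E') :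
    fderiv ℝ (fun z => q (φ z)) z v = fderiv ℝ q (φ z) (fderiv ℝ φ z v) := by
  have := HasFDerivAt.comp (g := q) (f := φ) z hq.hasFDerivAt hφ.hasFDerivAt
  exact congrArg (fun L => L v) this.fderiv

theorem fderiv_fderiv_comp {E' : Type*} [NormedAddCommGroup E'] [NormedSpace ℝ E']
    {φ : E' → E} {q : E → ℝ} {z : E'} (hφ : ContDiffAt ℝ ∞ φ z)
    (hq : ContDiffAt ℝ ∞ q (φ z)) (v w : E') :
    fderiv ℝ (fderiv ℝ (fun z => q (φ z))) z v w =
      fderiv ℝ (fderiv ℝ q) (φ z) (fderiv ℝ φ z v) (fderiv ℝ φ z w) +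
        fderiv ℝ q (φ z) (fderiv ℝ (fderiv ℝ φ) z v w) := by
  have hd : DifferentiableAt ℝ φ z := hφ.differentiableAt (by simp)
  have hφ1 : ContDiffAt ℝ ∞ (fderiv ℝ φ) z := hφ.fderiv_right le_rfl
  have hd1 := (hφ1.differentiableAt (by simp)).hasFDerivAt
  have hq1 := (((hq.fderiv_right (m := ∞) le_rfl).differentiableAt (by simp))).hasFDerivAt
  have hev : (fun x => fderiv ℝ (fun x => q (φ x)) x) =ᶠ[𝓝 z]
      fun x => (fderiv ℝ q (φ x)).comp (fderiv ℝ φ x) := by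
    have h1 : ∀ᶠ x in 𝓝 (φ z), DifferentiableAt ℝ q x :=
      ((hq.of_le (m := 1) (by simp)).eventually (by simp)).mono fun x hx =>
        hx.differentiableAt (by simp)
    have h2 : ∀ᶠ x in 𝓝 z, DifferentiableAt ℝ φ x :=
      ((hφ.of_le (m := 1) (by simp)).eventually (by simp)).mono fun x hx =>
        hx.differentiableAt (by simp)
    filter_upwards [hd.continuousAt h1, h2] with x hx hx'
    ext v
    exact fderiv_comp_of_contDiffAt hx' hx v
  have hqφ : HasFDerivAt (fun x => fderiv ℝ q (φ x)) _ z :=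
    HasFDerivAt.comp (g := fderiv ℝ q) (f := φ) z hq1 hd.hasFDerivAt
  rw [hev.fderiv_eq, (hqφ.clm_comp hd1).fderiv]
  simp [add_comm]

/-- The term with `d²φ` from the chain rule cancels against the inhomogeneous term in the
transformation law of `Γ`. -/
theorem IsTransition.hess_eq (ht : IsTransition U V φ g g') (hg : MetricOn U g)
    (hg' : MetricOn V g') (hy : y ∈ U) {q : E → ℝ} (hq : ContDiffAt ℝ ∞ q (φ y)) (v w : E) :
    hess b (fun z => mat b (g z)) (fun z => q (φ z)) y v w =
      hess b (fun z => mat b (g' z)) q (φ y) (fderiv ℝ φ y v) (fderiv ℝ φ y w) := by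
  rw [hess_apply, hess_apply, fderiv_fderiv_comp (ht.smooth y hy) hq,
    fderiv_comp_of_contDiffAt ((ht.smooth y hy).differentiableAt (by simp))
      (hq.differentiableAt (by simp)), ht.gammaL_eq hg hg' hy, map_add]
  ring

end Invariants

/-! ### Tensors in charts -/

section Charts

variable {E : Type*} [NormedAddCommGroup E] [NormedSpace ℝ E]
  {H : Type*} [TopologicalSpace H] {I : ModelWithCorners ℝ E H}
  {M : Type*} [TopologicalSpace M] [ChartedSpace H M]

/-- The bilinear form of `T` in the chart at `p`. -/
def chartForm (T : Tensor₂ I M) (p : M) (y : E) : E →L[ℝ] E →L[ℝ] ℝ :=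
  let t : E →L[ℝ] E →L[ℝ] ℝ := T ((extChartAt I p).symm y)
  let d : E →L[ℝ] E := mfderiv 𝓘(ℝ, E) I (extChartAt I p).symm y
  t.bilinearComp d d

theorem chartForm_apply (T : Tensor₂ I M) (p : M) (y v w : E) :
    chartForm T p y v w = T ((extChartAt I p).symm y)
      (mfderiv 𝓘(ℝ, E) I (extChartAt I p).symm y v)
      (mfderiv 𝓘(ℝ, E) I (extChartAt I p).symm y w) := rfl

theorem coords_eq_mat {ι : Type*} (b : Basis ι ℝ E) (T : Tensor₂ I M) (p : M) (y : E) :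
    coords b T p y = mat b (chartForm T p y) := rfl

variable [IsManifold I ∞ M] [I.Boundaryless]

/-- The trivialization of the tangent bundle at `p` is inverted by the derivative of the inverse
chart, so a tensor read in the trivialization is the tensor read in the chart. -/
theorem trivializationAt_tensor_apply (T : Tensor₂ I M) (p x : M)
    (hx : x ∈ (chartAt H p).source) :
    (trivializationAt (E →L[ℝ] E →L[ℝ] ℝ)
      (fun x : M => TangentSpace I x →L[ℝ] TangentSpace I x →L[ℝ] ℝ) p
        (Bundle.TotalSpace.mk' (E →L[ℝ] E →L[ℝ] ℝ) x (T x))).2 =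
      chartForm T p (extChartAt I p x) := by
  have hx' : (extChartAt I p).symm (extChartAt I p x) = x :=
    (extChartAt I p).left_inv (by simpa using hx)
  have : IsManifold I 1 M := IsManifold.of_le (n := ∞) (by simp)
  have hs := TangentBundle.symmL_trivializationAt (𝕜 := ℝ) (I := I) hx
  rw [I.range_eq_univ, mfderivWithin_univ] at hs
  rw [hom_trivializationAt_apply]
  ext v w
  have h1 : ∀ ψ : TangentSpace I x →L[ℝ] ℝ,
      (trivializationAt (E →L[ℝ] ℝ) (fun x : M => TangentSpace I x →L[ℝ] ℝ) p).continuousLinearMapAt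
        ℝ x ψ w = ψ ((trivializationAt E (TangentSpace I) p).symmL ℝ x w) := by
    intro ψ
    rw [Bundle.Trivialization.continuousLinearMapAt_apply,
      Bundle.Trivialization.coe_linearMapAt_of_mem _ (by simp [hx])]
    beta_reduce
    rw [hom_trivializationAt_apply]
    simp [ContinuousLinearMap.inCoordinates]
  -- The base points `x` and its image under chart and inverse chart agree; the forms there are
  -- compared in the common model space.
  have h2 : ∀ x' : M, x' = x → ∀ a c : E,
      (T x' : E →L[ℝ] E →L[ℝ] ℝ) a c = (T x : E →L[ℝ] E →L[ℝ] ℝ) a c := by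
    rintro x' rfl a c
    rfl
  simp only [ContinuousLinearMap.inCoordinates, ContinuousLinearMap.comp_apply]
  rw [h1, hs, chartForm_apply]
  exact (h2 _ hx' _ _).symm

/-- Used in both directions: to extract smooth coefficients from `γ`, and to recognise the
constructed `g` and `K` as smooth. -/
theorem contMDiff_tensor_iff (T : Tensor₂ I M) :
    ContMDiff I (I.prod 𝓘(ℝ, E →L[ℝ] E →L[ℝ] ℝ)) ∞
      (fun x : M => Bundle.TotalSpace.mk' (E →L[ℝ] E →L[ℝ] ℝ)
        (E := fun x : M => TangentSpace I x →L[ℝ] TangentSpace I x →L[ℝ] ℝ) x (T x)) ↔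
    ∀ p, ContDiffOn ℝ ∞ (chartForm T p) (extChartAt I p).target := by
  have key : ∀ p, ContMDiffOn I (I.prod 𝓘(ℝ, E →L[ℝ] E →L[ℝ] ℝ)) ∞
      (fun x : M => Bundle.TotalSpace.mk' (E →L[ℝ] E →L[ℝ] ℝ)
        (E := fun x : M => TangentSpace I x →L[ℝ] TangentSpace I x →L[ℝ] ℝ) x (T x))
        (chartAt H p).source ↔
      ContDiffOn ℝ ∞ (chartForm T p) (extChartAt I p).target := by
    intro p
    have hb : (chartAt H p).source ⊆ (trivializationAt (E →L[ℝ] E →L[ℝ] ℝ)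
        (fun x : M => TangentSpace I x →L[ℝ] TangentSpace I x →L[ℝ] ℝ) p).baseSet := by
      intro x hx
      simp [hx]
    have h := Bundle.Trivialization.contMDiffOn_section_iff (F := E →L[ℝ] E →L[ℝ] ℝ)
      (E := fun x : M => TangentSpace I x →L[ℝ] TangentSpace I x →L[ℝ] ℝ) (IB := I) (n := ∞)
      (s := T) (trivializationAt (E →L[ℝ] E →L[ℝ] ℝ)
        (fun x : M => TangentSpace I x →L[ℝ] TangentSpace I x →L[ℝ] ℝ) p) (chartAt H p).open_source hb
    rw [h]
    have hset : (extChartAt I p).source = (chartAt H p).source := extChartAt_source I p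
    constructor
    · intro hc
      rw [← contMDiffOn_iff_contDiffOn]
      have h1 : ContMDiffOn I 𝓘(ℝ, E →L[ℝ] E →L[ℝ] ℝ) ∞
          (fun x => chartForm T p (extChartAt I p x)) (chartAt H p).source :=
        hc.congr fun x hx => (trivializationAt_tensor_apply T p x hx).symm
      refine (h1.comp (contMDiffOn_extChartAt_symm p) fun y hy => ?_).congr fun y hy => ?_
      · exact hset ▸ (extChartAt I p).map_target hy
      · simp only [Function.comp_apply, (extChartAt I p).right_inv hy]
    · intro hc
      rw [← contMDiffOn_iff_contDiffOn] at hc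
      refine (hc.comp (contMDiffOn_extChartAt (x := p)) fun x hx => ?_).congr fun x hx => ?_
      · exact (extChartAt I p).map_source (hset ▸ hx)
      · exact trivializationAt_tensor_apply T p x hx
  refine ⟨fun h p => (key p).1 h.contMDiffOn, fun h p => ?_⟩
  exact ((key p).2 (h p)).contMDiffAt ((chartAt H p).open_source.mem_nhds (mem_chart_source H p))

theorem mfderiv_extChartAt_symm_bijective (p : M) {y : E} (hy : y ∈ (extChartAt I p).target) :
    Function.Bijective (mfderiv 𝓘(ℝ, E) I (extChartAt I p).symm y) := by
  have : IsManifold I 1 M := IsManifold.of_le (n := ∞) (by simp)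
  have h := isInvertible_mfderivWithin_extChartAt_symm (I := I) hy
  rw [I.range_eq_univ, mfderivWithin_univ] at h
  exact h.bijective

theorem metricOn_chartForm (γ : Bundle.ContMDiffRiemannianMetric I ∞ E
    (fun x : M => TangentSpace I x)) (p : M) :
    MetricOn (extChartAt I p).target (chartForm γ.inner p) where
  isOpen := isOpen_extChartAt_target p
  smooth y hy := ((contMDiff_tensor_iff γ.inner).1 γ.contMDiff p).contDiffAt
    ((isOpen_extChartAt_target p).mem_nhds hy)
  symm y _ v w := by
    rw [chartForm_apply, chartForm_apply]
    exact γ.symm _ _ _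
  pos y hy v hv := by
    rw [chartForm_apply]
    refine γ.pos _ _ fun h => hv ?_
    exact (mfderiv_extChartAt_symm_bijective p hy).1
      (h.trans (map_zero (mfderiv 𝓘(ℝ, E) I (extChartAt I p).symm y)).symm)

/-- The change of coordinates from the chart at `p` to the chart at `q`. -/
def transition (I : ModelWithCorners ℝ E H) (p q : M) (y : E) : E :=
  extChartAt I q ((extChartAt I p).symm y)

/-- The domain of `transition`. -/
def transitionSource (I : ModelWithCorners ℝ E H) (p q : M) : Set E :=
  (extChartAt I p).target ∩ (extChartAt I p).symm ⁻¹' (extChartAt I q).source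

omit [IsManifold I ∞ M] in
theorem isOpen_transitionSource (p q : M) : IsOpen (transitionSource I p q) :=
  (continuousOn_extChartAt_symm p).isOpen_inter_preimage (isOpen_extChartAt_target p)
    (isOpen_extChartAt_source q)

theorem contDiffAt_transition {p q : M} {y : E} (hy : y ∈ transitionSource I p q) :
    ContDiffAt ℝ ∞ (transition I p q) y := by
  have h1 : ContMDiffAt 𝓘(ℝ, E) I ∞ (extChartAt I p).symm y :=
    (contMDiffOn_extChartAt_symm p).contMDiffAt (extChartAt_target_mem_nhds' hy.1)
  have h2 : ContMDiffAt I 𝓘(ℝ, E) ∞ (extChartAt I q) ((extChartAt I p).symm y) :=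
    contMDiffAt_extChartAt' (by simpa using hy.2)
  exact (h2.comp y h1).contDiffAt

variable (I) in
/-- The derivative of the inverse of the chart at `p`, in the model space. -/
def symmDeriv (p : M) (y : E) : E →L[ℝ] E := mfderiv 𝓘(ℝ, E) I (extChartAt I p).symm y

/-- The chain rule for the inverse chart at `p`, written as the inverse chart at `q` after the
transition map. -/
theorem mfderiv_symm_eq {p q : M} {y : E} (hy : y ∈ transitionSource I p q) (v : E) :
    (mfderiv 𝓘(ℝ, E) I (extChartAt I p).symm y v : E) =
      mfderiv 𝓘(ℝ, E) I (extChartAt I q).symm (transition I p q y)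
        (fderiv ℝ (transition I p q) y v) := by
  have : IsManifold I 1 M := IsManifold.of_le (n := ∞) (by simp)
  have hev : (extChartAt I p).symm =ᶠ[𝓝 y] (extChartAt I q).symm ∘ transition I p q := by
    filter_upwards [(isOpen_transitionSource p q).mem_nhds hy] with z hz
    exact ((extChartAt I q).left_inv hz.2).symm
  have hq : transition I p q y ∈ (extChartAt I q).target := (extChartAt I q).map_source hy.2
  have h1 : MDifferentiableAt 𝓘(ℝ, E) I (extChartAt I q).symm (transition I p q y) :=
    ((contMDiffOn_extChartAt_symm (n := ∞) q).contMDiffAt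
      (extChartAt_target_mem_nhds' hq)).mdifferentiableAt (by simp)
  have h2 : DifferentiableAt ℝ (transition I p q) y :=
    (contDiffAt_transition hy).differentiableAt (by simp)
  have h3 := hev.mfderiv_eq (I := 𝓘(ℝ, E)) (I' := I)
  have h4 := mfderiv_comp y h1 h2.mdifferentiableAt
  rw [mfderiv_eq_fderiv] at h4
  have h5 : symmDeriv I p y =
    (symmDeriv I q (transition I p q y)).comp (fderiv ℝ (transition I p q) y) := h3.trans h4
  exact congrArg (fun L : E →L[ℝ] E => L v) h5

theorem chartForm_transition (T : Tensor₂ I M) {p q : M} {y : E}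
    (hy : y ∈ transitionSource I p q) (v w : E) :
    chartForm T p y v w = chartForm T q (transition I p q y)
      (fderiv ℝ (transition I p q) y v) (fderiv ℝ (transition I p q) y w) := by
  have h2 : ∀ x x' : M, x' = x → ∀ a c : E,
      (T x' : E →L[ℝ] E →L[ℝ] ℝ) a c = (T x : E →L[ℝ] E →L[ℝ] ℝ) a c := by
    rintro x x' rfl a c
    rfl
  have h3 : (extChartAt I q).symm (transition I p q y) = (extChartAt I p).symm y :=
    (extChartAt I q).left_inv hy.2
  rw [chartForm_apply, chartForm_apply]
  refine Eq.trans ?_ (h2 _ _ h3 _ _).symm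
  rw [← mfderiv_symm_eq hy v, ← mfderiv_symm_eq hy w]

theorem isTransition_transition [FiniteDimensional ℝ E] (T : Tensor₂ I M) (p q : M) :
    IsTransition (transitionSource I p q) (extChartAt I q).target (transition I p q)
      (chartForm T p) (chartForm T q) where
  mapsTo y hy := (extChartAt I q).map_source hy.2
  smooth y hy := contDiffAt_transition hy
  bijective y hy := by
    have hinj : Function.Injective (fderiv ℝ (transition I p q) y) := by
      intro v w h
      refine (mfderiv_extChartAt_symm_bijective p hy.1).1 ?_
      have h1 := mfderiv_symm_eq hy v
      rw [h] at h1
      exact h1.trans (mfderiv_symm_eq hy w).symm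
    exact ⟨hinj, (LinearMap.injective_iff_surjective (f := (fderiv ℝ (transition I p q) y :
      E →ₗ[ℝ] E))).1 hinj⟩
  pullback y hy v w := chartForm_transition T hy v w

theorem MetricOn.mono {U V : Set E} {g : E → E →L[ℝ] E →L[ℝ] ℝ} (h : MetricOn V g) (hU : IsOpen U)
    (hUV : U ⊆ V) : MetricOn U g :=
  ⟨hU, fun y hy => h.smooth y (hUV hy), fun y hy => h.symm y (hUV hy),
    fun y hy => h.pos y (hUV hy)⟩

theorem metricOn_transitionSource (γ : Bundle.ContMDiffRiemannianMetric I ∞ E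
    (fun x : M => TangentSpace I x)) (p q : M) :
    MetricOn (transitionSource I p q) (chartForm γ.inner p) :=
  (metricOn_chartForm γ p).mono (isOpen_transitionSource p q) Set.inter_subset_left

omit [IsManifold I ∞ M] [I.Boundaryless] in
theorem mem_transitionSource {p q : M} (hp : p ∈ (chartAt H q).source) :
    extChartAt I p p ∈ transitionSource I p q :=
  ⟨mem_extChartAt_target p, by simpa using hp⟩

omit [IsManifold I ∞ M] [I.Boundaryless] in
theorem transition_self (p q : M) : transition I p q (extChartAt I p p) = extChartAt I q p := by
  simp [transition]

variable {ι : Type*} [Fintype ι] [DecidableEq ι] (b : Basis ι ℝ E)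

/-- The definition uses a different chart at each point; this fixes one chart for all points near
`q`, which continuity at `q` requires. -/
theorem scalarCurvature_eq [FiniteDimensional ℝ E] (γ : Bundle.ContMDiffRiemannianMetric I ∞ E
    (fun x : M => TangentSpace I x)) {p q : M} (hp : p ∈ (chartAt H q).source) :
    scalarCurvature b γ.inner p = scalar b (coords b γ.inner q) (extChartAt I q p) := by
  rw [← transition_self p q]
  exact (isTransition_transition γ.inner p q).scalar_eq (metricOn_transitionSource γ p q)
    (metricOn_chartForm γ q) (mem_transitionSource hp)

theorem continuous_scalarCurvature [FiniteDimensional ℝ E]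
    (γ : Bundle.ContMDiffRiemannianMetric I ∞ E (fun x : M => TangentSpace I x)) :
    Continuous (scalarCurvature b γ.inner) := by
  refine continuous_iff_continuousAt.2 fun q => ?_
  have hs : ContinuousAt (fun p => scalar b (coords b γ.inner q) (extChartAt I q p)) q := by
    have hm := metricOn_chartForm γ q
    have hq := mem_extChartAt_target (I := I) q
    have h1 : ContinuousAt (scalar b (coords b γ.inner q)) (extChartAt I q q) :=
      (contDiffAt_scalar b (hm.contDiffAt_mat hq) (hm.isUnit hq)).continuousAt
    exact ContinuousAt.comp (f := extChartAt I q) h1 (continuousAt_extChartAt q)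
  refine hs.congr ?_
  filter_upwards [(chartAt H q).open_source.mem_nhds (mem_chart_source H q)] with p hp
  exact (scalarCurvature_eq b γ hp).symm

end Charts

open scoped Pointwise

/-! ### Warped tensors on the cylinder -/

section Warped

/-- The bilinear form `a dt² + c B` on `Plane × ℝ`. -/
def warpedForm (B : Plane →L[ℝ] Plane →L[ℝ] ℝ) (a c : ℝ) :
    (Plane × ℝ) →L[ℝ] (Plane × ℝ) →L[ℝ] ℝ :=
  a • (ContinuousLinearMap.snd ℝ Plane ℝ).smulRight (ContinuousLinearMap.snd ℝ Plane ℝ) +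
    c • B.bilinearComp (ContinuousLinearMap.fst ℝ Plane ℝ) (ContinuousLinearMap.fst ℝ Plane ℝ)

theorem warpedForm_apply (B : Plane →L[ℝ] Plane →L[ℝ] ℝ) (a c : ℝ) (v w : Plane × ℝ) :
    warpedForm B a c v w = a * (v.2 * w.2) + c * B v.1 w.1 := by
  simp [warpedForm, add_apply, smul_apply]

/-- The value of a tensor as a bilinear form on the model space. -/
def modelForm {E H M : Type*} [NormedAddCommGroup E] [NormedSpace ℝ E] [TopologicalSpace H]
    {I : ModelWithCorners ℝ E H} [TopologicalSpace M] [ChartedSpace H M] (T : Tensor₂ I M) (x : M) :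
    E →L[ℝ] E →L[ℝ] ℝ := T x

variable {S : Type*} [TopologicalSpace S] [ChartedSpace Plane S] [IsManifold (𝓡 2) ∞ S]

/-- The tensor `a(t) dt² + c(t) γ`. -/
def warped (γ : Tensor₂ (𝓡 2) S) (a c : ℝ → ℝ) : Tensor₂ cylModel (S × ℝ) :=
  fun x =>
    warpedForm (modelForm γ x.1) (a x.2) (c x.2)

theorem warped_apply (γ : Tensor₂ (𝓡 2) S) (a c : ℝ → ℝ) (x : S × ℝ) (v w : Plane × ℝ) :
    modelForm (warped γ a c) x v w =
      a x.2 * (v.2 * w.2) + c x.2 * modelForm γ x.1 v.1 w.1 :=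
  warpedForm_apply _ _ _ _ _

theorem extChartAt_cyl (x : S × ℝ) :
    extChartAt cylModel x = (extChartAt (𝓡 2) x.1).prod (PartialEquiv.refl ℝ) := by
  rw [extChartAt_prod, extChartAt_model_space_eq_id]

theorem extChartAt_cyl_apply (x z : S × ℝ) :
    extChartAt cylModel x z = (extChartAt (𝓡 2) x.1 z.1, z.2) := by
  rw [extChartAt_cyl]
  rfl

theorem symmDeriv_cyl (x : S × ℝ) {y : Plane × ℝ} (hy : y.1 ∈ (extChartAt (𝓡 2) x.1).target)
    (v : Plane × ℝ) : symmDeriv cylModel x y v = (symmDeriv (𝓡 2) x.1 y.1 v.1, v.2) := by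
  have h1 : MDifferentiableAt 𝓘(ℝ, Plane) (𝓡 2) (extChartAt (𝓡 2) x.1).symm y.1 :=
    ((contMDiffOn_extChartAt_symm (n := ∞) x.1).contMDiffAt
      (extChartAt_target_mem_nhds' hy)).mdifferentiableAt (by simp)
  have h2 : ((extChartAt cylModel x).symm : Plane × ℝ → S × ℝ) =
      fun z => ((extChartAt (𝓡 2) x.1).symm z.1, z.2) := by
    rw [extChartAt_cyl]
    rfl
  have hfst : MDifferentiableAt 𝓘(ℝ, Plane × ℝ) 𝓘(ℝ, Plane) (Prod.fst : Plane × ℝ → Plane) y :=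
    differentiableAt_fst.mdifferentiableAt
  have hsnd : MDifferentiableAt 𝓘(ℝ, Plane × ℝ) 𝓘(ℝ, ℝ) (Prod.snd : Plane × ℝ → ℝ) y :=
    differentiableAt_snd.mdifferentiableAt
  have h3 := mfderiv_prodMk (h1.comp (I := 𝓘(ℝ, Plane × ℝ)) y hfst) hsnd
  have h4 := mfderiv_comp (I := 𝓘(ℝ, Plane × ℝ)) y h1 hfst
  rw [mfderiv_eq_fderiv, fderiv_snd] at h3
  rw [mfderiv_eq_fderiv, fderiv_fst] at h4
  rw [h4] at h3
  have h5 : symmDeriv cylModel x y = ((symmDeriv (𝓡 2) x.1 y.1).comp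
      (ContinuousLinearMap.fst ℝ Plane ℝ)).prod (ContinuousLinearMap.snd ℝ Plane ℝ) := by
    rw [symmDeriv, h2]
    exact h3
  rw [h5]
  rfl

theorem chartForm_eq_symmDeriv {E H M : Type*} [NormedAddCommGroup E] [NormedSpace ℝ E]
    [TopologicalSpace H] {I : ModelWithCorners ℝ E H} [TopologicalSpace M] [ChartedSpace H M]
    (T : Tensor₂ I M) (p : M) (y v w : E) :
    chartForm T p y v w = modelForm T ((extChartAt I p).symm y)
      (symmDeriv I p y v) (symmDeriv I p y w) := rfl

theorem chartForm_warped (γ : Tensor₂ (𝓡 2) S) (a c : ℝ → ℝ) (x : S × ℝ) {y : Plane × ℝ}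
    (hy : y.1 ∈ (extChartAt (𝓡 2) x.1).target) :
    chartForm (warped γ a c) x y = warpedForm (chartForm γ x.1 y.1) (a y.2) (c y.2) := by
  refine ContinuousLinearMap.ext fun v => ContinuousLinearMap.ext fun w => ?_
  have h2 : (extChartAt cylModel x).symm y = ((extChartAt (𝓡 2) x.1).symm y.1, y.2) := by
    rw [extChartAt_cyl]
    rfl
  rw [chartForm_eq_symmDeriv, h2, symmDeriv_cyl x hy, symmDeriv_cyl x hy, warped_apply,
    warpedForm_apply, chartForm_eq_symmDeriv]

theorem contDiffOn_warpedForm {F : Type*} [NormedAddCommGroup F] [NormedSpace ℝ F] {U : Set F}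
    {B : F → Plane →L[ℝ] Plane →L[ℝ] ℝ} {a c : F → ℝ}
    (hB : ContDiffOn ℝ ∞ B U) (ha : ContDiffOn ℝ ∞ a U) (hc : ContDiffOn ℝ ∞ c U) :
    ContDiffOn ℝ ∞ (fun z => warpedForm (B z) (a z) (c z)) U := by
  rw [contDiffOn_clm_apply]
  intro v
  rw [contDiffOn_clm_apply]
  intro w
  simp only [warpedForm_apply]
  exact (ha.mul contDiffOn_const).add
    (hc.mul ((hB.clm_apply contDiffOn_const).clm_apply contDiffOn_const))

theorem extChartAt_cyl_target (x : S × ℝ) :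
    (extChartAt cylModel x).target = (extChartAt (𝓡 2) x.1).target ×ˢ Set.univ := by
  rw [extChartAt_cyl]
  rfl

theorem contDiffOn_chartForm_warped (γ : Bundle.ContMDiffRiemannianMetric (𝓡 2) ∞ Plane
    (fun x : S => TangentSpace (𝓡 2) x)) {a c : ℝ → ℝ}
    (ha : ContDiff ℝ ∞ a) (hc : ContDiff ℝ ∞ c) (x : S × ℝ) :
    ContDiffOn ℝ ∞ (chartForm (warped γ.inner a c) x) (extChartAt cylModel x).target := by
  have hfst : Set.MapsTo Prod.fst (extChartAt cylModel x).target
      (extChartAt (𝓡 2) x.1).target := fun y hy => by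
    rw [extChartAt_cyl_target] at hy
    exact hy.1
  have h1 : ContDiffOn ℝ ∞ (chartForm γ.inner x.1) (extChartAt (𝓡 2) x.1).target := fun z hz =>
    ((metricOn_chartForm γ x.1).smooth z hz).contDiffWithinAt
  have h2 : ContDiffOn ℝ ∞ (fun z : Plane × ℝ => chartForm γ.inner x.1 z.1)
      (extChartAt cylModel x).target := h1.comp contDiff_fst.contDiffOn hfst
  have h3 : ContDiffOn ℝ ∞ (fun z : Plane × ℝ => a z.2) (extChartAt cylModel x).target :=
    (ha.comp contDiff_snd).contDiffOn
  have h4 : ContDiffOn ℝ ∞ (fun z : Plane × ℝ => c z.2) (extChartAt cylModel x).target :=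
    (hc.comp contDiff_snd).contDiffOn
  exact (contDiffOn_warpedForm h2 h3 h4).congr fun y hy => chartForm_warped γ.inner a c x (hfst hy)

theorem contMDiff_warped (γ : Bundle.ContMDiffRiemannianMetric (𝓡 2) ∞ Plane
    (fun x : S => TangentSpace (𝓡 2) x)) {a c : ℝ → ℝ}
    (ha : ContDiff ℝ ∞ a) (hc : ContDiff ℝ ∞ c) :
    ContMDiff cylModel (cylModel.prod 𝓘(ℝ, (Plane × ℝ) →L[ℝ] (Plane × ℝ) →L[ℝ] ℝ)) ∞
      (fun x : S × ℝ => Bundle.TotalSpace.mk' ((Plane × ℝ) →L[ℝ] (Plane × ℝ) →L[ℝ] ℝ)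
        (E := fun x : S × ℝ => TangentSpace cylModel x →L[ℝ] TangentSpace cylModel x →L[ℝ] ℝ)
          x (warped γ.inner a c x)) := by
  rw [contMDiff_tensor_iff]
  intro x
  exact contDiffOn_chartForm_warped γ ha hc x

theorem modelForm_nonneg (γ : Bundle.ContMDiffRiemannianMetric (𝓡 2) ∞ Plane
    (fun x : S => TangentSpace (𝓡 2) x)) (x : S) (v : Plane) : 0 ≤ modelForm γ.inner x v v := by
  by_cases h : v = 0
  · rw [h, map_zero]
  · exact (γ.pos x v h).le

/-- The metric `a(t) dt² + c(t) γ`. -/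
def warpedMetric (γ : Bundle.ContMDiffRiemannianMetric (𝓡 2) ∞ Plane
    (fun x : S => TangentSpace (𝓡 2) x)) (a c : ℝ → ℝ)
    (ha : ContDiff ℝ ∞ a) (hc : ContDiff ℝ ∞ c) (ha0 : ∀ t, 0 < a t) (hc0 : ∀ t, 0 < c t) :
    Bundle.ContMDiffRiemannianMetric cylModel ∞ (Plane × ℝ)
      (fun x : S × ℝ => TangentSpace cylModel x) where
  inner := warped γ.inner a c
  symm x v w := by
    refine (warped_apply γ.inner a c x v w).trans (Eq.trans ?_ (warped_apply γ.inner a c x w v).symm)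
    have h : modelForm γ.inner x.1 v.1 w.1 =
      modelForm γ.inner x.1 w.1 v.1 := γ.symm x.1 v.1 w.1
    rw [h, mul_comm v.2 w.2]
  pos x v hv := by
    refine lt_of_lt_of_eq ?_ (warped_apply γ.inner a c x v v).symm
    have h0 := modelForm_nonneg γ x.1 (Prod.fst (α := Plane) (β := ℝ) v)
    by_cases h3 : Prod.snd (α := Plane) (β := ℝ) v = 0
    · refine add_pos_of_nonneg_of_pos (mul_nonneg (ha0 _).le (mul_self_nonneg _))
        (mul_pos (hc0 _) (γ.pos x.1 _ fun h1 => hv (Prod.ext h1 h3)))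
    · exact add_pos_of_pos_of_nonneg (mul_pos (ha0 _) (mul_self_pos.2 h3))
        (mul_nonneg (hc0 _).le h0)
  isVonNBounded x := by
    have hA : Bornology.IsVonNBounded ℝ
      {v : Plane | modelForm γ.inner x.1 v v < 1} := γ.isVonNBounded x.1
    rw [NormedSpace.isVonNBounded_iff] at hA
    have hB := (hA.smul₀ (√(c x.2))⁻¹).prod (Metric.isBounded_ball (x := (0 : ℝ)) (r := √(a x.2)⁻¹))
    rw [← NormedSpace.isVonNBounded_iff ℝ] at hB
    -- A vector of length less than `1` has both its horizontal and its vertical part of length less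
    -- than `1`, so the unit ball lies in a product of two bounded sets.
    have hsub : {v : Plane × ℝ | a x.2 * (v.2 * v.2) +
        c x.2 * modelForm γ.inner x.1 v.1 v.1 < 1} ⊆
      ((√(c x.2))⁻¹ • {v : Plane | modelForm γ.inner x.1 v v < 1}) ×ˢ
        Metric.ball (0 : ℝ) √(a x.2)⁻¹ := by
      intro v hv
      have hv' : a x.2 * (v.2 * v.2) + c x.2 * modelForm γ.inner x.1 v.1 v.1 < 1 := hv
      have hc1 : 0 < √(c x.2) := Real.sqrt_pos.2 (hc0 _)
      have h0 := modelForm_nonneg γ x.1 v.1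
      have h1 := mul_nonneg (hc0 x.2).le h0
      have h2 := mul_nonneg (ha0 x.2).le (mul_self_nonneg v.2)
      constructor
      · refine Set.mem_smul_set.2 ⟨√(c x.2) • v.1, ?_, ?_⟩
        · simp only [Set.mem_ofPred_eq, map_smul, smul_apply, smul_eq_mul]
          rw [← mul_assoc, Real.mul_self_sqrt (hc0 _).le]
          linarith
        · rw [smul_smul, inv_mul_cancel₀ hc1.ne', one_smul]
      · rw [Metric.mem_ball, dist_zero_right, Real.norm_eq_abs]
        rw [← Real.sqrt_sq_eq_abs]
        apply Real.sqrt_lt_sqrt (sq_nonneg _)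
        rw [← one_div, lt_div_iff₀ (ha0 _)]
        nlinarith
    have hC := hB.subset hsub
    have hset : {v : Plane × ℝ | modelForm (warped γ.inner a c) x v v < 1} = {v : Plane × ℝ | a x.2 * (v.2 * v.2) +
        c x.2 * modelForm γ.inner x.1 v.1 v.1 < 1} := by
      ext v
      rw [Set.mem_ofPred_eq, Set.mem_ofPred_eq, warped_apply]
    rw [← hset] at hC
    exact hC
  contMDiff := contMDiff_warped γ ha hc

/-- The initial data `g = L² dt² + r(t)² γ`, `K = k(t) dt² + m(t) γ`. -/
def warpedData (γ : Bundle.ContMDiffRiemannianMetric (𝓡 2) ∞ Plane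
    (fun x : S => TangentSpace (𝓡 2) x)) {L : ℝ} (hL : 0 < L) {r k m : ℝ → ℝ}
    (hr : ContDiff ℝ ∞ r) (hk : ContDiff ℝ ∞ k) (hm : ContDiff ℝ ∞ m) (hr0 : ∀ t, 0 < r t) :
    InitialData cylModel (S × ℝ) where
  g := warpedMetric γ (fun _ => L ^ 2) (fun t => r t ^ 2) contDiff_const (hr.pow 2)
    (fun _ => pow_pos hL 2) (fun t => pow_pos (hr0 t) 2)
  K := warped γ.inner k m
  symm x v w := by
    refine (warped_apply γ.inner k m x v w).trans (Eq.trans ?_ (warped_apply γ.inner k m x w v).symm)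
    have h : modelForm γ.inner x.1 v.1 w.1 =
      modelForm γ.inner x.1 w.1 v.1 := γ.symm x.1 v.1 w.1
    rw [h, mul_comm v.2 w.2]
  smooth := contMDiff_warped γ hk hm

end Warped

/-! ### Curvature of a warped product in coordinates -/

section WarpedCurvature

theorem cylBasis_inl (i : Fin 2) : cylBasis (Sum.inl i) = (planeBasis i, 0) := by
  simp [cylBasis]

theorem cylBasis_inr (u : Unit) : cylBasis (Sum.inr u) = (0, 1) := by
  simp [cylBasis]

theorem mat_warpedForm (B : Plane →L[ℝ] Plane →L[ℝ] ℝ) (a c : ℝ) :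
    mat cylBasis (warpedForm B a c) =
      Matrix.fromBlocks (c • mat planeBasis B) 0 0 (a • (1 : Matrix Unit Unit ℝ)) := by
  ext i j
  rcases i with i | i <;> rcases j with j | j <;>
    simp [mat_apply, warpedForm_apply, cylBasis_inl, cylBasis_inr]

theorem inv_mat_warpedForm {B : Plane →L[ℝ] Plane →L[ℝ] ℝ} {a c : ℝ} (ha : a ≠ 0) (hc : c ≠ 0)
    (hB : IsUnit (mat planeBasis B).det) :
    (mat cylBasis (warpedForm B a c))⁻¹ =
      Matrix.fromBlocks (c⁻¹ • (mat planeBasis B)⁻¹) 0 0 (a⁻¹ • (1 : Matrix Unit Unit ℝ)) := by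
  apply Matrix.inv_eq_right_inv
  rw [mat_warpedForm, Matrix.fromBlocks_multiply]
  simp [Matrix.mul_nonsing_inv _ hB, smul_smul, hc, ha, Matrix.fromBlocks_one]

/-- Coordinate derivatives of a function with separated variables. -/
theorem pd_cyl {f : Plane × ℝ → ℝ} {F : Plane → ℝ} {c : ℝ → ℝ} {y : Plane × ℝ}
    (hF : DifferentiableAt ℝ F y.1) (hc : DifferentiableAt ℝ c y.2)
    (hf : f =ᶠ[𝓝 y] fun z => c z.2 * F z.1) :
    (∀ i, pd cylBasis f (Sum.inl i) y = c y.2 * pd planeBasis F i y.1) ∧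
      ∀ u, pd cylBasis f (Sum.inr u) y = deriv c y.2 * F y.1 := by
  have h1 : HasFDerivAt (fun z : Plane × ℝ => F z.1) _ y :=
    HasFDerivAt.comp (g := F) (f := Prod.fst) y hF.hasFDerivAt hasFDerivAt_fst
  have h2 : HasFDerivAt (fun z : Plane × ℝ => c z.2) _ y :=
    HasFDerivAt.comp (g := c) (f := Prod.snd) y hc.hasDerivAt.hasFDerivAt hasFDerivAt_snd
  have h3 : fderiv ℝ (fun z : Plane × ℝ => c z.2 * F z.1) y = _ := (h2.mul h1).fderiv
  constructor <;> intro i <;> rw [pd, hf.fderiv_eq, h3]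
  · simp [cylBasis_inl, pd]
  · simp [cylBasis_inr, mul_comm]

variable {U : Set Plane} {g : Plane → Plane →L[ℝ] Plane →L[ℝ] ℝ}
  {G K : Plane × ℝ → Matrix (Fin 2 ⊕ Unit) (Fin 2 ⊕ Unit) ℝ} {L : ℝ} {r k m : ℝ → ℝ}

theorem preimage_fst_mem_nhds (hg : MetricOn U g) {y : Plane × ℝ} (hy : y.1 ∈ U) :
    ∀ᶠ z in 𝓝 y, z.1 ∈ U :=
  continuous_fst.continuousAt.eventually (hg.isOpen.mem_nhds hy)

theorem deriv_sq' {c : ℝ → ℝ} {t : ℝ} (hc : DifferentiableAt ℝ c t) :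
    deriv (fun t => c t ^ 2) t = 2 * c t * deriv c t := by
  have h : deriv (fun t => c t ^ 2) t = _ := (hc.hasDerivAt.pow 2).deriv
  rw [h]
  ring

theorem MetricOn.differentiableAt_mat (hg : MetricOn U g) {z : Plane} (hz : z ∈ U) (i j : Fin 2) :
    DifferentiableAt ℝ (fun z => g z (planeBasis i) (planeBasis j)) z :=
  (hg.contDiffAt_mat (b := planeBasis) hz i j).differentiableAt (by simp)

/-- The coordinate derivatives of the components of a warped metric. -/
theorem pd_warped (hg : MetricOn U g) (hc : Differentiable ℝ r) {a : ℝ → ℝ}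
    (ha : Differentiable ℝ a)
    (hG : ∀ z : Plane × ℝ, z.1 ∈ U → G z = mat cylBasis (warpedForm (g z.1) (a z.2) (r z.2)))
    {y : Plane × ℝ} (hy : y.1 ∈ U) :
    (∀ i j l, pd cylBasis (fun z => G z (Sum.inl i) (Sum.inl j)) (Sum.inl l) y =
      r y.2 * pd planeBasis (fun z => g z (planeBasis i) (planeBasis j)) l y.1) ∧
    (∀ i j u, pd cylBasis (fun z => G z (Sum.inl i) (Sum.inl j)) (Sum.inr u) y =
      deriv r y.2 * g y.1 (planeBasis i) (planeBasis j)) ∧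
    (∀ i u l, pd cylBasis (fun z => G z (Sum.inl i) (Sum.inr u)) l y = 0) ∧
    (∀ i u l, pd cylBasis (fun z => G z (Sum.inr u) (Sum.inl i)) l y = 0) ∧
    (∀ u u' l, pd cylBasis (fun z => G z (Sum.inr u) (Sum.inr u')) (Sum.inl l) y = 0) ∧
    (∀ u u' v, pd cylBasis (fun z => G z (Sum.inr u) (Sum.inr u')) (Sum.inr v) y =
      deriv a y.2) := by
  have h1 : ∀ i j, (fun z => G z (Sum.inl i) (Sum.inl j)) =ᶠ[𝓝 y]
      fun z => r z.2 * g z.1 (planeBasis i) (planeBasis j) := by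
    intro i j
    filter_upwards [preimage_fst_mem_nhds hg hy] with z hz
    rw [hG z hz, mat_warpedForm]
    simp [mat_apply]
  have h2 : ∀ i u, (fun z => G z (Sum.inl i) (Sum.inr u)) =ᶠ[𝓝 y] fun z => (0 : ℝ) := by
    intro i u
    filter_upwards [preimage_fst_mem_nhds hg hy] with z hz
    rw [hG z hz, mat_warpedForm]
    simp
  have h3 : ∀ i u, (fun z => G z (Sum.inr u) (Sum.inl i)) =ᶠ[𝓝 y] fun z => (0 : ℝ) := by
    intro i u
    filter_upwards [preimage_fst_mem_nhds hg hy] with z hz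
    rw [hG z hz, mat_warpedForm]
    simp
  have h4 : ∀ u u', (fun z => G z (Sum.inr u) (Sum.inr u')) =ᶠ[𝓝 y]
      fun z => a z.2 * (fun _ : Plane => (1 : ℝ)) z.1 := by
    intro u u'
    filter_upwards [preimage_fst_mem_nhds hg hy] with z hz
    rw [hG z hz, mat_warpedForm]
    simp
  refine ⟨fun i j l => ?_, fun i j u => ?_, fun i u l => ?_, fun i u l => ?_, fun u u' l => ?_,
    fun u u' v => ?_⟩
  · exact (pd_cyl (hg.differentiableAt_mat hy i j) (hc _) (h1 i j)).1 l
  · exact (pd_cyl (hg.differentiableAt_mat hy i j) (hc _) (h1 i j)).2 u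
  · rw [pd, (h2 i u).fderiv_eq]; simp
  · rw [pd, (h3 i u).fderiv_eq]; simp
  · rw [(pd_cyl (differentiableAt_const _) (ha _) (h4 u u')).1 l]
    simp [pd]
  · rw [(pd_cyl (differentiableAt_const _) (ha _) (h4 u u')).2 v]
    simp

/-- The Christoffel symbols of `L² dt² + r(t)² γ`. -/
theorem christoffel_warped (hg : MetricOn U g) (hr : Differentiable ℝ r) (hr0 : ∀ t, 0 < r t)
    (hL : 0 < L)
    (hG : ∀ z : Plane × ℝ, z.1 ∈ U → G z = mat cylBasis (warpedForm (g z.1) (L ^ 2) (r z.2 ^ 2)))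
    {y : Plane × ℝ} (hy : y.1 ∈ U) :
    (∀ l i j, christoffel cylBasis G (Sum.inl l) (Sum.inl i) (Sum.inl j) y =
      christoffel planeBasis (fun z => mat planeBasis (g z)) l i j y.1) ∧
    (∀ u i j, christoffel cylBasis G (Sum.inr u) (Sum.inl i) (Sum.inl j) y =
      -(r y.2 * deriv r y.2 / L ^ 2) * g y.1 (planeBasis i) (planeBasis j)) ∧
    (∀ u l j, christoffel cylBasis G (Sum.inl l) (Sum.inr u) (Sum.inl j) y =
      deriv r y.2 / r y.2 * if l = j then 1 else 0) ∧
    (∀ u l j, christoffel cylBasis G (Sum.inl l) (Sum.inl j) (Sum.inr u) y =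
      deriv r y.2 / r y.2 * if l = j then 1 else 0) ∧
    (∀ u l v, christoffel cylBasis G l (Sum.inr u) (Sum.inr v) y = 0) ∧
    (∀ u u' j, christoffel cylBasis G (Sum.inr u) (Sum.inr u') (Sum.inl j) y = 0) ∧
    (∀ u u' j, christoffel cylBasis G (Sum.inr u) (Sum.inl j) (Sum.inr u') y = 0) := by
  have hu := hg.isUnit (b := planeBasis) hy
  have hr' := (hr0 y.2).ne'
  obtain ⟨p1, p2, p3, p4, p5, p6⟩ := pd_warped hg (r := fun t => r t ^ 2) (hr.pow 2)
    (differentiable_const (L ^ 2)) hG hy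
  have hinv := inv_mat_warpedForm (B := g y.1) (a := L ^ 2) (c := r y.2 ^ 2) (by positivity)
    (by positivity) hu
  have hd := deriv_sq' (hr y.2)
  have hsym := hg.symm y.1 hy
  refine ⟨fun l i j => ?_, fun u i j => ?_, fun u l j => ?_, fun u l j => ?_, fun u l v => ?_,
    fun u u' j => ?_, fun u u' j => ?_⟩
  · simp only [christoffel, hG y hy, hinv, Fintype.sum_sum_type, Finset.univ_unique,
      Finset.sum_singleton, Matrix.fromBlocks_apply₁₁, Matrix.fromBlocks_apply₁₂, p1,
      Matrix.smul_apply, Matrix.zero_apply, smul_eq_mul, zero_mul, add_zero, mat_apply]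
    congr 1
    refine Finset.sum_congr rfl fun n _ => ?_
    field_simp
  · simp only [christoffel, hG y hy, hinv, Fintype.sum_sum_type, Finset.univ_unique,
      Finset.sum_singleton, Matrix.fromBlocks_apply₂₁, Matrix.fromBlocks_apply₂₂, p2, p4,
      Matrix.smul_apply, Matrix.zero_apply, smul_eq_mul, zero_mul, Finset.sum_const_zero, zero_add,
      hd, Matrix.one_apply]
    simp
    field_simp
  · have h := inv_mul_mat hu l j
    simp only [christoffel, hG y hy, hinv, Fintype.sum_sum_type, Finset.univ_unique,
      Finset.sum_singleton, Matrix.fromBlocks_apply₁₁, Matrix.fromBlocks_apply₁₂, p2, p3, p4,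
      Matrix.smul_apply, Matrix.zero_apply, smul_eq_mul, zero_mul, add_zero, hd, sub_zero]
    rw [← h, Finset.mul_sum, Finset.mul_sum]
    refine Finset.sum_congr rfl fun n _ => ?_
    field_simp
  · have h := inv_mul_mat hu l j
    simp only [christoffel, hG y hy, hinv, Fintype.sum_sum_type, Finset.univ_unique,
      Finset.sum_singleton, Matrix.fromBlocks_apply₁₁, Matrix.fromBlocks_apply₁₂, p2, p3, p4,
      Matrix.smul_apply, Matrix.zero_apply, smul_eq_mul, zero_mul, add_zero, zero_add, hd, sub_zero]
    rw [← h, Finset.mul_sum, Finset.mul_sum]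
    refine Finset.sum_congr rfl fun n _ => ?_
    field_simp
  · rcases l with l | l <;>
    simp [christoffel, hG y hy, hinv, Fintype.sum_sum_type, p3, p5, p6]
  · simp [christoffel, hG y hy, hinv, Fintype.sum_sum_type, p3, p4, p5]
  · simp [christoffel, hG y hy, hinv, Fintype.sum_sum_type, p3, p4, p5]

/-- The diagonal blocks of the Ricci tensor of `L² dt² + r(t)² γ`. -/
theorem ricci_warped (hg : MetricOn U g) (hr : ContDiff ℝ ∞ r) (hr0 : ∀ t, 0 < r t)
    (hL : 0 < L)
    (hG : ∀ z : Plane × ℝ, z.1 ∈ U → G z = mat cylBasis (warpedForm (g z.1) (L ^ 2) (r z.2 ^ 2)))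
    {y : Plane × ℝ} (hy : y.1 ∈ U) :
    (∀ i j, ricci cylBasis G (Sum.inl i) (Sum.inl j) y =
      ricci planeBasis (fun z => mat planeBasis (g z)) i j y.1 -
        (r y.2 * deriv (deriv r) y.2 + deriv r y.2 ^ 2) / L ^ 2 *
          g y.1 (planeBasis i) (planeBasis j)) ∧
    (∀ u v, ricci cylBasis G (Sum.inr u) (Sum.inr v) y =
      -2 * deriv (deriv r) y.2 / r y.2) := by
  have hr1 : Differentiable ℝ r := hr.differentiable (by simp)
  have hr2 : Differentiable ℝ (deriv r) :=
    ((contDiff_infty_iff_deriv.1 hr).2).differentiable (by simp)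
  have hr' := (hr0 y.2).ne'
  have hc := fun {z : Plane × ℝ} (hz : z.1 ∈ U) => christoffel_warped hg hr1 hr0 hL hG hz
  have hev := preimage_fst_mem_nhds hg hy
  obtain ⟨c1, c2, c3, c4, c5, c6, c7⟩ := hc hy
  have hcd := hg.contDiffAt_mat (b := planeBasis) hy
  have q1 : ∀ k i j l, pd cylBasis (christoffel cylBasis G (Sum.inl k) (Sum.inl i) (Sum.inl j))
      (Sum.inl l) y =
        pd planeBasis (christoffel planeBasis (fun z => mat planeBasis (g z)) k i j) l y.1 := by
    intro k i j l
    rw [(pd_cyl (c := fun _ => 1)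
      (F := christoffel planeBasis (fun z => mat planeBasis (g z)) k i j) ?_
      (differentiableAt_const _) ?_).1 l, one_mul]
    · exact (contDiffAt_christoffel planeBasis hcd (hg.isUnit hy) k i j).differentiableAt (by simp)
    · filter_upwards [hev] with z hz
      rw [(hc hz).1, one_mul]
  have q2 : ∀ u i j, pd cylBasis (christoffel cylBasis G (Sum.inr u) (Sum.inl i) (Sum.inl j))
      (Sum.inr ()) y = -((r y.2 * deriv (deriv r) y.2 + deriv r y.2 ^ 2) / L ^ 2) *
        g y.1 (planeBasis i) (planeBasis j) := by
    intro u i j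
    have hd : HasDerivAt (fun t => -(r t * deriv r t / L ^ 2)) _ y.2 :=
      (((hr1 y.2).hasDerivAt.mul (hr2 y.2).hasDerivAt).div_const (L ^ 2)).neg
    rw [(pd_cyl (c := fun t => -(r t * deriv r t / L ^ 2)) (hg.differentiableAt_mat hy i j)
      hd.differentiableAt ?_).2 (), hd.deriv]
    · ring
    · filter_upwards [hev] with z hz using (hc hz).2.1 u i j
  have q3 : ∀ u i u' l, pd cylBasis (christoffel cylBasis G (Sum.inr u) (Sum.inl i) (Sum.inr u'))
      l y = 0 := by
    intro u i u' l
    have : christoffel cylBasis G (Sum.inr u) (Sum.inl i) (Sum.inr u') =ᶠ[𝓝 y] fun _ => (0 : ℝ) := by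
      filter_upwards [hev] with z hz using (hc hz).2.2.2.2.2.2 u u' i
    rw [pd, this.fderiv_eq]; simp
  have q4 : ∀ n u v l, pd cylBasis (christoffel cylBasis G n (Sum.inr u) (Sum.inr v)) l y = 0 := by
    intro n u v l
    have : christoffel cylBasis G n (Sum.inr u) (Sum.inr v) =ᶠ[𝓝 y] fun _ => (0 : ℝ) := by
      filter_upwards [hev] with z hz using (hc hz).2.2.2.2.1 u n v
    rw [pd, this.fderiv_eq]; simp
  have q5 : ∀ u k, pd cylBasis (christoffel cylBasis G (Sum.inl k) (Sum.inr u) (Sum.inl k))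
      (Sum.inr ()) y =
        (deriv (deriv r) y.2 * r y.2 - deriv r y.2 * deriv r y.2) / r y.2 ^ 2 := by
    intro u k
    have hd : HasDerivAt (fun t => deriv r t / r t) _ y.2 :=
      (hr2 y.2).hasDerivAt.div (hr1 y.2).hasDerivAt hr'
    rw [(pd_cyl (c := fun t => deriv r t / r t) (F := fun _ => 1) (differentiableAt_const _)
      hd.differentiableAt ?_).2 (), hd.deriv, mul_one]
    filter_upwards [hev] with z hz
    rw [(hc hz).2.2.1 u k k, if_pos rfl]
  constructor
  · intro i j
    simp only [ricci, Fintype.sum_sum_type, Finset.univ_unique, Finset.sum_singleton, q1,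
      PUnit.default_eq_unit, q2, q3, c1, c2, c4, c5, c6, c7, sub_zero, mul_zero, zero_mul,
      add_zero]
    simp only [Fin.sum_univ_two, mul_ite, ite_mul]
    have hs := hg.symm y.1 hy (planeBasis 1) (planeBasis 0)
    fin_cases i <;> fin_cases j <;> simp [hs] <;> field_simp <;> ring
  · intro u v
    simp only [ricci, Fintype.sum_sum_type, Finset.univ_unique, Finset.sum_singleton, q4,
      PUnit.default_eq_unit, q5, c3, c5, c6, sub_zero, mul_zero, zero_mul,
      add_zero]
    simp only [Fin.sum_univ_two]
    simp
    field_simp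
    ring

theorem sum_inv_mul (hg : MetricOn U g) {y : Plane} (hy : y ∈ U) :
    ∑ i, ∑ j, (mat planeBasis (g y))⁻¹ i j * g y (planeBasis i) (planeBasis j) = 2 := by
  have h := fun i => inv_mul_mat (hg.isUnit (b := planeBasis) hy) i i
  simp only [hg.symm y hy, if_true] at h
  calc _ = ∑ i : Fin 2, (1 : ℝ) := by
        refine Finset.sum_congr rfl fun i _ => ?_
        rw [← h i]
    _ = 2 := by simp

/-- The scalar curvature of `L² dt² + r(t)² γ`. -/
theorem scalar_warped (hg : MetricOn U g) (hr : ContDiff ℝ ∞ r) (hr0 : ∀ t, 0 < r t)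
    (hL : 0 < L)
    (hG : ∀ z : Plane × ℝ, z.1 ∈ U → G z = mat cylBasis (warpedForm (g z.1) (L ^ 2) (r z.2 ^ 2)))
    {y : Plane × ℝ} (hy : y.1 ∈ U) :
    scalar cylBasis G y = scalar planeBasis (fun z => mat planeBasis (g z)) y.1 / r y.2 ^ 2 -
      (4 * (deriv (deriv r) y.2 / r y.2) + 2 * (deriv r y.2 / r y.2) ^ 2) / L ^ 2 := by
  -- The diagonal blocks suffice: the inverse metric is block diagonal, so the trace does not see
  -- the mixed Ricci components.
  obtain ⟨h1, h2⟩ := ricci_warped hg hr hr0 hL hG hy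
  have hr' := (hr0 y.2).ne'
  have hu := hg.isUnit (b := planeBasis) hy
  have hinv := inv_mat_warpedForm (B := g y.1) (a := L ^ 2) (c := r y.2 ^ 2) (by positivity)
    (by positivity) hu
  have htr := sum_inv_mul hg hy
  unfold scalar trace
  rw [hG y hy, hinv]
  simp only [Fintype.sum_sum_type, Finset.univ_unique, Finset.sum_singleton,
    Matrix.fromBlocks_apply₁₁, Matrix.fromBlocks_apply₁₂, Matrix.fromBlocks_apply₂₁,
    Matrix.fromBlocks_apply₂₂, h1, h2, Matrix.zero_apply, zero_mul, add_zero, zero_add,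
    Finset.sum_const_zero, Matrix.smul_apply, Matrix.one_apply_eq, smul_eq_mul, mul_one]
  calc _ = (∑ i, ∑ j, (mat planeBasis (g y.1))⁻¹ i j *
          ricci planeBasis (fun z => mat planeBasis (g z)) i j y.1) / r y.2 ^ 2 -
        (r y.2 * deriv (deriv r) y.2 + deriv r y.2 ^ 2) / L ^ 2 / r y.2 ^ 2 *
          (∑ i, ∑ j, (mat planeBasis (g y.1))⁻¹ i j * g y.1 (planeBasis i) (planeBasis j)) +
        (L ^ 2)⁻¹ * (-2 * deriv (deriv r) y.2 / r y.2) := by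
        congr 1
        simp only [Finset.mul_sum, Finset.sum_div, ← Finset.sum_sub_distrib]
        refine Finset.sum_congr rfl fun i _ => Finset.sum_congr rfl fun j _ => ?_
        field_simp
    _ = _ := by
      rw [htr]
      field_simp
      ring

/-- Metric compatibility of the Christoffel symbols. -/
theorem MetricOn.pd_eq (hg : MetricOn U g) {y : Plane} (hy : y ∈ U) (i j k : Fin 2) :
    pd planeBasis (fun z => g z (planeBasis i) (planeBasis j)) k y =
      ∑ l, christoffel planeBasis (fun z => mat planeBasis (g z)) l k i y *
          g y (planeBasis l) (planeBasis j) +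
        ∑ l, christoffel planeBasis (fun z => mat planeBasis (g z)) l k j y *
          g y (planeBasis i) (planeBasis l) := by
  have hd : DifferentiableAt ℝ g y := (hg.smooth y hy).differentiableAt (by simp)
  have h1 : ∀ i j, gammaL planeBasis (fun z => mat planeBasis (g z)) y (planeBasis i)
      (planeBasis j) = ∑ k, christoffel planeBasis (fun z => mat planeBasis (g z)) k i j y •
        planeBasis k := by
    intro i j
    rw [← planeBasis.sum_repr (gammaL planeBasis (fun z => mat planeBasis (g z)) y _ _)]
    simp only [repr_gammaL_basis]
  have k1 := hg.koszul (b := planeBasis) hy (planeBasis k) (planeBasis i) (planeBasis j)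
  have k2 := hg.koszul (b := planeBasis) hy (planeBasis k) (planeBasis j) (planeBasis i)
  rw [h1] at k1 k2
  simp only [map_sum, map_smul, smul_eq_mul] at k1 k2
  simp only [fun l => hg.symm y hy (planeBasis l) (planeBasis j)]
  rw [k1, k2, pd, fderiv_apply₂ hd, hg.fderiv_symm hy (planeBasis k) (planeBasis j) (planeBasis i),
    hg.fderiv_symm hy (planeBasis j) (planeBasis i) (planeBasis k),
    hg.fderiv_symm hy (planeBasis i) (planeBasis j) (planeBasis k)]
  ring

/-- The trace of `k dt² + m γ` with respect to `L² dt² + r(t)² γ`. -/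
theorem trace_warped (hg : MetricOn U g) {y : Plane} (hy : y ∈ U) {a c k m : ℝ} (ha : 0 < a)
    (hc : 0 < c) :
    trace (mat cylBasis (warpedForm (g y) a c)) (mat cylBasis (warpedForm (g y) k m)) =
      k / a + 2 * m / c := by
  have hu := hg.isUnit (b := planeBasis) hy
  have htr := sum_inv_mul hg hy
  rw [trace, inv_mat_warpedForm ha.ne' hc.ne' hu, mat_warpedForm]
  simp only [Fintype.sum_sum_type, Finset.univ_unique, Finset.sum_singleton,
    Matrix.fromBlocks_apply₁₁, Matrix.fromBlocks_apply₁₂, Matrix.fromBlocks_apply₂₁,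
    Matrix.fromBlocks_apply₂₂, Matrix.zero_apply, zero_mul, add_zero, zero_add,
    Finset.sum_const_zero, Matrix.smul_apply, Matrix.one_apply_eq, smul_eq_mul, mul_one, mat_apply]
  calc _ = (∑ i, ∑ j, (mat planeBasis (g y))⁻¹ i j * g y (planeBasis i) (planeBasis j)) *
        (m / c) + k / a := by
        congr 1
        · simp only [Finset.sum_mul]
          refine Finset.sum_congr rfl fun i _ => Finset.sum_congr rfl fun j _ => ?_
          field_simp
        · field_simp
    _ = _ := by
      rw [htr]
      ring

/-- As a trace of a matrix product, the fourfold sum can be evaluated by block multiplication. -/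
theorem normSq_eq_trace {ι : Type*} [Fintype ι] [DecidableEq ι] (G K : Matrix ι ι ℝ) :
    normSq G K = Matrix.trace ((G⁻¹).transpose * K * (G⁻¹ * K.transpose)) := by
  simp only [normSq, Matrix.trace, Matrix.diag, Matrix.mul_apply, Matrix.transpose_apply,
    Finset.sum_mul_sum]
  calc _ = ∑ i, ∑ k, ∑ j, ∑ l, G⁻¹ i k * G⁻¹ j l * K i j * K k l :=
        Finset.sum_congr rfl fun i _ => Finset.sum_comm
    _ = ∑ k, ∑ i, ∑ j, ∑ l, G⁻¹ i k * G⁻¹ j l * K i j * K k l := Finset.sum_comm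
    _ = ∑ k, ∑ j, ∑ i, ∑ l, G⁻¹ i k * G⁻¹ j l * K i j * K k l :=
        Finset.sum_congr rfl fun k _ => Finset.sum_comm
    _ = _ := Finset.sum_congr rfl fun k _ => Finset.sum_congr rfl fun j _ =>
        Finset.sum_congr rfl fun i _ => Finset.sum_congr rfl fun l _ => by ring

theorem normSq_warped (hg : MetricOn U g) {y : Plane} (hy : y ∈ U) {a c k m : ℝ} (ha : 0 < a)
    (hc : 0 < c) :
    normSq (mat cylBasis (warpedForm (g y) a c)) (mat cylBasis (warpedForm (g y) k m)) =
      (k / a) ^ 2 + 2 * (m / c) ^ 2 := by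
  have hu := hg.isUnit (b := planeBasis) hy
  have hs : (mat planeBasis (g y)).transpose = mat planeBasis (g y) := by
    ext i j
    exact hg.symm y hy _ _
  have hs' : ((mat planeBasis (g y))⁻¹).transpose = (mat planeBasis (g y))⁻¹ := by
    rw [Matrix.transpose_nonsing_inv, hs]
  rw [normSq_eq_trace, inv_mat_warpedForm ha.ne' hc.ne' hu, mat_warpedForm]
  simp only [Matrix.fromBlocks_transpose, Matrix.fromBlocks_multiply, Matrix.transpose_smul, hs,
    hs', Matrix.smul_mul, Matrix.mul_smul, Matrix.nonsing_inv_mul _ hu, Matrix.transpose_zero,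
    Matrix.transpose_one, Matrix.mul_zero, Matrix.zero_mul, Matrix.mul_one, add_zero, zero_add,
    Matrix.trace, Fintype.sum_sum_type, Matrix.diag_apply, Matrix.fromBlocks_apply₁₁,
    Matrix.fromBlocks_apply₂₂, Matrix.smul_apply, Matrix.one_apply_eq, smul_eq_mul, smul_zero]
  simp
  field_simp
  ring

/-- The momentum density of `K = k dt² + m γ` with respect to `L² dt² + r(t)² γ`. -/
theorem momentum_warped (hg : MetricOn U g) (hr : ContDiff ℝ ∞ r) (hr0 : ∀ t, 0 < r t)
    (hL : 0 < L) (hk : Differentiable ℝ k) (hm : Differentiable ℝ m)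
    (hG : ∀ z : Plane × ℝ, z.1 ∈ U → G z = mat cylBasis (warpedForm (g z.1) (L ^ 2) (r z.2 ^ 2)))
    (hK : ∀ z : Plane × ℝ, z.1 ∈ U → K z = mat cylBasis (warpedForm (g z.1) (k z.2) (m z.2)))
    {y : Plane × ℝ} (hy : y.1 ∈ U) :
    (∀ i, momentum cylBasis G K (Sum.inl i) y = 0) ∧
    (∀ u, momentum cylBasis G K (Sum.inr u) y =
      -deriv (fun t => 2 * (m t / r t ^ 2)) y.2 +
        deriv r y.2 / r y.2 * (2 * (k y.2 / L ^ 2) - 2 * (m y.2 / r y.2 ^ 2))) := by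
  have hr1 : Differentiable ℝ r := hr.differentiable (by simp)
  have hr' := (hr0 y.2).ne'
  have hu := hg.isUnit (b := planeBasis) hy
  have hinv := inv_mat_warpedForm (B := g y.1) (a := L ^ 2) (c := r y.2 ^ 2) (by positivity)
    (by positivity) hu
  obtain ⟨c1, c2, c3, c4, c5, c6, c7⟩ := christoffel_warped hg hr1 hr0 hL hG hy
  -- `K - (tr K) g` is again warped, equal to `B dt² + A γ`, so its coordinate derivatives are those
  -- already computed for warped tensors.
  set A : ℝ → ℝ := fun t => -m t - k t * r t ^ 2 / L ^ 2 with hA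
  set B : ℝ → ℝ := fun t => -(2 * (m t / r t ^ 2)) * L ^ 2 with hB
  have hdB : HasDerivAt (fun t => 2 * (m t / r t ^ 2)) _ y.2 :=
    ((hm y.2).hasDerivAt.div ((hr1 y.2).hasDerivAt.pow 2) (pow_ne_zero 2 hr')).const_mul 2
  have hAd : Differentiable ℝ A := by
    exact (hm.neg).sub ((hk.mul (hr1.pow 2)).div_const _)
  have hBd : Differentiable ℝ B :=
    ((hm.div (hr1.pow 2) fun t => pow_ne_zero 2 (hr0 t).ne').const_mul 2).neg.mul_const _
  set Q : Plane × ℝ → Matrix (Fin 2 ⊕ Unit) (Fin 2 ⊕ Unit) ℝ := fun z i j =>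
    momentumTensor G K i j z with hQdef
  have hQ : ∀ z : Plane × ℝ, z.1 ∈ U →
      Q z = mat cylBasis (warpedForm (g z.1) (B z.2) (A z.2)) := by
    intro z hz
    have hrz := (hr0 z.2).ne'
    ext i j
    simp only [hQdef, momentumTensor]
    rw [hG z hz, hK z hz, trace_warped hg hz (pow_pos hL 2) (pow_pos (hr0 z.2) 2)]
    simp only [mat_apply, warpedForm_apply, hA, hB]
    field_simp
    ring
  obtain ⟨p1, p2, p3, p4, p5, p6⟩ := pd_warped hg hAd hBd hQ hy
  have hdB' : deriv B y.2 = -deriv (fun t => 2 * (m t / r t ^ 2)) y.2 * L ^ 2 :=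
    (hdB.differentiableAt.hasDerivAt.neg.mul_const _).deriv
  have v1 : ∀ i j, momentumTensor G K (Sum.inl i) (Sum.inl j) y =
      A y.2 * g y.1 (planeBasis i) (planeBasis j) := fun i j =>
    (congrFun (congrFun (hQ y hy) _) _).trans (by simp [mat_apply, warpedForm_apply, cylBasis_inl])
  have v2 : ∀ i u, momentumTensor G K (Sum.inl i) (Sum.inr u) y = 0 := fun i u =>
    (congrFun (congrFun (hQ y hy) _) _).trans (by simp [mat_warpedForm])
  have v3 : ∀ i u, momentumTensor G K (Sum.inr u) (Sum.inl i) y = 0 := fun i u =>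
    (congrFun (congrFun (hQ y hy) _) _).trans (by simp [mat_warpedForm])
  have v4 : ∀ u u', momentumTensor G K (Sum.inr u) (Sum.inr u') y = B y.2 := fun u u' =>
    (congrFun (congrFun (hQ y hy) _) _).trans (by simp [mat_warpedForm])
  rw [← hG y hy] at hinv
  have i1 : ∀ i j, (G y)⁻¹ (Sum.inl i) (Sum.inl j) = (r y.2 ^ 2)⁻¹ *
      (mat planeBasis (g y.1))⁻¹ i j := fun i j => by simp [hinv]
  have i2 : ∀ i u, (G y)⁻¹ (Sum.inl i) (Sum.inr u) = 0 := fun i u => by simp [hinv]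
  have i3 : ∀ i u, (G y)⁻¹ (Sum.inr u) (Sum.inl i) = 0 := fun i u => by simp [hinv]
  have i4 : ∀ u u', (G y)⁻¹ (Sum.inr u) (Sum.inr u') = (L ^ 2)⁻¹ := fun u u' => by simp [hinv]
  have htr := sum_inv_mul hg hy
  have e : ∀ i j, momentumTensor G K i j = fun z => Q z i j := fun _ _ => rfl
  have hAv : A y.2 = -m y.2 - k y.2 * r y.2 ^ 2 / L ^ 2 := rfl
  have hBv : B y.2 = -(2 * (m y.2 / r y.2 ^ 2)) * L ^ 2 := rfl
  simp only [← e] at p1 p2 p3 p4 p5 p6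
  constructor
  · intro i
    -- Tangentially only `A ∇γ` survives, which vanishes by metric compatibility since `A` depends
    -- on `t` alone.
    have hc := hg.pd_eq hy
    simp only [momentum, Fintype.sum_sum_type, Finset.univ_unique,
      Finset.sum_singleton, PUnit.default_eq_unit, p1, p2, p3, c1, c2, c3, c4, c5, c6,
      v1, v2, v3, v4, i1, i2, i3, i4, zero_mul, add_zero, zero_add, mul_zero, sub_zero,
      Finset.sum_const_zero]
    refine Finset.sum_eq_zero fun j _ => Finset.sum_eq_zero fun n _ => ?_
    rw [hc]
    simp only [Fin.sum_univ_two]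
    ring
  · intro u
    simp only [momentum, Fintype.sum_sum_type, Finset.univ_unique,
      Finset.sum_singleton, PUnit.default_eq_unit, p4, p5, p6, c2, c4, c5, c6,
      c7, v1, v2, v3, v4, i1, i2, i3, i4, zero_mul, add_zero, zero_add, mul_zero, sub_zero,
      Finset.sum_const_zero, hdB', mul_ite, mul_one, ite_mul, Finset.sum_ite_eq',
      Finset.mem_univ, if_true]
    calc _ = (∑ i, ∑ j, (mat planeBasis (g y.1))⁻¹ i j * g y.1 (planeBasis i) (planeBasis j)) *
          ((r y.2 ^ 2)⁻¹ * (r y.2 * deriv r y.2 / L ^ 2 * B y.2 - deriv r y.2 / r y.2 * A y.2)) +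
          (L ^ 2)⁻¹ * (-deriv (fun t => 2 * (m t / r t ^ 2)) y.2 * L ^ 2) := by
          congr 1
          simp only [Finset.sum_mul]
          refine Finset.sum_congr rfl fun i _ => Finset.sum_congr rfl fun j _ => ?_
          rw [hg.symm y.1 hy (planeBasis j) (planeBasis i)]
          ring
      _ = _ := by
        rw [htr, hAv, hBv]
        field_simp
        ring

end WarpedCurvature

/-! ### Hypersurfaces in charts -/

section Hypersurfaces

variable {E : Type*} [NormedAddCommGroup E] [NormedSpace ℝ E] [FiniteDimensional ℝ E]
  {H : Type*} [TopologicalSpace H] {I : ModelWithCorners ℝ E H} [I.Boundaryless]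
  {M : Type*} [TopologicalSpace M] [ChartedSpace H M] [IsManifold I ∞ M]
  {E' : Type*} [NormedAddCommGroup E'] [NormedSpace ℝ E'] [FiniteDimensional ℝ E']
  {H' : Type*} [TopologicalSpace H'] {I' : ModelWithCorners ℝ E' H'} [I'.Boundaryless]
  {N : Type*} [TopologicalSpace N] [ChartedSpace H' N] [IsManifold I' ∞ N]
  {ι κ : Type*} [Fintype ι] [DecidableEq ι] [Fintype κ] [DecidableEq κ]
  (b : Basis ι ℝ E) (b' : Basis κ ℝ E')

/-- The tangent space at `p` is identified with the model space through the chart at `p` itself.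
Hence at the base point tensors coincide with their chart components. -/
theorem symmDeriv_self (p : M) :
    symmDeriv I p (extChartAt I p p) = ContinuousLinearMap.id ℝ E := by
  have : IsManifold I 1 M := IsManifold.of_le (n := ∞) (by simp)
  have h := mfderivWithin_range_extChartAt_symm (I := I) (x := p)
  rw [I.range_eq_univ, mfderivWithin_univ] at h
  exact h

theorem chartForm_self (T : Tensor₂ I M) (p : M) :
    chartForm T p (extChartAt I p p) = modelForm T p := by
  refine ContinuousLinearMap.ext fun v => ContinuousLinearMap.ext fun w => ?_
  rw [chartForm_eq_symmDeriv, symmDeriv_self, extChartAt_to_inv]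
  rfl

variable (I I') in
/-- The derivative of a map between manifolds, in the model spaces. -/
def modelDeriv (F : N → M) (s : N) : E' →L[ℝ] E := mfderiv I' I F s

theorem modelDeriv_eq {F : N → M} {s : N} (hF : MDifferentiableAt I' I F s) :
    modelDeriv I I' F s = fderiv ℝ (writtenInExtChartAt I' I s F) (extChartAt I' s s) := by
  have h : modelDeriv I I' F s =
      fderivWithin ℝ (writtenInExtChartAt I' I s F) (Set.range I') (extChartAt I' s s) := hF.mfderiv
  rw [h, I'.range_eq_univ, fderivWithin_univ]

/-- The pullback of a bilinear form at a point. -/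
def modelPullback (T : Tensor₂ I M) (F : N → M) (s : N) : E' →L[ℝ] E' →L[ℝ] ℝ :=
  (modelForm T (F s)).bilinearComp (modelDeriv I I' F s) (modelDeriv I I' F s)

theorem modelPullback_apply (T : Tensor₂ I M) (F : N → M) (s : N) (v w : E') :
    modelPullback (I' := I') T F s v w =
      modelForm T (F s) (modelDeriv I I' F s v) (modelDeriv I I' F s w) := rfl

theorem coords_pullback (T : Tensor₂ I M) (F : N → M) (s : N) :
    coords b' (pullback I' T F) s (extChartAt I' s s) = mat b' (modelPullback (I' := I') T F s) := by
  rw [coords_eq_mat, chartForm_self]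
  rfl

theorem secondForm_apply (D : InitialData I M) (F : N → M)
    (ν : ∀ s : N, TangentSpace I (F s)) (s : N) (a c : κ) :
    D.secondForm I' b b' F ν s a c = -modelForm D.g.inner (F s) (ν s)
      (fderiv ℝ (fun z => fderiv ℝ (writtenInExtChartAt I' I s F) z (b' c)) (extChartAt I' s s) (b' a) +
        gammaL b (coords b D.g.inner (F s)) (extChartAt I (F s) (F s))
          (fderiv ℝ (writtenInExtChartAt I' I s F) (extChartAt I' s s) (b' a))
          (fderiv ℝ (writtenInExtChartAt I' I s F) (extChartAt I' s s) (b' c))) := by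
  rw [gammaL_apply]
  set X := fderiv ℝ (fun z => fderiv ℝ (writtenInExtChartAt I' I s F) z (b' c)) (extChartAt I' s s)
    (b' a) + christoffelVec b (coords b D.g.inner (F s)) (extChartAt I (F s) (F s))
          (fderiv ℝ (writtenInExtChartAt I' I s F) (extChartAt I' s s) (b' a))
          (fderiv ℝ (writtenInExtChartAt I' I s F) (extChartAt I' s s) (b' c)) with hX
  have h1 : symmDeriv I (F s) (extChartAt I (F s) (F s)) X = X := by
    rw [symmDeriv_self]; rfl
  conv_rhs => rw [← h1]
  rfl

end Hypersurfaces

/-! ### Data given by profile functions -/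

section Profile

variable {S : Type*} [TopologicalSpace S] [ChartedSpace Plane S] [IsManifold (𝓡 2) ∞ S]
  (γ : Bundle.ContMDiffRiemannianMetric (𝓡 2) ∞ Plane (fun x : S => TangentSpace (𝓡 2) x))
  {L : ℝ} {r k m : ℝ → ℝ} (hL : 0 < L) (hr : ContDiff ℝ ∞ r) (hk : ContDiff ℝ ∞ k)
  (hm : ContDiff ℝ ∞ m) (hr0 : ∀ t, 0 < r t)

theorem coords_warped (γ : Tensor₂ (𝓡 2) S) (a c : ℝ → ℝ) (x : S × ℝ) {z : Plane × ℝ}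
    (hz : z.1 ∈ (extChartAt (𝓡 2) x.1).target) :
    coords cylBasis (warped γ a c) x z =
      mat cylBasis (warpedForm (chartForm γ x.1 z.1) (a z.2) (c z.2)) := by
  rw [coords_eq_mat, chartForm_warped γ a c x hz]

theorem energyDensity_warpedData (x : S × ℝ) :
    (warpedData γ hL hr hk hm hr0).energyDensity cylBasis x =
      (1 / 2) * (scalarCurvature planeBasis γ.inner x.1 / r x.2 ^ 2 -
        (4 * (deriv (deriv r) x.2 / r x.2) + 2 * (deriv r x.2 / r x.2) ^ 2) / L ^ 2 +
        (k x.2 / L ^ 2 + 2 * m x.2 / r x.2 ^ 2) ^ 2 -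
        ((k x.2 / L ^ 2) ^ 2 + 2 * (m x.2 / r x.2 ^ 2) ^ 2)) := by
  have hg := metricOn_chartForm γ x.1
  have hx : (extChartAt cylModel x x).1 ∈ (extChartAt (𝓡 2) x.1).target := by
    rw [extChartAt_cyl_apply]
    exact mem_extChartAt_target x.1
  have h1 := scalar_warped (G := coords cylBasis (warpedData γ hL hr hk hm hr0).g.inner x) hg hr hr0
    hL (fun z hz => coords_warped γ.inner _ _ x hz) hx
  have h2 : coords cylBasis (warpedData γ hL hr hk hm hr0).g.inner x (extChartAt cylModel x x) = _ :=
    coords_warped γ.inner (fun _ => L ^ 2) (fun t => r t ^ 2) x hx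
  have h3 : coords cylBasis (warpedData γ hL hr hk hm hr0).K x (extChartAt cylModel x x) = _ :=
    coords_warped γ.inner k m x hx
  have h4 := trace_warped hg hx (k := k x.2) (m := m x.2) (pow_pos hL 2) (pow_pos (hr0 x.2) 2)
  have h5 := normSq_warped hg hx (k := k x.2) (m := m x.2) (pow_pos hL 2) (pow_pos (hr0 x.2) 2)
  have h6 : extChartAt cylModel x x = (extChartAt (𝓡 2) x.1 x.1, x.2) := extChartAt_cyl_apply x x
  have h7 : scalarCurvature planeBasis γ.inner x.1 = scalar planeBasis
      (fun z => mat planeBasis (chartForm γ.inner x.1 z)) (extChartAt (𝓡 2) x.1 x.1) := rfl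
  rw [h6] at h1 h2 h3 h4 h5
  simp only [InitialData.energyDensity, scalarCurvature] at h7 ⊢
  rw [h6, h1, h2, h3, h4, h5, h7]

theorem momentumNorm_warpedData (x : S × ℝ) :
    (warpedData γ hL hr hk hm hr0).momentumNorm cylBasis x =
      |-deriv (fun t => 2 * (m t / r t ^ 2)) x.2 +
        deriv r x.2 / r x.2 * (2 * (k x.2 / L ^ 2) - 2 * (m x.2 / r x.2 ^ 2))| / L := by
  have hg := metricOn_chartForm γ x.1
  have hx : (extChartAt cylModel x x).1 ∈ (extChartAt (𝓡 2) x.1).target := by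
    rw [extChartAt_cyl_apply]
    exact mem_extChartAt_target x.1
  obtain ⟨h1, h4⟩ := momentum_warped
    (G := coords cylBasis (warpedData γ hL hr hk hm hr0).g.inner x)
    (K := coords cylBasis (warpedData γ hL hr hk hm hr0).K x) hg hr hr0 hL
    (hk.differentiable (by simp)) (hm.differentiable (by simp))
    (fun z hz => coords_warped γ.inner _ _ x hz) (fun z hz => coords_warped γ.inner k m x hz) hx
  have h2 : coords cylBasis (warpedData γ hL hr hk hm hr0).g.inner x (extChartAt cylModel x x) = _ :=
    coords_warped γ.inner (fun _ => L ^ 2) (fun t => r t ^ 2) x hx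
  simp only [InitialData.momentumNorm]
  rw [h2, inv_mat_warpedForm (pow_pos hL 2).ne' (pow_pos (hr0 _) 2).ne' (hg.isUnit hx)]
  simp only [Fintype.sum_sum_type, Finset.univ_unique, Finset.sum_singleton, h1, h4, mul_zero,
    zero_mul, Finset.sum_const_zero, zero_add, Matrix.fromBlocks_apply₂₂,
    Matrix.smul_apply, Matrix.one_apply_eq, smul_eq_mul, mul_one]
  have h5 : (extChartAt cylModel x x).2 = x.2 := by rw [extChartAt_cyl_apply]
  rw [h5, mul_assoc, ← sq, Real.sqrt_mul (by positivity), Real.sqrt_sq_eq_abs, Real.sqrt_inv,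
    Real.sqrt_sq hL.le, inv_mul_eq_div]

variable {h p q : ℝ → ℝ} (hp : ContDiff ℝ ∞ p) (hq : ContDiff ℝ ∞ q)

/-- The initial data `g = L² dt² + r(t)² γ`, `K = L² q(t) dt² + ½ r(t)² p(t) γ`. -/
def profileData : InitialData cylModel (S × ℝ) :=
  warpedData γ (k := fun t => L ^ 2 * q t) (m := fun t => r t ^ 2 * (p t / 2)) hL hr
    (contDiff_const.mul hq) ((hr.pow 2).mul (hp.div_const 2)) hr0

/-- From `r' = ½ L h r` follows `r''/r = ½ L h' + ¼ L² h²`; in the unit normal direction the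
eigenvalues of `K` are `q` once and `p/2` twice along the slice. Substituting both turns the
dominant energy condition into an inequality between profiles. -/
theorem profileData_DEC (hh : Differentiable ℝ h) (hrh : ∀ t, deriv r t = L / 2 * h t * r t)
    (hdec : ∀ s : S, ∀ t, 0 ≤ t → t ≤ 1 → |h t * q t - h t * p t / 2 - deriv p t / L| ≤
      (1 / 2) * (scalarCurvature planeBasis γ.inner s / r t ^ 2 - 2 * deriv h t / L -
        3 / 2 * h t ^ 2 + 2 * q t * p t + p t ^ 2 / 2)) :
    (profileData γ hL hr hr0 hp hq).DEC cylBasis (cylinder S) := by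
  intro x hx
  have hr1 := (hr0 x.2).ne'
  have e1 : (fun t => 2 * (r t ^ 2 * (p t / 2) / r t ^ 2)) = p := by
    funext t
    have := (hr0 t).ne'
    field_simp
  have e2 : deriv (deriv r) x.2 = (L / 2 * deriv h x.2 + (L / 2 * h x.2) ^ 2) * r x.2 := by
    have hd : HasDerivAt (fun t => L / 2 * h t * r t) _ x.2 :=
      ((hh x.2).hasDerivAt.const_mul (L / 2)).mul
        ((hr.differentiable (by simp)) x.2).hasDerivAt
    rw [funext hrh, hd.deriv, hrh]
    ring
  rw [profileData, energyDensity_warpedData, momentumNorm_warpedData, e1, e2, hrh]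
  convert hdec x.1 x.2 hx.1 hx.2 using 1
  · rw [← abs_of_pos hL, ← abs_div, abs_of_pos hL]
    congr 1
    field_simp
    ring
  · field_simp
    ring

theorem modelDeriv_slice (t : ℝ) (s : S) :
    modelDeriv cylModel (𝓡 2) (fun s : S => (s, t)) s = ContinuousLinearMap.inl ℝ Plane ℝ :=
  mfderiv_prod_left

theorem modelPullback_slice (a c : ℝ → ℝ) (t : ℝ) (s : S) :
    modelPullback (I' := 𝓡 2) (warped γ.inner a c) (fun s : S => (s, t)) s =
      c t • modelForm γ.inner s := by
  refine ContinuousLinearMap.ext fun v => ContinuousLinearMap.ext fun w => ?_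
  rw [modelPullback_apply, modelDeriv_slice, warped_apply]
  simp [smul_apply]

theorem writtenInExtChartAt_slice (t : ℝ) (s : S) :
    writtenInExtChartAt (𝓡 2) cylModel s (fun s : S => (s, t)) =ᶠ[𝓝 (extChartAt (𝓡 2) s s)]
      fun z => (z, t) := by
  filter_upwards [extChartAt_target_mem_nhds (I := 𝓡 2) s] with z hz
  simp only [writtenInExtChartAt, Function.comp_apply, extChartAt_cyl_apply]
  rw [(extChartAt (𝓡 2) s).right_inv hz]

theorem trace_smul_smul {ι : Type*} [Fintype ι] [DecidableEq ι] {G : Matrix ι ι ℝ}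
    (hG : IsUnit G.det) (hs : G.transpose = G) {c : ℝ} (hc : c ≠ 0) (d : ℝ) :
    trace (c • G) (d • G) = d / c * Fintype.card ι := by
  have hi : (c • G)⁻¹ = c⁻¹ • G⁻¹ :=
    Matrix.inv_eq_right_inv (by simp [Matrix.mul_nonsing_inv _ hG, smul_smul, hc])
  rw [trace_eq_matrix_trace, hi, Matrix.transpose_smul, hs]
  simp [Matrix.nonsing_inv_mul _ hG, smul_smul, div_eq_inv_mul, mul_comm, mul_assoc]

theorem repr_cylBasis_inr (v : Plane × ℝ) (u : Unit) : cylBasis.repr v (Sum.inr u) = v.2 := by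
  simp [cylBasis]

/-- In product charts a slice is affine, so its second derivatives vanish and only the Christoffel
symbol `Γᵗᵢⱼ` contributes. -/
theorem secondForm_slice (t : ℝ) (s : S) (a c : Fin 2) :
    (profileData γ hL hr hr0 hp hq).secondForm (𝓡 2) cylBasis planeBasis
      (fun s : S => (s, t)) (fun _ => ((0, L⁻¹) : Plane × ℝ)) s a c =
      r t * deriv r t / L * modelForm γ.inner s (planeBasis a) (planeBasis c) := by
  have hw := writtenInExtChartAt_slice t s
  have hd : ∀ z, fderiv ℝ (fun z : Plane => (z, t)) z = ContinuousLinearMap.inl ℝ Plane ℝ :=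
    fun z => (hasFDerivAt_prodMk_left z t).fderiv
  have h1 := hw.fderiv_eq (𝕜 := ℝ)
  have h2 : (fun z => fderiv ℝ (writtenInExtChartAt (𝓡 2) cylModel s (fun s : S => (s, t))) z
      (planeBasis c)) =ᶠ[𝓝 (extChartAt (𝓡 2) s s)]
      fun _ => ContinuousLinearMap.inl ℝ Plane ℝ (planeBasis c) := by
    filter_upwards [hw.fderiv (𝕜 := ℝ)] with z hz
    rw [hz, hd]
  have h3 := h2.fderiv_eq (𝕜 := ℝ)
  have hg := metricOn_chartForm γ s
  have hx : (extChartAt cylModel (s, t) (s, t)).1 ∈ (extChartAt (𝓡 2) s).target := by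
    rw [extChartAt_cyl_apply]
    exact mem_extChartAt_target s
  have h4 := (christoffel_warped
    (G := coords cylBasis (profileData γ hL hr hr0 hp hq).g.inner (s, t)) hg
    (hr.differentiable (by simp)) hr0 hL
    (fun z hz => coords_warped γ.inner _ _ (s, t) hz) hx).2.1 () a c
  have h5 : fderiv ℝ (fun _ : Plane => ContinuousLinearMap.inl ℝ Plane ℝ (planeBasis c))
      (extChartAt (𝓡 2) s s) (planeBasis a) = 0 := by simp
  have h6 : ∀ i, ContinuousLinearMap.inl ℝ Plane ℝ (planeBasis i) = cylBasis (Sum.inl i) :=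
    fun i => (cylBasis_inl i).symm
  have h7 := secondForm_apply (I' := 𝓡 2) cylBasis planeBasis (profileData γ hL hr hr0 hp hq)
    (fun s : S => (s, t)) (fun s => ((0, L⁻¹) : Plane × ℝ)) s a c
  rw [h3, h1, hd, h5, zero_add, h6, h6] at h7
  refine h7.trans ((congrArg Neg.neg (warped_apply γ.inner (fun _ => L ^ 2) (fun t => r t ^ 2)
    (s, t) ((0, L⁻¹) : Plane × ℝ) _)).trans ?_)
  rw [← repr_cylBasis_inr (gammaL _ _ _ _ _) (), repr_gammaL_basis, h4, extChartAt_cyl_apply,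
    chartForm_self]
  simp
  field_simp

/-- The unit normal is `L⁻¹ ∂ₜ`. The second fundamental form is `½ h r² γ` and `K` restricts to `½ p
r² γ`, with traces `h` and `p` in dimension two; the absence of mixed terms in `K` gives `ω^⊥ = 0`.
-/
theorem sliceData_profileData (hrh : ∀ t, deriv r t = L / 2 * h t * r t) (t : ℝ)
    (γ' : Tensor₂ (𝓡 2) S)
    (hγ' : ∀ s (v w : Plane), modelForm γ' s v w = r t ^ 2 * modelForm γ.inner s v w) :
    SliceData (profileData γ hL hr hr0 hp hq) t γ' (fun _ => h t) (fun _ => p t) (fun _ => 0) := by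
  have hrt := (hr0 t).ne'
  have hu : ∀ s, IsUnit (mat planeBasis (modelForm γ.inner s)).det := fun s => by
    rw [← chartForm_self]
    exact (metricOn_chartForm γ s).isUnit (mem_extChartAt_target s)
  have hsy : ∀ s, (mat planeBasis (modelForm γ.inner s)).transpose =
      mat planeBasis (modelForm γ.inner s) := fun s => by
    ext i j
    exact γ.symm s _ _
  refine ⟨fun s => ((0, L⁻¹) : Plane × ℝ), fun s => ?_, ?_, fun s v w => ?_, fun s => ?_,
    fun s => ?_, fun s (v : Plane) => ?_⟩
  · have h1 : mfderiv cylModel 𝓘(ℝ, ℝ) (Prod.snd : S × ℝ → ℝ) (s, t) =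
      ContinuousLinearMap.snd ℝ Plane ℝ := mfderiv_snd
    rw [h1]
    exact inv_pos.2 hL
  · intro s
    constructor
    · refine (warped_apply γ.inner (fun _ => L ^ 2) (fun t => r t ^ 2) (s, t) (0, L⁻¹)
        (0, L⁻¹)).trans ?_
      simp
      field_simp
    · intro (v : Plane)
      have h1 : modelForm (warped γ.inner (fun _ => L ^ 2) fun t => r t ^ 2) (s, t) (0, L⁻¹)
          (modelDeriv cylModel (𝓡 2) (fun s : S => (s, t)) s v) = 0 := by
        rw [warped_apply, modelDeriv_slice]
        simp [ContinuousLinearMap.inl_apply]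
      exact h1
  · have h1 := congrArg (fun B => B v w)
      (modelPullback_slice γ (fun _ => L ^ 2) (fun t => r t ^ 2) t s)
    exact h1.trans (hγ' s v w).symm
  · have h1 : coords planeBasis (pullback (𝓡 2) (profileData γ hL hr hr0 hp hq).g.inner
        fun s : S => (s, t)) s (extChartAt (𝓡 2) s s) = _ := coords_pullback planeBasis _ _ s
    have h2 := modelPullback_slice γ (fun _ => L ^ 2) (fun t => r t ^ 2) t s
    have h3 : (profileData γ hL hr hr0 hp hq).secondForm (𝓡 2) cylBasis planeBasis
        (fun s : S => (s, t)) (fun s => ((0, L⁻¹) : Plane × ℝ)) s =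
        (r t ^ 2 * h t / 2) • mat planeBasis (modelForm γ.inner s) := by
      ext a c
      refine (secondForm_slice γ hL hr hr0 hp hq t s a c).trans ?_
      rw [hrh, Matrix.smul_apply, mat_apply, smul_eq_mul]
      field_simp
    refine (congrArg₂ trace h1 h3).trans ?_
    refine (congrArg (fun B => trace (mat planeBasis B) _) h2).trans ?_
    refine (trace_smul_smul (hu s) (hsy s) (pow_ne_zero 2 hrt) _).trans ?_
    simp only [Fintype.card_fin]
    field_simp
    norm_num
  · have h1 : coords planeBasis (pullback (𝓡 2) (profileData γ hL hr hr0 hp hq).g.inner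
        fun s : S => (s, t)) s (extChartAt (𝓡 2) s s) = _ := coords_pullback planeBasis _ _ s
    have h2 := modelPullback_slice γ (fun _ => L ^ 2) (fun t => r t ^ 2) t s
    have h3 : coords planeBasis (pullback (𝓡 2) (profileData γ hL hr hr0 hp hq).K
        fun s : S => (s, t)) s (extChartAt (𝓡 2) s s) = _ := coords_pullback planeBasis _ _ s
    have h4 := modelPullback_slice γ (fun t => L ^ 2 * q t) (fun t => r t ^ 2 * (p t / 2)) t s
    refine (congrArg₂ trace h1 h3).trans ?_
    refine (congrArg₂ (fun B B' => trace (mat planeBasis B) (mat planeBasis B')) h2 h4).trans ?_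
    refine (trace_smul_smul (hu s) (hsy s) (pow_ne_zero 2 hrt) _).trans ?_
    simp only [Fintype.card_fin]
    field_simp
    norm_num
  · have h1 : modelForm (warped γ.inner (fun t => L ^ 2 * q t) fun t => r t ^ 2 * (p t / 2)) (s, t)
        (0, L⁻¹) (modelDeriv cylModel (𝓡 2) (fun s : S => (s, t)) s v) = 0 := by
      rw [warped_apply, modelDeriv_slice]
      simp [ContinuousLinearMap.inl_apply]
    exact h1

end Profile

/-! ### Traces of semidefinite forms and of forms on hyperplanes -/

section SemidefiniteTraces

variable {E : Type*} [NormedAddCommGroup E] [NormedSpace ℝ E] [FiniteDimensional ℝ E]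
  {ι : Type*} [Fintype ι] [DecidableEq ι] (b : Basis ι ℝ E) {g B : E →L[ℝ] E →L[ℝ] ℝ}

/-- In a `g`-orthogonal basis the inverse metric is diagonal. One basis serves for all `B`, so signs
of traces can be read off termwise. -/
theorem exists_trace_eq_sum (hs : ∀ v w, g v w = g w v) (hp : ∀ v, v ≠ 0 → 0 < g v v) :
    ∃ e : Basis (Fin (Module.finrank ℝ E)) ℝ E, ∀ B : E →L[ℝ] E →L[ℝ] ℝ,
      trace (mat b g) (mat b B) = ∑ i, (g (e i) (e i))⁻¹ * B (e i) (e i) := by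
  let g' : LinearMap.BilinForm ℝ E := LinearMap.mk₂ ℝ (fun v w => g v w) (by simp) (by simp)
    (by simp) (by simp)
  obtain ⟨e, he⟩ := LinearMap.BilinForm.exists_orthogonal_basis (B := g') ⟨fun v w => hs v w⟩
  refine ⟨e, fun B => ?_⟩
  have hd : mat e g = Matrix.diagonal fun i => g (e i) (e i) := by
    ext i j
    rcases eq_or_ne i j with rfl | hij
    · simp [mat_apply]
    · rw [Matrix.diagonal_apply_ne _ hij]
      exact he hij
  have hi : (mat e g)⁻¹ = Matrix.diagonal fun i => (g (e i) (e i))⁻¹ := by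
    refine Matrix.inv_eq_right_inv ?_
    rw [hd, Matrix.diagonal_mul_diagonal, ← Matrix.diagonal_one]
    congr 1
    funext i
    exact mul_inv_cancel₀ (hp _ (e.ne_zero i)).ne'
  rw [← trace_basis_change b e g B (isUnit_det_mat_of_pos b g hp)]
  unfold trace
  rw [hi]
  refine Finset.sum_congr rfl fun i _ => ?_
  rw [Finset.sum_eq_single i]
  · simp [mat_apply]
  · intro j _ hj
    rw [Matrix.diagonal_apply_ne' _ hj, zero_mul]
  · simp

theorem trace_nonneg (hs : ∀ v w, g v w = g w v) (hp : ∀ v, v ≠ 0 → 0 < g v v)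
    (hB : ∀ v, 0 ≤ B v v) : 0 ≤ trace (mat b g) (mat b B) := by
  obtain ⟨e, he⟩ := exists_trace_eq_sum b hs hp
  rw [he]
  exact Finset.sum_nonneg fun i _ => mul_nonneg (inv_nonneg.2 (hp _ (e.ne_zero i)).le) (hB _)

theorem trace_smulRight_pos (hs : ∀ v w, g v w = g w v) (hp : ∀ v, v ≠ 0 → 0 < g v v)
    {l : E →L[ℝ] ℝ} (hl : l ≠ 0) : 0 < trace (mat b g) (mat b (l.smulRight l)) := by
  obtain ⟨e, he⟩ := exists_trace_eq_sum b hs hp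
  rw [he]
  have h0 : ∀ i, 0 ≤ (g (e i) (e i))⁻¹ * (l.smulRight l) (e i) (e i) := fun i =>
    mul_nonneg (inv_nonneg.2 (hp _ (e.ne_zero i)).le) (by simpa using mul_self_nonneg _)
  refine (Finset.sum_nonneg fun i _ => h0 i).lt_of_ne' fun h => hl ?_
  rw [Finset.sum_eq_zero_iff_of_nonneg fun i _ => h0 i] at h
  ext v
  induction v using basis_induction e with
  | h0 => simp
  | ha x y hx hy => simpa using by simp [hx, hy]
  | hs c x hx => simp [hx]
  | hb i =>
    have := h i (Finset.mem_univ i)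
    simpa [(hp _ (e.ne_zero i)).ne'] using this

theorem trace_add {ι : Type*} [Fintype ι] [DecidableEq ι] (G A B : Matrix ι ι ℝ) :
    trace G (A + B) = trace G A + trace G B := by
  simp [trace, mul_add, Finset.sum_add_distrib]

theorem trace_smul {ι : Type*} [Fintype ι] [DecidableEq ι] (G A : Matrix ι ι ℝ) (c : ℝ) :
    trace G (c • A) = c * trace G A := by
  simp only [trace, Finset.mul_sum, Matrix.smul_apply, smul_eq_mul]
  exact Finset.sum_congr rfl fun i _ => Finset.sum_congr rfl fun j _ => by ring

theorem mat_add {ι : Type*} (b : Basis ι ℝ E) (A B : E →L[ℝ] E →L[ℝ] ℝ) :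
    mat b (A + B) = mat b A + mat b B := rfl

theorem mat_smul {ι : Type*} (b : Basis ι ℝ E) (c : ℝ) (A : E →L[ℝ] E →L[ℝ] ℝ) :
    mat b (c • A) = c • mat b A := rfl

variable {E' : Type*} [NormedAddCommGroup E'] [NormedSpace ℝ E']
  {κ : Type*} [Fintype κ] [DecidableEq κ] (b' : Basis κ ℝ E')

/-- A basis adapted to a hyperplane and a unit normal. -/
theorem exists_adapted_basis (hcard : Module.finrank ℝ E = Fintype.card κ + 1)
    {d : E' →L[ℝ] E} (hd : Function.Injective d) {ν : E} (h1 : g ν ν = 1)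
    (h0 : ∀ v, g ν (d v) = 0) :
    ∃ e : Basis (κ ⊕ Unit) ℝ E, (∀ i, e (Sum.inl i) = d (b' i)) ∧ ∀ u, e (Sum.inr u) = ν := by
  have hli : LinearIndependent ℝ (Sum.elim (fun i => d (b' i)) fun _ : Unit => ν) := by
    refine LinearIndependent.sum_type ?_ ?_ ?_
    · exact b'.linearIndependent.map' (d : E' →ₗ[ℝ] E) (LinearMap.ker_eq_bot.2 hd)
    · rw [linearIndependent_unique_iff]
      rintro rfl
      simp at h1
    · rw [Set.range_const, Submodule.disjoint_span_singleton']
      · intro h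
        have : Submodule.span ℝ (Set.range fun i => d (b' i)) ≤ LinearMap.ker (g ν : E →ₗ[ℝ] ℝ) := by
          rw [Submodule.span_le]
          rintro _ ⟨i, rfl⟩
          exact h0 _
        have h2 : g ν ν = 0 := this h
        rw [h2] at h1
        exact zero_ne_one h1
      · rintro rfl
        simp at h1
  have : Nonempty (κ ⊕ Unit) := ⟨Sum.inr ()⟩
  refine ⟨basisOfLinearIndependentOfCardEqFinrank hli (by simp [hcard]), fun i => ?_, fun u => ?_⟩
  · simp
  · simp

/-- In a basis made of tangent vectors and the unit normal the metric is block diagonal, and the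
trace splits into its tangential and normal parts. -/
theorem trace_eq_trace_add (hcard : Module.finrank ℝ E = Fintype.card κ + 1)
    (hs : ∀ v w, g v w = g w v) (hp : ∀ v, v ≠ 0 → 0 < g v v)
    {d : E' →L[ℝ] E} (hd : Function.Injective d) {ν : E} (h1 : g ν ν = 1)
    (h0 : ∀ v, g ν (d v) = 0) (B : E →L[ℝ] E →L[ℝ] ℝ) :
    trace (mat b g) (mat b B) =
      trace (mat b' (g.bilinearComp d d)) (mat b' (B.bilinearComp d d)) + B ν ν := by
  obtain ⟨e, he, he'⟩ := exists_adapted_basis b' hcard hd h1 h0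
  have hu : IsUnit (mat b' (g.bilinearComp d d)).det :=
    isUnit_det_mat_of_pos _ _ fun v hv => hp _ fun h => hv (hd (h.trans (map_zero d).symm))
  have hm : mat e g = Matrix.fromBlocks (mat b' (g.bilinearComp d d)) 0 0 1 := by
    ext i j
    rcases i with i | i <;> rcases j with j | j
    · simp [mat_apply, he]
    · simp [mat_apply, he, he', hs _ ν, h0]
    · simp [mat_apply, he, he', h0]
    · simp [mat_apply, he', h1]
  have hi : (mat e g)⁻¹ = Matrix.fromBlocks (mat b' (g.bilinearComp d d))⁻¹ 0 0 1 := by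
    refine Matrix.inv_eq_right_inv ?_
    rw [hm, Matrix.fromBlocks_multiply]
    simp [Matrix.mul_nonsing_inv _ hu, Matrix.fromBlocks_one]
  rw [← trace_basis_change b e g B (isUnit_det_mat_of_pos b g hp)]
  unfold trace
  rw [hi]
  simp [Fintype.sum_sum_type, mat_apply, he, he']

end SemidefiniteTraces

/-! ### The second derivative at a maximum -/

section SecondDerivative

variable {E : Type*} [NormedAddCommGroup E] [NormedSpace ℝ E]

/-- A positive second derivative would make `x` a local minimum too; the function would be locally
constant and its second derivative zero. -/
theorem deriv_deriv_nonpos_of_isLocalMax {f : ℝ → ℝ} {x : ℝ} (h : IsLocalMax f x)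
    (hf : ContinuousAt f x) : deriv (deriv f) x ≤ 0 := by
  by_contra! h0
  have h1 := isLocalMin_of_deriv_deriv_pos h0 h.deriv_eq_zero hf
  have h2 : f =ᶠ[𝓝 x] fun _ => f x := by
    filter_upwards [h, h1] with y hy hy' using le_antisymm hy hy'
  have h3 : deriv f =ᶠ[𝓝 x] fun _ => 0 := by
    filter_upwards [h2.eventuallyEq_nhds] with y hy
    rw [hy.deriv_eq, deriv_const]
  rw [h3.deriv_eq, deriv_const] at h0
  exact h0.false

theorem fderiv_fderiv_nonpos_of_isLocalMax {f : E → ℝ} {x : E} (h : IsLocalMax f x)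
    (hf : ContDiffAt ℝ ∞ f x) (v : E) : fderiv ℝ (fderiv ℝ f) x v v ≤ 0 := by
  have hl : ∀ t : ℝ, HasDerivAt (fun t : ℝ => x + t • v) v t := fun t => by
    simpa using ((hasDerivAt_id t).smul_const v).const_add x
  have hc : ContinuousAt (fun t : ℝ => x + t • v) 0 := (hl 0).continuousAt
  have hx : x + (0 : ℝ) • v = x := by simp
  have hT : Tendsto (fun t : ℝ => x + t • v) (𝓝 0) (𝓝 x) := by
    have := hc.tendsto
    rwa [hx] at this
  have hmax : IsLocalMax (fun t : ℝ => f (x + t • v)) 0 := by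
    filter_upwards [hT.eventually h] with t ht
    rwa [hx]
  have h1 : ∀ᶠ z in 𝓝 x, DifferentiableAt ℝ f z :=
    ((hf.of_le (m := 1) (by simp)).eventually (by simp)).mono fun z hz =>
      hz.differentiableAt (by simp)
  have h2 : deriv (fun t : ℝ => f (x + t • v)) =ᶠ[𝓝 0] fun t => fderiv ℝ f (x + t • v) v := by
    filter_upwards [hT.eventually h1] with t ht
    exact (ht.hasFDerivAt.comp_hasDerivAt t (hl t)).deriv
  have h3 : DifferentiableAt ℝ (fderiv ℝ f) x :=
    (hf.fderiv_right (m := ∞) le_rfl).differentiableAt (by simp)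
  have h4 : HasFDerivAt (fun z => fderiv ℝ f z v) (fderiv ℝ (fun z => fderiv ℝ f z v) x)
      (x + (0 : ℝ) • v) := by
    rw [hx]
    exact (h3.clm_apply (differentiableAt_const v)).hasFDerivAt
  have h5 := (h4.comp_hasDerivAt (0 : ℝ) (hl 0)).deriv
  have h6 : ContinuousAt (fun t : ℝ => f (x + t • v)) 0 := by
    have hfx : ContinuousAt f (x + (0 : ℝ) • v) := by rw [hx]; exact hf.continuousAt
    exact ContinuousAt.comp (g := f) (f := fun t : ℝ => x + t • v) hfx hc
  have h7 := deriv_deriv_nonpos_of_isLocalMax hmax h6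
  rw [h2.deriv_eq] at h7
  have h8 : fderiv ℝ (fun z => fderiv ℝ f z v) x v = fderiv ℝ (fderiv ℝ f) x v v := by
    rw [fderiv_clm_apply h3 (differentiableAt_const v)]
    simp
  rw [← h8, ← h5]
  exact h7

end SecondDerivative

/-! ### The induced metric of an immersed hypersurface -/

section InducedMetric

variable {E : Type*} [NormedAddCommGroup E] [NormedSpace ℝ E] [FiniteDimensional ℝ E]
  {H : Type*} [TopologicalSpace H] {I : ModelWithCorners ℝ E H} [I.Boundaryless]
  {M : Type*} [TopologicalSpace M] [ChartedSpace H M] [IsManifold I ∞ M]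
  {E' : Type*} [NormedAddCommGroup E'] [NormedSpace ℝ E'] [FiniteDimensional ℝ E']
  {H' : Type*} [TopologicalSpace H'] {I' : ModelWithCorners ℝ E' H'} [I'.Boundaryless]
  {N : Type*} [TopologicalSpace N] [ChartedSpace H' N] [IsManifold I' ∞ N]
  {ι κ : Type*} [Fintype ι] [DecidableEq ι] [Fintype κ] [DecidableEq κ]
  {b : Basis ι ℝ E} {b' : Basis κ ℝ E'}

variable (I I') in
/-- The map `F` in the charts at `s` and at `p`. -/
def inCharts (F : N → M) (s : N) (p : M) (z : E') : E :=
  extChartAt I p (F ((extChartAt I' s).symm z))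

theorem contDiffAt_inCharts {F : N → M} (hF : ContMDiff I' I ∞ F) {s : N} {p : M} {z : E'}
    (hz : z ∈ (extChartAt I' s).target) (hp : F ((extChartAt I' s).symm z) ∈ (chartAt H p).source) :
    ContDiffAt ℝ ∞ (inCharts I I' F s p) z := by
  have h1 : ContMDiffAt 𝓘(ℝ, E') I' ∞ (extChartAt I' s).symm z :=
    (contMDiffOn_extChartAt_symm s).contMDiffAt (extChartAt_target_mem_nhds' hz)
  have h2 : ContMDiffAt I 𝓘(ℝ, E) ∞ (extChartAt I p) (F ((extChartAt I' s).symm z)) :=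
    contMDiffAt_extChartAt' hp
  exact (h2.comp z (hF.contMDiffAt.comp z h1)).contDiffAt

theorem eventually_mem_source {F : N → M} (hF : Continuous F) {s : N} {p : M} {z : E'}
    (hz : z ∈ (extChartAt I' s).target) (hp : F ((extChartAt I' s).symm z) ∈ (chartAt H p).source) :
    ∀ᶠ x in 𝓝 z, x ∈ (extChartAt I' s).target ∧
      F ((extChartAt I' s).symm x) ∈ (chartAt H p).source := by
  have h1 : ContinuousAt (fun x => F ((extChartAt I' s).symm x)) z :=
    hF.continuousAt.comp ((continuousOn_extChartAt_symm s).continuousAt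
      (extChartAt_target_mem_nhds' hz))
  filter_upwards [extChartAt_target_mem_nhds' hz,
    h1.eventually ((chartAt H p).open_source.mem_nhds hp)] with x hx hx' using ⟨hx, hx'⟩

theorem mfderiv_inCharts {F : N → M} (hF : ContMDiff I' I ∞ F) {s : N} {p : M} {z : E'}
    (hz : z ∈ (extChartAt I' s).target) (hp : F ((extChartAt I' s).symm z) ∈ (chartAt H p).source)
    (v : E') :
    modelDeriv I I' F ((extChartAt I' s).symm z) (symmDeriv I' s z v) =
      symmDeriv I p (inCharts I I' F s p z) (fderiv ℝ (inCharts I I' F s p) z v) := by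
  have hev : F ∘ (extChartAt I' s).symm =ᶠ[𝓝 z] (extChartAt I p).symm ∘ inCharts I I' F s p := by
    filter_upwards [eventually_mem_source hF.continuous hz hp] with x hx
    exact ((extChartAt I p).left_inv (by rw [extChartAt_source]; exact hx.2)).symm
  have hq : inCharts I I' F s p z ∈ (extChartAt I p).target :=
    (extChartAt I p).map_source (by rw [extChartAt_source]; exact hp)
  have h1 : MDifferentiableAt 𝓘(ℝ, E) I (extChartAt I p).symm (inCharts I I' F s p z) :=
    ((contMDiffOn_extChartAt_symm (n := ∞) p).contMDiffAt
      (extChartAt_target_mem_nhds' hq)).mdifferentiableAt (by simp)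
  have h2 : DifferentiableAt ℝ (inCharts I I' F s p) z :=
    (contDiffAt_inCharts hF hz hp).differentiableAt (by simp)
  have h3 : MDifferentiableAt 𝓘(ℝ, E') I' (extChartAt I' s).symm z :=
    ((contMDiffOn_extChartAt_symm (n := ∞) s).contMDiffAt
      (extChartAt_target_mem_nhds' hz)).mdifferentiableAt (by simp)
  have h4 : MDifferentiableAt I' I F ((extChartAt I' s).symm z) :=
    hF.mdifferentiableAt (by simp)
  have e1 := hev.mfderiv_eq (I := 𝓘(ℝ, E')) (I' := I)
  have e2 := mfderiv_comp z h1 h2.mdifferentiableAt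
  rw [mfderiv_eq_fderiv] at e2
  have e3 := mfderiv_comp z h4 h3
  have h5 : (modelDeriv I I' F ((extChartAt I' s).symm z)).comp (symmDeriv I' s z) =
    (symmDeriv I p (inCharts I I' F s p z)).comp (fderiv ℝ (inCharts I I' F s p) z) :=
      e3.symm.trans (e1.trans e2)
  exact congrArg (fun L : E' →L[ℝ] E => L v) h5

theorem chartForm_pullback (T : Tensor₂ I M) {F : N → M} (hF : ContMDiff I' I ∞ F) {s : N} {p : M}
    {z : E'} (hz : z ∈ (extChartAt I' s).target)
    (hp : F ((extChartAt I' s).symm z) ∈ (chartAt H p).source) (v w : E') :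
    chartForm (pullback I' T F) s z v w = chartForm T p (inCharts I I' F s p z)
      (fderiv ℝ (inCharts I I' F s p) z v) (fderiv ℝ (inCharts I I' F s p) z w) := by
  have h2 : ∀ x x' : M, x' = x → ∀ a c : E, modelForm T x' a c = modelForm T x a c := by
    rintro x x' rfl a c
    rfl
  have h3 : (extChartAt I p).symm (inCharts I I' F s p z) = F ((extChartAt I' s).symm z) :=
    (extChartAt I p).left_inv (by rw [extChartAt_source]; exact hp)
  rw [chartForm_eq_symmDeriv T, h2 _ _ h3, ← mfderiv_inCharts hF hz hp, ← mfderiv_inCharts hF hz hp]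
  rfl

/-- With this the coordinate results on Riemannian metrics, in particular the maximum principles,
apply on the hypersurface itself. -/
theorem metricOn_pullback (g : Bundle.ContMDiffRiemannianMetric I ∞ E
    (fun x : M => TangentSpace I x)) {F : N → M} (hF : ContMDiff I' I ∞ F)
    (hi : ∀ s, Function.Injective (mfderiv I' I F s)) (s : N) :
    MetricOn (extChartAt I' s).target (chartForm (pullback I' g.inner F) s) where
  isOpen := isOpen_extChartAt_target s
  smooth z hz := by
    -- The image of a chart domain of `N` need not lie in one chart of `M`, so smoothness at `z` is
    -- checked in the chart at the image of `z`.
    set p := F ((extChartAt I' s).symm z)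
    have hp : F ((extChartAt I' s).symm z) ∈ (chartAt H p).source := mem_chart_source H p
    have hev := eventually_mem_source hF.continuous hz hp
    obtain ⟨W, hWs, hWo, hzW⟩ := eventually_nhds_iff.1 hev
    have hf : ContDiffOn ℝ ∞ (inCharts I I' F s p) W := fun x hx =>
      (contDiffAt_inCharts hF (hWs x hx).1 (hWs x hx).2).contDiffWithinAt
    have hdf : ContDiffOn ℝ ∞ (fderiv ℝ (inCharts I I' F s p)) W := fun x hx =>
      ((contDiffAt_inCharts hF (hWs x hx).1 (hWs x hx).2).fderiv_right le_rfl).contDiffWithinAt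
    have hmaps : Set.MapsTo (inCharts I I' F s p) W (extChartAt I p).target := fun x hx =>
      (extChartAt I p).map_source (by rw [extChartAt_source]; exact (hWs x hx).2)
    have hg : ContDiffOn ℝ ∞ (fun x => chartForm g.inner p (inCharts I I' F s p x)) W :=
      ContDiffOn.comp (t := (extChartAt I p).target) (g := chartForm g.inner p)
        (fun x hx => ((metricOn_chartForm g p).smooth x hx).contDiffWithinAt) hf hmaps
    have : ContDiffOn ℝ ∞ (chartForm (pullback I' g.inner F) s) W := by
      rw [contDiffOn_clm_apply]
      intro v
      rw [contDiffOn_clm_apply]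
      intro w
      refine ((hg.clm_apply (hdf.clm_apply (contDiffOn_const (c := v)))).clm_apply
        (hdf.clm_apply (contDiffOn_const (c := w)))).congr fun x hx => ?_
      exact chartForm_pullback g.inner hF (hWs x hx).1 (hWs x hx).2 v w
    exact this.contDiffAt (hWo.mem_nhds hzW)
  symm z hz v w := by
    rw [chartForm_eq_symmDeriv, chartForm_eq_symmDeriv]
    exact g.symm _ _ _
  pos z hz v hv := by
    rw [chartForm_eq_symmDeriv]
    refine g.pos _ _ fun h => hv ?_
    refine (mfderiv_extChartAt_symm_bijective s hz).1
      (Eq.trans (hi _ ?_) (map_zero (mfderiv 𝓘(ℝ, E') I' (extChartAt I' s).symm z)).symm)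
    exact h.trans (map_zero (mfderiv I' I F ((extChartAt I' s).symm z))).symm

end InducedMetric

/-! ### The Laplacian on a marginally outer trapped surface -/

section Laplacian

variable {E : Type*} [NormedAddCommGroup E] [NormedSpace ℝ E] [FiniteDimensional ℝ E]
  {H : Type*} [TopologicalSpace H] {I : ModelWithCorners ℝ E H} [I.Boundaryless]
  {M : Type*} [TopologicalSpace M] [ChartedSpace H M] [IsManifold I ∞ M]
  {E' : Type*} [NormedAddCommGroup E'] [NormedSpace ℝ E'] [FiniteDimensional ℝ E']
  {H' : Type*} [TopologicalSpace H'] {I' : ModelWithCorners ℝ E' H'} [I'.Boundaryless]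
  {N : Type*} [TopologicalSpace N] [ChartedSpace H' N] [IsManifold I' ∞ N]
  {ι κ : Type*} [Fintype ι] [DecidableEq ι] [Fintype κ] [DecidableEq κ]
  {b : Basis ι ℝ E} {b' : Basis κ ℝ E'}

/-- The Laplacian of a function in coordinates. -/
def laplacian (b : Basis ι ℝ E) (g : E → E →L[ℝ] E →L[ℝ] ℝ) (q : E → ℝ) (y : E) : ℝ :=
  trace (mat b (g y)) (mat b (hess b (fun z => mat b (g z)) q y))

/-- A vector is determined by its products with a hyperplane and a unit normal. -/
theorem eq_smul_of_orthogonal {g : E →L[ℝ] E →L[ℝ] ℝ}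
    (hcard : Module.finrank ℝ E = Fintype.card κ + 1) (b' : Basis κ ℝ E')
    (hp : ∀ v, v ≠ 0 → 0 < g v v)
    {d : E' →L[ℝ] E} (hd : Function.Injective d) {ν : E} (h1 : g ν ν = 1)
    (h0 : ∀ v, g ν (d v) = 0) (hs : ∀ v w, g v w = g w v) {x : E} (hx : ∀ v, g (d v) x = 0) :
    x = g ν x • ν := by
  obtain ⟨e, he, he'⟩ := exists_adapted_basis b' hcard hd h1 h0
  by_contra hne
  have hpos := hp _ (sub_ne_zero.2 hne)
  have : ∀ w, g w (x - g ν x • ν) = 0 := by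
    intro w
    induction w using basis_induction e with
    | h0 => simp
    | ha x y hx hy => simp only [map_add, add_apply, hx, hy, add_zero]
    | hs c x hx => simp only [map_smul, smul_apply, hx, smul_zero]
    | hb i =>
      rcases i with i | i
      · rw [he, map_sub, map_smul, hx, hs _ ν, h0]
        simp
      · rw [he', map_sub, map_smul, h1]
        simp
  rw [this] at hpos
  exact hpos.false

/-! ### Hessian and Laplacian of a restricted function -/

section Coordinates

variable {U : Set E} {U' : Set E'} {g : E → E →L[ℝ] E →L[ℝ] ℝ} {h : E' → E' →L[ℝ] E' →L[ℝ] ℝ}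
  {f : E' → E} {z : E'} {n : E} {q : E → ℝ}

/-- By the Gauss formula `d²f + Γ(df, df) - df(Γ_h)` is orthogonal to the image of `df`, hence a
multiple of `n`. Applying `dq` to it gives the correction to the ambient Hessian. -/
theorem hess_comp_of_pullback (hcard : Module.finrank ℝ E = Fintype.card κ + 1)
    (hh : MetricOn U' h) (hz : z ∈ U') (hg : MetricOn U g) (hfz : f z ∈ U)
    (hf : ContDiffAt ℝ ∞ f z)
    (hp : ∀ᶠ x in 𝓝 z, ∀ v w, h x v w = g (f x) (fderiv ℝ f x v) (fderiv ℝ f x w))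
    (hd : Function.Injective (fderiv ℝ f z)) (hn1 : g (f z) n n = 1)
    (hn0 : ∀ v, g (f z) n (fderiv ℝ f z v) = 0) (hq : ContDiffAt ℝ ∞ q (f z)) (v w : E') :
    hess b' (fun x => mat b' (h x)) (fun x => q (f x)) z v w =
      hess b (fun x => mat b (g x)) q (f z) (fderiv ℝ f z v) (fderiv ℝ f z w) +
        fderiv ℝ q (f z) n * g (f z) n (fderiv ℝ (fderiv ℝ f) z v w +
          gammaL b (fun x => mat b (g x)) (f z) (fderiv ℝ f z v) (fderiv ℝ f z w)) := by
  have hX := eq_smul_of_orthogonal hcard b' (hg.pos _ hfz) hd hn1 hn0 (hg.symm _ hfz)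
    (x := gammaL b (fun x => mat b (g x)) (f z) (fderiv ℝ f z v) (fderiv ℝ f z w) +
      fderiv ℝ (fderiv ℝ f) z v w - fderiv ℝ f z (gammaL b' (fun x => mat b' (h x)) z v w))
    (fun u => by
      rw [map_sub, sub_eq_zero, ← hh.gauss (b := b) (b' := b') hz hg hfz hf hp, hp.self_of_nhds])
  rw [map_sub, hn0, sub_zero] at hX
  have hX' := congrArg (fderiv ℝ q (f z)) hX
  rw [map_smul, map_sub, map_add, smul_eq_mul, add_comm (gammaL b _ _ _ _)] at hX'
  rw [hess_apply, hess_apply, fderiv_fderiv_comp hf hq,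
    fderiv_comp_of_contDiffAt (hf.differentiableAt (by simp)) (hq.differentiableAt (by simp))]
  linear_combination hX'

/-- The trace of the Hessian formula: the tangential trace of the ambient Hessian is the full trace
minus its value on the normal, and the correction term is the mean curvature times the normal
derivative. -/
theorem laplacian_comp_of_pullback (hcard : Module.finrank ℝ E = Fintype.card κ + 1)
    (hh : MetricOn U' h) (hz : z ∈ U') (hg : MetricOn U g) (hfz : f z ∈ U)
    (hf : ContDiffAt ℝ ∞ f z)
    (hp : ∀ᶠ x in 𝓝 z, ∀ v w, h x v w = g (f x) (fderiv ℝ f x v) (fderiv ℝ f x w))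
    (hd : Function.Injective (fderiv ℝ f z)) (hn1 : g (f z) n n = 1)
    (hn0 : ∀ v, g (f z) n (fderiv ℝ f z v) = 0) (hq : ContDiffAt ℝ ∞ q (f z))
    {A : Matrix κ κ ℝ} (hA : ∀ a c, A a c = -g (f z) n (fderiv ℝ (fderiv ℝ f) z (b' a) (b' c) +
      gammaL b (fun x => mat b (g x)) (f z) (fderiv ℝ f z (b' a)) (fderiv ℝ f z (b' c)))) :
    laplacian b' h (fun x => q (f x)) z =
      laplacian b g q (f z) - hess b (fun x => mat b (g x)) q (f z) n n -
        fderiv ℝ q (f z) n * trace (mat b' (h z)) A := by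
  have hmat : mat b' (hess b' (fun x => mat b' (h x)) (fun x => q (f x)) z) =
      mat b' ((hess b (fun x => mat b (g x)) q (f z)).bilinearComp (fderiv ℝ f z) (fderiv ℝ f z)) +
        (-fderiv ℝ q (f z) n) • A := by
    ext a c
    refine (hess_comp_of_pullback (b := b) hcard hh hz hg hfz hf hp hd hn1 hn0 hq _ _).trans ?_
    simp [mat_apply, hA]
    ring
  have hhz : mat b' (h z) = mat b' ((g (f z)).bilinearComp (fderiv ℝ f z) (fderiv ℝ f z)) := by
    ext a c
    exact hp.self_of_nhds _ _
  rw [laplacian, laplacian, hmat, trace_add, trace_smul, trace_eq_trace_add b b' hcard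
    (hg.symm _ hfz) (hg.pos _ hfz) hd hn1 hn0, ← hhz]
  ring

end Coordinates

theorem writtenInExtChartAt_eq_inCharts (F : N → M) (s : N) :
    writtenInExtChartAt I' I s F = inCharts I I' F s (F s) := rfl

theorem secondForm_eq_neg {D : InitialData I M} {F : N → M} (hF : ContMDiff I' I ∞ F)
    (ν : ∀ s : N, TangentSpace I (F s)) (s : N) (a c : κ) :
    D.secondForm I' b b' F ν s a c = -modelForm D.g.inner (F s) (ν s)
      (fderiv ℝ (fderiv ℝ (inCharts I I' F s (F s))) (extChartAt I' s s) (b' a) (b' c) +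
        gammaL b (coords b D.g.inner (F s)) (extChartAt I (F s) (F s))
          (fderiv ℝ (inCharts I I' F s (F s)) (extChartAt I' s s) (b' a))
          (fderiv ℝ (inCharts I I' F s (F s)) (extChartAt I' s s) (b' c))) := by
  have hf : ContDiffAt ℝ ∞ (inCharts I I' F s (F s)) (extChartAt I' s s) :=
    contDiffAt_inCharts hF (mem_extChartAt_target s)
      (by rw [extChartAt_to_inv]; exact mem_chart_source H (F s))
  have hsnd : fderiv ℝ (fun z => fderiv ℝ (inCharts I I' F s (F s)) z (b' c)) (extChartAt I' s s)
      (b' a) = fderiv ℝ (fderiv ℝ (inCharts I I' F s (F s))) (extChartAt I' s s) (b' a) (b' c) := by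
    rw [fderiv_clm_apply ((hf.fderiv_right (m := ∞) le_rfl).differentiableAt (by simp))
      (differentiableAt_const _)]
    simp
  have h := secondForm_apply (I' := I') b b' D F ν s a c
  rw [writtenInExtChartAt_eq_inCharts, hsnd] at h
  exact h

theorem inCharts_self (F : N → M) (s : N) :
    inCharts I I' F s (F s) (extChartAt I' s s) = extChartAt I (F s) (F s) := by
  rw [inCharts, extChartAt_to_inv]

theorem fderiv_inCharts_self {F : N → M} (hF : ContMDiff I' I ∞ F) (s : N) :
    fderiv ℝ (inCharts I I' F s (F s)) (extChartAt I' s s) = modelDeriv I I' F s :=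
  (modelDeriv_eq (hF.mdifferentiableAt (by simp))).symm

theorem null_expansion_eq {D : InitialData I M} {F : N → M} {ν : ∀ s : N, TangentSpace I (F s)}
    (hM : D.IsMOTS I' b b' F ν) (s : N) :
    trace (mat b' (modelPullback (I' := I') D.g.inner F s)) (D.secondForm I' b b' F ν s) +
      trace (mat b' (modelPullback (I' := I') D.g.inner F s))
        (mat b' (modelPullback (I' := I') D.K F s)) = 0 := by
  rw [← coords_pullback, ← coords_pullback]
  exact hM.null_expansion s

/-- The Laplacian of the restriction of a function to a marginally outer trapped surface. -/
theorem laplacian_comp_of_isMOTS (hcard : Module.finrank ℝ E = Fintype.card κ + 1)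
    {D : InitialData I M} {F : N → M} {ν : ∀ s : N, TangentSpace I (F s)}
    (hM : D.IsMOTS I' b b' F ν) (s : N) {q : E → ℝ}
    (hq : ContDiffAt ℝ ∞ q (extChartAt I (F s) (F s))) :
    laplacian b' (chartForm (pullback I' D.g.inner F) s) (fun z => q (inCharts I I' F s (F s) z))
        (extChartAt I' s s) =
      laplacian b (chartForm D.g.inner (F s)) q (extChartAt I (F s) (F s)) -
        hess b (fun z => mat b (chartForm D.g.inner (F s) z)) q (extChartAt I (F s) (F s)) (ν s) (ν s) +
        fderiv ℝ q (extChartAt I (F s) (F s)) (ν s) *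
          (trace (mat b (modelForm D.g.inner (F s))) (mat b (modelForm D.K (F s))) -
            modelForm D.K (F s) (ν s) (ν s)) := by
  have hz := mem_extChartAt_target (I := I') s
  have hp : F ((extChartAt I' s).symm (extChartAt I' s s)) ∈ (chartAt H (F s)).source := by
    rw [extChartAt_to_inv]
    exact mem_chart_source H (F s)
  have hg := metricOn_chartForm D.g (F s)
  have hgy := mem_extChartAt_target (I := I) (F s)
  have hd := fderiv_inCharts_self hM.smooth s
  have hfy := inCharts_self (I := I) (I' := I') F s
  have hg_eq : chartForm D.g.inner (F s) (extChartAt I (F s) (F s)) = modelForm D.g.inner (F s) :=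
    chartForm_self _ _
  have hdi : Function.Injective (fderiv ℝ (inCharts I I' F s (F s)) (extChartAt I' s s)) := by
    rw [hd]
    exact hM.immersion s
  have hn1 : modelForm D.g.inner (F s) (ν s) (ν s) = 1 := (hM.unit_normal s).1
  have hn0 : ∀ v, modelForm D.g.inner (F s) (ν s) (modelDeriv I I' F s v) = 0 :=
    (hM.unit_normal s).2
  have key := laplacian_comp_of_pullback (b := b) (b' := b') (n := ν s) (q := q)
    (A := D.secondForm I' b b' F ν s) hcard
    (metricOn_pullback D.g hM.smooth hM.immersion s) hz hg (by rw [hfy]; exact hgy)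
    (contDiffAt_inCharts hM.smooth hz hp)
    (by
      filter_upwards [eventually_mem_source hM.smooth.continuous hz hp] with x hx v w
      exact chartForm_pullback D.g.inner hM.smooth hx.1 hx.2 v w)
    hdi (by rw [hfy, hg_eq]; exact hn1) (by rw [hfy, hg_eq, hd]; exact hn0)
    (by rw [hfy]; exact hq)
    (by
      intro a c
      rw [hfy, hg_eq]
      exact secondForm_eq_neg hM.smooth ν s a c)
  have hnull := null_expansion_eq hM s
  have hdm : Function.Injective (modelDeriv I I' F s) := hM.immersion s
  have hgs : ∀ v w, modelForm D.g.inner (F s) v w = modelForm D.g.inner (F s) w v := by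
    rw [← hg_eq]
    exact hg.symm _ hgy
  have hgp : ∀ v, v ≠ 0 → 0 < modelForm D.g.inner (F s) v v := by
    rw [← hg_eq]
    exact hg.pos _ hgy
  have t2 := trace_eq_trace_add b b' hcard hgs hgp hdm hn1 hn0 (modelForm D.K (F s))
  have hhy : mat b' (chartForm (pullback I' D.g.inner F) s (extChartAt I' s s)) =
      mat b' (modelPullback (I' := I') D.g.inner F s) := by
    rw [← coords_eq_mat, coords_pullback]
  rw [hhy, hfy] at key
  rw [modelPullback, modelPullback] at hnull
  rw [modelPullback] at key
  rw [t2]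
  refine key.trans ?_
  linear_combination (-fderiv ℝ q (extChartAt I (F s) (F s)) (ν s)) * hnull

end Laplacian

/-! ### The height function on marginally outer trapped surfaces -/

section Height

variable {S : Type*} [TopologicalSpace S] [ChartedSpace Plane S] [IsManifold (𝓡 2) ∞ S]
  (γ : Bundle.ContMDiffRiemannianMetric (𝓡 2) ∞ Plane (fun x : S => TangentSpace (𝓡 2) x))
  {L : ℝ} {r h p q : ℝ → ℝ} (hL : 0 < L) (hr : ContDiff ℝ ∞ r) (hr0 : ∀ t, 0 < r t)
  (hp : ContDiff ℝ ∞ p) (hq : ContDiff ℝ ∞ q)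

theorem mat_injective {E ι : Type*} [NormedAddCommGroup E] [NormedSpace ℝ E] [Fintype ι]
    (b : Basis ι ℝ E) : Function.Injective (mat b) := by
  classical
  intro A B hAB
  refine ContinuousLinearMap.ext fun v => ContinuousLinearMap.ext fun w => ?_
  rw [apply_eq_sum b A, apply_eq_sum b B]
  refine Finset.sum_congr rfl fun i _ => Finset.sum_congr rfl fun j _ => ?_
  rw [← mat_apply, ← mat_apply, hAB]

/-- The second derivatives of `t` vanish in product coordinates, so its Hessian is `-Γᵗ`, which has
only a horizontal block. -/
theorem hess_snd_warped {U : Set Plane} {g : Plane → Plane →L[ℝ] Plane →L[ℝ] ℝ}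
    {G : Plane × ℝ → Matrix (Fin 2 ⊕ Unit) (Fin 2 ⊕ Unit) ℝ}
    (hg : MetricOn U g) (hr : Differentiable ℝ r) (hr0 : ∀ t, 0 < r t) (hL : 0 < L)
    (hG : ∀ z : Plane × ℝ, z.1 ∈ U → G z = mat cylBasis (warpedForm (g z.1) (L ^ 2) (r z.2 ^ 2)))
    {y : Plane × ℝ} (hy : y.1 ∈ U) :
    hess cylBasis G Prod.snd y = warpedForm (g y.1) 0 (r y.2 * deriv r y.2 / L ^ 2) := by
  obtain ⟨-, c2, -, -, c5, c6, c7⟩ := christoffel_warped hg hr hr0 hL hG hy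
  have h1 : fderiv ℝ (fderiv ℝ (Prod.snd : Plane × ℝ → ℝ)) y = 0 := by
    have : fderiv ℝ (Prod.snd : Plane × ℝ → ℝ) = fun _ => ContinuousLinearMap.snd ℝ Plane ℝ :=
      funext fun z => fderiv_snd
    rw [this, fderiv_fun_const]
    rfl
  apply mat_injective cylBasis
  ext i j
  rw [mat_apply, mat_apply, hess_apply, h1, fderiv_snd, warpedForm_apply, zero_apply, zero_apply,
    ContinuousLinearMap.coe_snd', ← repr_cylBasis_inr _ (), repr_gammaL_basis]
  rcases i with i | i <;> rcases j with j | j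
  · simp [c2, cylBasis_inl]
  · simp [c7, cylBasis_inl, cylBasis_inr]
  · simp [c6, cylBasis_inl, cylBasis_inr]
  · simp [c5, cylBasis_inr]

theorem finrank_cyl : Module.finrank ℝ (Plane × ℝ) = Fintype.card (Fin 2) + 1 := by
  simp

variable {N : Type*} [TopologicalSpace N] [ChartedSpace Plane N] [IsManifold (𝓡 2) ∞ N]
  {F : N → S × ℝ} {ν : ∀ s : N, TangentSpace cylModel (F s)}

/-- The height function in the chart at `s`. -/
def heightIn (F : N → S × ℝ) (s : N) (z : Plane) : ℝ := (F ((extChartAt (𝓡 2) s).symm z)).2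

theorem heightIn_eq (F : N → S × ℝ) (s : N) (x : S × ℝ) (z : Plane) :
    heightIn F s z = (inCharts cylModel (𝓡 2) F s x z).2 := by
  rw [heightIn, inCharts, extChartAt_cyl_apply]

theorem contDiffAt_heightIn (hF : ContMDiff (𝓡 2) cylModel ∞ F) (s : N) {z : Plane}
    (hz : z ∈ (extChartAt (𝓡 2) s).target) : ContDiffAt ℝ ∞ (heightIn F s) z := by
  have h1 := contDiffAt_inCharts (p := F ((extChartAt (𝓡 2) s).symm z)) hF hz (mem_chart_source _ _)
  have h2 : heightIn F s =
      fun z' => (inCharts cylModel (𝓡 2) F s (F ((extChartAt (𝓡 2) s).symm z)) z').2 :=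
    funext fun z' => heightIn_eq F s _ z'
  rw [h2]
  exact contDiff_snd.contDiffAt.comp z h1

theorem modelForm_g_profileData (x : S × ℝ) :
    modelForm (profileData γ hL hr hr0 hp hq).g.inner x =
      warpedForm (modelForm γ.inner x.1) (L ^ 2) (r x.2 ^ 2) := rfl

theorem modelForm_K_profileData (x : S × ℝ) :
    modelForm (profileData γ hL hr hr0 hp hq).K x =
      warpedForm (modelForm γ.inner x.1) (L ^ 2 * q x.2) (r x.2 ^ 2 * (p x.2 / 2)) := rfl

theorem hess_snd_profileData (hrh : ∀ t, deriv r t = L / 2 * h t * r t) (x : S × ℝ) :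
    hess cylBasis
      (fun z => mat cylBasis (chartForm (profileData γ hL hr hr0 hp hq).g.inner x z)) Prod.snd
      (extChartAt cylModel x x) =
      warpedForm (modelForm γ.inner x.1) 0 (h x.2 / (2 * L) * r x.2 ^ 2) := by
  have hx : (extChartAt cylModel x x).1 ∈ (extChartAt (𝓡 2) x.1).target := by
    rw [extChartAt_cyl_apply]
    exact mem_extChartAt_target x.1
  have e : r x.2 * deriv r x.2 / L ^ 2 = h x.2 / (2 * L) * r x.2 ^ 2 := by
    rw [hrh]
    field_simp
  have hG : ∀ z : Plane × ℝ, z.1 ∈ (extChartAt (𝓡 2) x.1).target →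
      coords cylBasis (profileData γ hL hr hr0 hp hq).g.inner x z =
        mat cylBasis (warpedForm (chartForm γ.inner x.1 z.1) (L ^ 2) (r z.2 ^ 2)) := fun z hz =>
    coords_warped γ.inner (fun _ => L ^ 2) (fun t => r t ^ 2) x hz
  have h1 := hess_snd_warped (metricOn_chartForm γ x.1) (hr.differentiable (by simp)) hr0 hL hG hx
  rw [extChartAt_cyl_apply, chartForm_self, e] at h1
  rw [extChartAt_cyl_apply]
  exact h1

theorem trace_profileData (x : S × ℝ) (k m : ℝ) :
    trace (mat cylBasis (modelForm (profileData γ hL hr hr0 hp hq).g.inner x))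
      (mat cylBasis (warpedForm (modelForm γ.inner x.1) k m)) = k / L ^ 2 + 2 * m / r x.2 ^ 2 := by
  rw [modelForm_g_profileData, ← chartForm_self,
    trace_warped (metricOn_chartForm γ x.1) (mem_extChartAt_target x.1) (pow_pos hL 2)
      (pow_pos (hr0 _) 2)]

theorem laplacian_snd_profileData (hrh : ∀ t, deriv r t = L / 2 * h t * r t) (x : S × ℝ) :
    laplacian cylBasis (chartForm (profileData γ hL hr hr0 hp hq).g.inner x) Prod.snd
      (extChartAt cylModel x x) = h x.2 / L := by
  have hr1 := (hr0 x.2).ne'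
  rw [laplacian, hess_snd_profileData γ hL hr hr0 hp hq hrh, chartForm_self, trace_profileData]
  field_simp
  ring

theorem trace_K_profileData (x : S × ℝ) :
    trace (mat cylBasis (modelForm (profileData γ hL hr hr0 hp hq).g.inner x))
      (mat cylBasis (modelForm (profileData γ hL hr hr0 hp hq).K x)) = q x.2 + p x.2 := by
  have hr1 := (hr0 x.2).ne'
  rw [modelForm_K_profileData, trace_profileData]
  field_simp

/-- At a critical point of the height function the normal is vertical. -/
theorem normal_of_isMOTS
    (hM : (profileData γ hL hr hr0 hp hq).IsMOTS (𝓡 2) cylBasis planeBasis F ν) (s : N)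
    {n : Plane × ℝ} (hn1 : modelForm (profileData γ hL hr hr0 hp hq).g.inner (F s) n n = 1)
    (hn0 : ∀ v, modelForm (profileData γ hL hr hr0 hp hq).g.inner (F s) n
      (modelDeriv cylModel (𝓡 2) F s v) = 0)
    (h0 : fderiv ℝ (heightIn F s) (extChartAt (𝓡 2) s s) = 0) : (L * n.2) ^ 2 = 1 := by
  have hu : (fun z => (inCharts cylModel (𝓡 2) F s (F s) z).2) = heightIn F s :=
    funext fun z => (heightIn_eq F s (F s) z).symm
  have hd : ∀ v, (modelDeriv cylModel (𝓡 2) F s v).2 = 0 := by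
    intro v
    have h1 : DifferentiableAt ℝ (inCharts cylModel (𝓡 2) F s (F s)) (extChartAt (𝓡 2) s s) :=
      (contDiffAt_inCharts hM.smooth (mem_extChartAt_target s)
        (by rw [extChartAt_to_inv]; exact mem_chart_source _ _)).differentiableAt (by simp)
    have h2 : fderiv ℝ (fun z => (inCharts cylModel (𝓡 2) F s (F s) z).2)
        (extChartAt (𝓡 2) s s) v = _ :=
      fderiv_comp_of_contDiffAt (q := Prod.snd) h1 differentiableAt_snd v
    rw [hu, h0, fderiv_snd, fderiv_inCharts_self hM.smooth] at h2
    exact h2.symm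
  -- At a critical point `∂ₜ` is orthogonal to the surface, hence equals `g(ν, ∂ₜ) ν`; the vertical
  -- component of this identity is the claim.
  have he := eq_smul_of_orthogonal (g := modelForm (profileData γ hL hr hr0 hp hq).g.inner (F s))
    finrank_cyl planeBasis (fun v hv => (profileData γ hL hr hr0 hp hq).g.pos (F s) v hv)
    (d := modelDeriv cylModel (𝓡 2) F s) (hM.immersion s) hn1 hn0
    (fun v w => (profileData γ hL hr hr0 hp hq).g.symm (F s) v w)
    (x := ((0, 1) : Plane × ℝ)) (fun v => by
      rw [modelForm_g_profileData, warpedForm_apply, hd]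
      simp)
  have he2 := congrArg Prod.snd he
  rw [modelForm_g_profileData, warpedForm_apply] at he2
  simp at he2
  nlinarith

/-- The Laplacian of the height function. -/
theorem laplacian_height (hrh : ∀ t, deriv r t = L / 2 * h t * r t)
    (hM : (profileData γ hL hr hr0 hp hq).IsMOTS (𝓡 2) cylBasis planeBasis F ν) (s : N) :
    ∃ n w : ℝ, w = (L * n) ^ 2 ∧ w ≤ 1 ∧
      (fderiv ℝ (heightIn F s) (extChartAt (𝓡 2) s s) = 0 → w = 1) ∧
      laplacian planeBasis (chartForm (pullback (𝓡 2) (profileData γ hL hr hr0 hp hq).g.inner F) s)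
        (heightIn F s) (extChartAt (𝓡 2) s s) =
        h (F s).2 / (2 * L) * (1 + w) +
          n * (q (F s).2 * (1 - w) + p (F s).2 * (1 + w) / 2) := by
  obtain ⟨n, hn⟩ : ∃ n : Plane × ℝ, n = ν s := ⟨_, rfl⟩
  have hn1 : modelForm (profileData γ hL hr hr0 hp hq).g.inner (F s) n n = 1 := by
    rw [hn]
    exact (hM.unit_normal s).1
  have hn0 : ∀ v, modelForm (profileData γ hL hr hr0 hp hq).g.inner (F s) n
      (modelDeriv cylModel (𝓡 2) F s v) = 0 := by
    rw [hn]
    exact (hM.unit_normal s).2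
  have hk := laplacian_comp_of_isMOTS (q := Prod.snd) finrank_cyl hM s contDiff_snd.contDiffAt
  have hu : (fun z => (inCharts cylModel (𝓡 2) F s (F s) z).2) = heightIn F s :=
    funext fun z => (heightIn_eq F s (F s) z).symm
  have hγ0 : 0 ≤ modelForm γ.inner (F s).1 n.1 n.1 := modelForm_nonneg γ _ _
  have hone := normal_of_isMOTS γ hL hr hr0 hp hq hM s hn1 hn0
  rw [← hn, hu, laplacian_snd_profileData γ hL hr hr0 hp hq hrh, trace_K_profileData,
    hess_snd_profileData γ hL hr hr0 hp hq hrh, modelForm_K_profileData, fderiv_snd,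
    warpedForm_apply, warpedForm_apply] at hk
  rw [modelForm_g_profileData, warpedForm_apply] at hn1
  -- `w` is the squared length of the vertical part of the unit normal, and `1 - w` that of the
  -- horizontal part. So `Hess t(ν, ν) = h (1 - w) / (2L)` and `K(ν, ν) = q w + p (1 - w) / 2`.
  refine ⟨n.2, (L * n.2) ^ 2, rfl, ?_, hone, hk.trans ?_⟩
  · nlinarith [mul_nonneg (sq_nonneg (r (F s).2)) hγ0]
  · have e2 : h (F s).2 / L = 2 * (h (F s).2 / (2 * L)) := by field_simp
    rw [e2]
    simp only [ContinuousLinearMap.coe_snd']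
    linear_combination (-n.2 * p (F s).2 / 2 - h (F s).2 / (2 * L)) * hn1

end Height

/-! ### The strong maximum principle -/

section MaximumPrinciple

variable {E : Type*} [NormedAddCommGroup E] [NormedSpace ℝ E] [FiniteDimensional ℝ E]
  {ι : Type*} [Fintype ι] [DecidableEq ι] {b : Basis ι ℝ E}
  {U : Set E} {g : E → E →L[ℝ] E →L[ℝ] ℝ} {u v : E → ℝ} {y : E}

/-- At a critical point the Christoffel term drops out of the Hessian, which is then the negative
semidefinite second derivative. -/
theorem laplacian_nonpos_of_isLocalMax (hg : MetricOn U g) (hy : y ∈ U) (hm : IsLocalMax u y)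
    (hu : ContDiffAt ℝ ∞ u y) : laplacian b g u y ≤ 0 := by
  have h := trace_nonneg b (hg.symm y hy) (hg.pos y hy)
    (B := (-1 : ℝ) • hess b (fun z => mat b (g z)) u y) fun w => by
      have := fderiv_fderiv_nonpos_of_isLocalMax hm hu w
      rw [smul_apply, smul_apply, hess_apply, hm.fderiv_eq_zero, zero_apply, smul_eq_mul]
      linarith
  rw [mat_smul, trace_smul] at h
  rw [laplacian]
  linarith

theorem hess_add_const_mul {G : E → Matrix ι ι ℝ} (hu : ContDiffAt ℝ ∞ u y)
    (hv : ContDiffAt ℝ ∞ v y) (δ : ℝ) :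
    hess b G (fun z => u z + δ * v z) y = hess b G u y + δ • hess b G v y := by
  have hd : ∀ {q : E → ℝ}, ContDiffAt ℝ ∞ q y → ∀ᶠ z in 𝓝 y, DifferentiableAt ℝ q z :=
    fun hq => ((hq.of_le (m := 1) (by simp)).eventually (by simp)).mono fun x hx =>
      hx.differentiableAt (by simp)
  have hd2 : ∀ {q : E → ℝ}, ContDiffAt ℝ ∞ q y → DifferentiableAt ℝ (fderiv ℝ q) y :=
    fun hq => (hq.fderiv_right (m := ∞) le_rfl).differentiableAt (by simp)
  have h1 : fderiv ℝ (fun z => u z + δ * v z) =ᶠ[𝓝 y] fun z => fderiv ℝ u z + δ • fderiv ℝ v z := by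
    filter_upwards [hd hu, hd hv] with z hz hz'
    exact (hz.hasFDerivAt.add (hz'.hasFDerivAt.const_mul δ)).fderiv
  have h2 : fderiv ℝ (fun z => fderiv ℝ u z + δ • fderiv ℝ v z) y = _ :=
    ((hd2 hu).hasFDerivAt.add ((hd2 hv).hasFDerivAt.const_smul δ)).fderiv
  refine ContinuousLinearMap.ext fun w => ContinuousLinearMap.ext fun x => ?_
  simp only [add_apply, smul_apply, hess_apply]
  rw [h1.fderiv_eq, h2, h1.self_of_nhds]
  simp only [add_apply, smul_apply, smul_eq_mul]
  ring

theorem laplacian_add_const_mul (hu : ContDiffAt ℝ ∞ u y) (hv : ContDiffAt ℝ ∞ v y) (δ : ℝ) :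
    laplacian b g (fun z => u z + δ * v z) y = laplacian b g u y + δ * laplacian b g v y := by
  rw [laplacian, hess_add_const_mul hu hv, mat_add, mat_smul, trace_add, trace_smul]
  rfl

theorem continuousAt_laplacian (hg : MetricOn U g) (hy : y ∈ U) (hv : ContDiffAt ℝ ∞ v y) :
    ContinuousAt (laplacian b g v) y := by
  unfold laplacian trace
  refine tendsto_finsetSum _ fun i _ => tendsto_finsetSum _ fun j _ => ?_
  have h1 : ContinuousAt (fun z => (mat b (g z))⁻¹ i j) y :=
    (contDiffAt_inv (hg.contDiffAt_mat hy) (hg.isUnit hy) i j).continuousAt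
  have h2 : ContDiffAt ℝ ∞ (fderiv ℝ v) y := hv.fderiv_right le_rfl
  have h3 : ContDiffAt ℝ ∞ (fderiv ℝ (fderiv ℝ v)) y := h2.fderiv_right le_rfl
  have h4 : ContinuousAt (fun z => fderiv ℝ (fderiv ℝ v) z (b i) (b j) -
      fderiv ℝ v z (gammaL b (fun z => mat b (g z)) z (b i) (b j))) y :=
    (((h3.clm_apply contDiffAt_const).clm_apply contDiffAt_const).sub
      (h2.clm_apply (((hg.contDiffAt_gammaL hy).clm_apply contDiffAt_const).clm_apply
        contDiffAt_const))).continuousAt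
  exact h1.mul h4

/-- Where `v` vanishes, the square changes the Hessian only by a multiple of `dv ⊗ dv`. A large `α`
thus makes the Laplacian positive whenever `dv ≠ 0`, which gives the barrier for the strong maximum
principle. -/
theorem hess_add_mul_sq {G : E → Matrix ι ι ℝ} (hv : ContDiff ℝ ∞ v) (hy : v y = 0) (α : ℝ) :
    hess b G (fun z => v z + α * v z ^ 2) y =
      hess b G v y + (2 * α) • (fderiv ℝ v y).smulRight (fderiv ℝ v y) := by
  have hd : Differentiable ℝ v := hv.differentiable (by simp)
  have hd2 : DifferentiableAt ℝ (fderiv ℝ v) y :=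
    (hv.contDiffAt.fderiv_right (m := ∞) le_rfl).differentiableAt (by simp)
  have h1 : fderiv ℝ (fun z => v z + α * v z ^ 2) = fun z => (1 + 2 * α * v z) • fderiv ℝ v z := by
    funext z
    have h : fderiv ℝ (fun z => v z + α * v z ^ 2) z = _ :=
      ((hd z).hasFDerivAt.add (((hd z).hasFDerivAt.pow 2).const_mul α)).fderiv
    rw [h]
    ext w
    simp only [add_apply, smul_apply, smul_eq_mul]
    ring
  have h2 : fderiv ℝ (fun z => (1 + 2 * α * v z) • fderiv ℝ v z) y = _ :=
    ((((hd y).hasFDerivAt.const_mul (2 * α)).const_add 1).smul hd2.hasFDerivAt).fderiv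
  refine ContinuousLinearMap.ext fun w => ContinuousLinearMap.ext fun x => ?_
  simp only [add_apply, smul_apply, hess_apply]
  rw [h1, h2]
  simp only [add_apply, smul_apply, smul_eq_mul, ContinuousLinearMap.smulRight_apply, hy]
  ring

/-- On the compact part where `v ≥ 0`, `u` stays a definite amount below `c` and `v` is bounded, so
a small multiple of `v` fits; where `v < 0` any positive multiple helps. -/
theorem exists_pos_forall_add_mul_lt {X : Type*} [TopologicalSpace X] [T2Space X] {K : Set X} {u v : X → ℝ}
    {c : ℝ} (hK : IsCompact K) (hu : ContinuousOn u K) (hv : ContinuousOn v K)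
    (hle : ∀ y ∈ K, u y ≤ c) (h : ∀ y ∈ K, 0 ≤ v y → u y < c) :
    ∃ δ > 0, ∀ y ∈ K, u y + δ * v y < c := by
  have hK' : IsCompact (K ∩ v ⁻¹' Set.Ici 0) :=
    hK.of_isClosed_subset (hv.preimage_isClosed_of_isClosed hK.isClosed isClosed_Ici)
      Set.inter_subset_left
  rcases (K ∩ v ⁻¹' Set.Ici 0).eq_empty_or_nonempty with he | hne
  · refine ⟨1, one_pos, fun y hy => ?_⟩
    have : ¬ 0 ≤ v y := fun h0 => by
      have : y ∈ K ∩ v ⁻¹' Set.Ici 0 := ⟨hy, h0⟩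
      rw [he] at this
      exact this
    have := hle y hy
    linarith
  · obtain ⟨a, ha, hamax⟩ := hK'.exists_isMaxOn hne (hu.mono Set.inter_subset_left)
    obtain ⟨e, he, hemax⟩ := hK'.exists_isMaxOn hne (hv.mono Set.inter_subset_left)
    have hac := h a ha.1 ha.2
    have he0 : 0 ≤ v e := he.2
    -- The gap at the maximum of `u` over the bound for `v`; the added `1` keeps the denominator
    -- positive and the inequality strict.
    refine ⟨(c - u a) / (v e + 1), div_pos (by linarith) (by linarith), fun y hy => ?_⟩
    have hδ : 0 < (c - u a) / (v e + 1) := div_pos (by linarith) (by linarith)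
    by_cases h0 : 0 ≤ v y
    · have h1 : u y ≤ u a := hamax ⟨hy, h0⟩
      have h2 : v y ≤ v e := hemax ⟨hy, h0⟩
      have h3 : (c - u a) / (v e + 1) * v y < c - u a := by
        rw [div_mul_eq_mul_div, div_lt_iff₀ (by linarith)]
        nlinarith
      linarith
    · have := hle y hy
      nlinarith

end MaximumPrinciple

/-! ### Exterior tangent balls -/

section InteriorBall

open scoped RealInnerProductSpace

variable {E : Type*} [NormedAddCommGroup E] [InnerProductSpace ℝ E]

/-- A ball that is internally tangent touches the larger sphere in one point only. -/
theorem dist_lt_of_mem_tangent_ball {a z x : E} {d : ℝ} (hd : ‖z - a‖ = d) (hx : x ≠ z)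
    (h : ‖x - ((1 / 2 : ℝ) • (a + z))‖ ≤ d / 2) : ‖x - a‖ < d := by
  set w : E := (1 / 2 : ℝ) • (z - a) with hw
  set p : E := x - (1 / 2 : ℝ) • (a + z) with hp
  have e1 : x - a = p + w := by rw [hp, hw]; module
  have e2 : x - z = p - w := by rw [hp, hw]; module
  have hd0 : 0 ≤ d := hd ▸ norm_nonneg _
  have hwn : ‖w‖ = d / 2 := by rw [hw, norm_smul, hd]; norm_num; ring
  have h0 : 0 < ‖x - z‖ := norm_pos_iff.2 (sub_ne_zero.2 hx)
  have h1 := norm_add_sq_real p w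
  have h2 := norm_sub_sq_real p w
  rw [← e1, hwn] at h1
  rw [← e2, hwn] at h2
  have hpn := norm_nonneg p
  nlinarith [norm_nonneg (x - a), norm_nonneg (x - z), sq_nonneg (‖x - a‖ - d)]

/-- A point of a closed set that is not interior is close to a point with an exterior ball. -/
theorem exists_tangent_ball [ProperSpace E] {C : Set E} {y : E} {ρ : ℝ} (hρ : 0 < ρ) (hy : y ∈ C)
    (hC : IsClosed (C ∩ Metric.closedBall y ρ)) (hn : ¬ ∀ᶠ x in 𝓝 y, x ∈ C) :
    ∃ z ∈ C, ∃ a : E, dist z y < ρ ∧ z ≠ a ∧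
      ∀ x, ‖x - a‖ ≤ ‖z - a‖ → x ≠ z → x ∉ C ∧ dist x y < ρ := by
  obtain ⟨x₁, hx₁, hx₁C⟩ : ∃ x₁ ∈ Metric.ball y (ρ / 4), x₁ ∉ C := by
    by_contra! h
    exact hn (Filter.eventually_of_mem (Metric.ball_mem_nhds y (by positivity)) h)
  rw [Metric.mem_ball] at hx₁
  have hK : IsCompact (C ∩ Metric.closedBall y ρ) :=
    (isCompact_closedBall y ρ).of_isClosed_subset hC Set.inter_subset_right
  have hyK : y ∈ C ∩ Metric.closedBall y ρ := ⟨hy, Metric.mem_closedBall_self hρ.le⟩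
  -- `z` is a nearest point of the set to the outside point `x₁`. The ball with centre midway
  -- between them, of half the radius, touches the set in `z` alone. The radius `ρ / 4` keeps all
  -- this inside the `ρ`-ball where the set is known to be closed.
  obtain ⟨z, hz, hzd⟩ := hK.exists_infDist_eq_dist ⟨y, hyK⟩ x₁
  have hmin : ∀ x ∈ C ∩ Metric.closedBall y ρ, dist x₁ z ≤ dist x₁ x := fun x hx => by
    rw [← hzd]
    exact Metric.infDist_le_dist_of_mem hx
  have hzx : z ≠ x₁ := fun h => hx₁C (h ▸ hz.1)
  have h1 := hmin y hyK
  have hza : z - (1 / 2 : ℝ) • (x₁ + z) = (1 / 2 : ℝ) • (z - x₁) := by module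
  have hzn : ‖z - (1 / 2 : ℝ) • (x₁ + z)‖ = ‖z - x₁‖ / 2 := by
    rw [hza, norm_smul]
    norm_num
    ring
  refine ⟨z, hz.1, (1 / 2 : ℝ) • (x₁ + z), ?_, ?_, fun x hx hxz => ?_⟩
  · have := dist_triangle z x₁ y
    rw [dist_comm z x₁] at this
    linarith
  · intro h
    have : ‖z - x₁‖ = 0 := by
      have h2 := hzn
      rw [← h, sub_self, norm_zero] at h2
      linarith
    exact hzx (sub_eq_zero.1 (norm_eq_zero.1 this))
  · rw [hzn] at hx
    have h2 := dist_lt_of_mem_tangent_ball rfl hxz hx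
    rw [← dist_eq_norm, ← dist_eq_norm] at h2
    have h3 := dist_triangle x x₁ y
    have h4 : dist x y < ρ := by
      rw [dist_comm z x₁] at h2
      linarith
    refine ⟨fun hxC => ?_, h4⟩
    have h5 := hmin x ⟨hxC, h4.le⟩
    rw [dist_comm x₁ z, dist_comm x₁ x] at h5
    linarith

end InteriorBall

/-! ### Hopf's strong maximum principle -/

section StrongMaximumPrinciple

variable {E : Type*} [NormedAddCommGroup E] [InnerProductSpace ℝ E] [FiniteDimensional ℝ E]
  {ι : Type*} [Fintype ι] [DecidableEq ι] {b : Basis ι ℝ E}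
  {U : Set E} {g : E → E →L[ℝ] E →L[ℝ] ℝ}

open scoped RealInnerProductSpace in
theorem contDiff_sub_norm_sq (a : E) (d : ℝ) : ContDiff ℝ ∞ fun y : E => d - ‖y - a‖ ^ 2 :=
  contDiff_const.sub ((contDiff_id.sub contDiff_const).norm_sq ℝ)

theorem fderiv_sub_norm_sq_ne_zero {a z : E} (d : ℝ) (h : z ≠ a) :
    fderiv ℝ (fun y : E => d - ‖y - a‖ ^ 2) z ≠ 0 := by
  intro h0
  have h1 : fderiv ℝ (fun y : E => d - ‖y - a‖ ^ 2) z = _ :=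
    ((((hasFDerivAt_id z).sub_const a).norm_sq).const_sub d).fderiv
  rw [h1] at h0
  have h2 := DFunLike.congr_fun h0 (z - a)
  have h3 : 0 < ‖z - a‖ := norm_pos_iff.2 (sub_ne_zero.2 h)
  simp only [neg_apply, smul_apply, ContinuousLinearMap.comp_apply, innerSL_apply_apply, id_eq,
    ContinuousLinearMap.id_apply, zero_apply, real_inner_self_eq_norm_sq] at h2
  simp only [nsmul_eq_mul, Nat.cast_ofNat] at h2
  nlinarith [pow_pos h3 2]

/-- The strong maximum principle of Hopf for the Laplacian. -/
theorem eventually_eq_of_laplacian_nonneg [Nonempty ι] (hg : MetricOn U g) {u : E → ℝ} {c : ℝ}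
    {y₀ : E} (hu : ∀ y ∈ U, ContDiffAt ℝ ∞ u y) (hle : ∀ y ∈ U, u y ≤ c)
    (hlap : ∀ y ∈ U, 0 ≤ laplacian b g u y) (hy₀ : y₀ ∈ U) (h0 : u y₀ = c) :
    ∀ᶠ y in 𝓝 y₀, u y = c := by
  by_contra hne
  have := FiniteDimensional.proper ℝ E
  obtain ⟨ρ, hρ, hρU⟩ := Metric.nhds_basis_closedBall.mem_iff.1 (hg.isOpen.mem_nhds hy₀)
  have hcl : IsClosed ({x | u x = c} ∩ Metric.closedBall y₀ ρ) := by
    rw [Set.inter_comm]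
    have hc : ContinuousOn u (Metric.closedBall y₀ ρ) := fun x hx =>
      (hu x (hρU hx)).continuousAt.continuousWithinAt
    exact hc.preimage_isClosed_of_isClosed Metric.isClosed_closedBall
      (isClosed_singleton (x := c))
  obtain ⟨z, hzC, a, hzρ, hza, hball⟩ := exists_tangent_ball
    (C := {x | u x = c}) hρ h0 hcl hne
  have hzC : u z = c := hzC
  have hzU : z ∈ U := hρU hzρ.le
  -- The tangent ball is `{σ ≥ 0}`; on it `u` equals `c` only at the boundary point `z`, where `dσ ≠
  -- 0`.
  set σ : E → ℝ := fun y => ‖z - a‖ ^ 2 - ‖y - a‖ ^ 2 with hσ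
  have hσs : ContDiff ℝ ∞ σ := contDiff_sub_norm_sq a _
  have hσz : σ z = 0 := sub_self _
  have hdσ : fderiv ℝ σ z ≠ 0 := fderiv_sub_norm_sq_ne_zero _ hza
  have hpos := trace_smulRight_pos b (hg.symm z hzU) (hg.pos z hzU) hdσ
  set P := trace (mat b (g z)) (mat b ((fderiv ℝ σ z).smulRight (fderiv ℝ σ z))) with hP
  -- `2αP` is the contribution of `α σ²` to the Laplacian at `z`; the witness makes the total equal
  -- to `1`.
  obtain ⟨α, hα⟩ : ∃ α : ℝ, 0 < laplacian b g σ z + 2 * α * P :=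
    ⟨(1 - laplacian b g σ z) / (2 * P), by field_simp; linarith⟩
  set v : E → ℝ := fun y => σ y + α * σ y ^ 2 with hv
  have hvs : ContDiff ℝ ∞ v := hσs.add (contDiff_const.mul (hσs.pow 2))
  have hvz : v z = 0 := by rw [hv]; simp [hσz]
  have hlv : 0 < laplacian b g v z := by
    rw [laplacian, hv, hess_add_mul_sq hσs hσz, mat_add, mat_smul, trace_add, trace_smul]
    exact hα
  -- Close to `z` the barrier stays strictly subharmonic, and `v = σ (1 + α σ)` has the sign of `σ`.
  have hev : ∀ᶠ y in 𝓝 z, y ∈ U ∧ 0 < laplacian b g v y ∧ -1 < α * σ y := by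
    refine (hg.isOpen.eventually_mem hzU).and (((continuousAt_laplacian hg hzU
      hvs.contDiffAt).eventually_const_lt hlv).and ?_)
    refine (continuous_const.mul hσs.continuous).continuousAt.eventually_const_lt ?_
    change -1 < α * σ z
    rw [hσz]
    norm_num
  obtain ⟨r, hr, hrU⟩ := Metric.nhds_basis_closedBall.eventually_iff.1 hev
  have hK : IsCompact (Metric.sphere z r) := isCompact_sphere z r
  have hsub : ∀ y ∈ Metric.sphere z r, y ∈ Metric.closedBall z r := fun y hy =>
    Metric.sphere_subset_closedBall hy
  have huK : ContinuousOn u (Metric.closedBall z r) := fun x hx =>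
    (hu x (hrU hx).1).continuousAt.continuousWithinAt
  -- On a small sphere around `z`, `v ≥ 0` forces the point into the tangent ball and away from `z`,
  -- where `u < c`. So `u + δ v < c` on the sphere, while its value at the centre is `c`.
  obtain ⟨δ, hδ, hlt⟩ := exists_pos_forall_add_mul_lt (c := c) hK
    (huK.mono Metric.sphere_subset_closedBall) hvs.continuous.continuousOn
    (fun y hy => hle y (hrU (hsub y hy)).1) fun y hy hvy => by
      obtain ⟨hyU, -, hy1⟩ := hrU (hsub y hy)
      have hσy : 0 ≤ σ y := by
        by_contra! h
        have : v y = σ y * (1 + α * σ y) := by rw [hv]; ring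
        nlinarith
      have h1 : ‖y - a‖ ≤ ‖z - a‖ :=
        le_of_sq_le_sq (by simpa [hσ] using hσy) (norm_nonneg _)
      have hyz : y ≠ z := fun h => by
        rw [h, Metric.mem_sphere, dist_self] at hy
        linarith
      exact lt_of_le_of_ne (hle y hyU) (hball y h1 hyz).1
  obtain ⟨m, hm, hmax⟩ := (isCompact_closedBall z r).exists_isMaxOn
    ⟨z, Metric.mem_closedBall_self hr.le⟩
    (huK.add (continuousOn_const.mul hvs.continuous.continuousOn) :
      ContinuousOn (fun y => u y + δ * v y) _)
  have hzm : u z + δ * v z ≤ u m + δ * v m := hmax (Metric.mem_closedBall_self hr.le)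
  rw [hvz, hzC] at hzm
  have hmb : m ∈ Metric.ball z r := by
    rcases (Metric.mem_closedBall.1 hm).lt_or_eq with h | h
    · exact h
    · have := hlt m h
      linarith
  have hmU := (hrU hm).1
  -- The maximum over the closed ball is therefore interior, contradicting the strict subharmonicity
  -- of `u + δ v`.
  have hloc : IsLocalMax (fun y => u y + δ * v y) m :=
    hmax.isLocalMax (Filter.mem_of_superset (Metric.isOpen_ball.mem_nhds hmb)
      Metric.ball_subset_closedBall)
  have h1 := laplacian_nonpos_of_isLocalMax (b := b) hg hmU hloc
    ((hu m hmU).add (contDiffAt_const.mul hvs.contDiffAt))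
  rw [laplacian_add_const_mul (hu m hmU) hvs.contDiffAt] at h1
  have h2 := hlap m hmU
  have h3 := mul_pos hδ (hrU hm).2.1
  linarith

end StrongMaximumPrinciple

/-! ### Exclusion of marginally outer trapped surfaces -/

section LaplacianInvariance

variable {E : Type*} [NormedAddCommGroup E] [NormedSpace ℝ E] [FiniteDimensional ℝ E]
  {ι : Type*} [Fintype ι] [DecidableEq ι] {b : Basis ι ℝ E}
  {U V : Set E} {g g' : E → E →L[ℝ] E →L[ℝ] ℝ} {φ : E → E} {y : E} {u v : E → ℝ}

theorem laplacian_congr (h : u =ᶠ[𝓝 y] v) : laplacian b g u y = laplacian b g v y := by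
  have h1 : hess b (fun z => mat b (g z)) u y = hess b (fun z => mat b (g z)) v y := by
    rw [hess, hess, (h.fderiv (𝕜 := ℝ)).fderiv_eq (𝕜 := ℝ), h.fderiv_eq (𝕜 := ℝ)]
  rw [laplacian, laplacian, h1]

theorem IsTransition.laplacian_eq (ht : IsTransition U V φ g g') (hg : MetricOn U g)
    (hg' : MetricOn V g') (hy : y ∈ U) (hu : ContDiffAt ℝ ∞ u (φ y)) :
    laplacian b g (fun z => u (φ z)) y = laplacian b g' u (φ y) :=
  ht.trace_eq hg' hy (ht.hess_eq hg hg' hy hu)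

end LaplacianInvariance

/-! ### The height function and the exclusion argument -/

section Exclusion

variable {S : Type*} [TopologicalSpace S] [ChartedSpace Plane S] [IsManifold (𝓡 2) ∞ S]
  (γ : Bundle.ContMDiffRiemannianMetric (𝓡 2) ∞ Plane (fun x : S => TangentSpace (𝓡 2) x))
  {L : ℝ} {r h p q : ℝ → ℝ} (hL : 0 < L) (hr : ContDiff ℝ ∞ r) (hr0 : ∀ t, 0 < r t)
  (hp : ContDiff ℝ ∞ p) (hq : ContDiff ℝ ∞ q)
  {N : Type*} [TopologicalSpace N] [ChartedSpace Plane N] [IsManifold (𝓡 2) ∞ N]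
  {F : N → S × ℝ} {ν : ∀ s : N, TangentSpace cylModel (F s)}

/-- The formula for the Laplacian of the height holds at the base point of each chart; this carries
it to all points of the fixed chart at `s₀`, where the strong maximum principle is applied. -/
theorem laplacian_heightIn_eq (g : Bundle.ContMDiffRiemannianMetric cylModel ∞ (Plane × ℝ)
      (fun x : S × ℝ => TangentSpace cylModel x)) (hF : ContMDiff (𝓡 2) cylModel ∞ F)
    (hi : ∀ s, Function.Injective (mfderiv (𝓡 2) cylModel F s)) {s s₀ : N}
    (hs : s ∈ (chartAt Plane s₀).source) :
    laplacian planeBasis (chartForm (pullback (𝓡 2) g.inner F) s) (heightIn F s)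
        (extChartAt (𝓡 2) s s) =
      laplacian planeBasis (chartForm (pullback (𝓡 2) g.inner F) s₀) (heightIn F s₀)
        (extChartAt (𝓡 2) s₀ s) := by
  have hmem := mem_transitionSource (I := 𝓡 2) hs
  have hs0 : extChartAt (𝓡 2) s₀ s ∈ (extChartAt (𝓡 2) s₀).target :=
    (extChartAt (𝓡 2) s₀).map_source (by rwa [extChartAt_source])
  have h1 : heightIn F s =ᶠ[𝓝 (extChartAt (𝓡 2) s s)]
      fun z => heightIn F s₀ (transition (𝓡 2) s s₀ z) := by
    filter_upwards [(isOpen_transitionSource s s₀).mem_nhds hmem] with z hz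
    rw [heightIn, heightIn, transition, (extChartAt (𝓡 2) s₀).left_inv hz.2]
  have hu : ContDiffAt ℝ ∞ (heightIn F s₀) (transition (𝓡 2) s s₀ (extChartAt (𝓡 2) s s)) := by
    rw [transition_self]
    exact contDiffAt_heightIn hF s₀ hs0
  rw [laplacian_congr h1, (isTransition_transition (pullback (𝓡 2) g.inner F) s s₀).laplacian_eq
    ((metricOn_pullback g hF hi s).mono (isOpen_transitionSource s s₀) Set.inter_subset_left)
    (metricOn_pullback g hF hi s₀) hmem hu, transition_self]

/-- At a local maximum of the height, the slice must not be untrapped. -/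
theorem le_abs_of_isLocalMax (hrh : ∀ t, deriv r t = L / 2 * h t * r t)
    (hM : (profileData γ hL hr hr0 hp hq).IsMOTS (𝓡 2) cylBasis planeBasis F ν) {s : N}
    (hs : IsLocalMax (fun s => (F s).2) s) : h (F s).2 ≤ |p (F s).2| := by
  obtain ⟨n, w, hw, -, h1, hlap⟩ := laplacian_height γ hL hr hr0 hp hq hrh hM s
  have hmax : IsLocalMax (heightIn F s) (extChartAt (𝓡 2) s s) := by
    have hs' : IsLocalMax (fun s => (F s).2)
        ((extChartAt (𝓡 2) s).symm (extChartAt (𝓡 2) s s)) := by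
      rwa [extChartAt_to_inv]
    exact hs'.comp_continuous (continuousAt_extChartAt_symm s)
  have h2 := laplacian_nonpos_of_isLocalMax (b := planeBasis)
    (metricOn_pullback (profileData γ hL hr hr0 hp hq).g hM.smooth hM.immersion s) (mem_extChartAt_target s) hmax
    (contDiffAt_heightIn hM.smooth s (mem_extChartAt_target s))
  rw [hlap, h1 hmax.fderiv_eq_zero] at h2
  have h3 : |L * n| = 1 := by
    have : (L * n) ^ 2 = 1 := by rw [← hw, h1 hmax.fderiv_eq_zero]
    simpa using (sq_eq_sq_iff_abs_eq_abs (L * n) 1).1 (by rw [this, one_pow])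
  -- With `w = 1` the profile `q` drops out, and `L n = ±1` leaves `h ± p ≤ 0`.
  have h4 : h (F s).2 + L * n * p (F s).2 ≤ 0 := by
    have h5 : L * (h (F s).2 / (2 * L) * (1 + 1) +
        n * (q (F s).2 * (1 - 1) + p (F s).2 * (1 + 1) / 2)) =
        h (F s).2 + L * n * p (F s).2 := by
      field_simp
      ring
    rw [← h5]
    exact mul_nonpos_of_nonneg_of_nonpos hL.le h2
  have h6 : |L * n * p (F s).2| = |p (F s).2| := by rw [abs_mul, h3, one_mul]
  rw [← h6]
  have := neg_abs_le (L * n * p (F s).2)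
  linarith

/-- Where `p = q = 0` the Laplacian of the height is `h (1 + w) / (2L) ≥ 0`, so the strong maximum
principle applies near a point at the top height. -/
theorem eventually_height_eq_one (hrh : ∀ t, deriv r t = L / 2 * h t * r t)
    (hM : (profileData γ hL hr hr0 hp hq).IsMOTS (𝓡 2) cylBasis planeBasis F ν)
    (hle : ∀ s, (F s).2 ≤ 1)
    (h0 : ∀ t, 1 / 2 < t → t ≤ 1 → 0 ≤ h t ∧ p t = 0 ∧ q t = 0) {s₀ : N} (hs₀ : (F s₀).2 = 1) :
    ∀ᶠ s in 𝓝 s₀, (F s).2 = 1 := by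
  set g := (profileData γ hL hr hr0 hp hq).g with hg
  have hF := hM.smooth
  have hi := hM.immersion
  have hcont : ContinuousOn (heightIn F s₀) (extChartAt (𝓡 2) s₀).target := fun z hz =>
    (contDiffAt_heightIn hF s₀ hz).continuousAt.continuousWithinAt
  have hU : IsOpen ((extChartAt (𝓡 2) s₀).target ∩ heightIn F s₀ ⁻¹' Set.Ioi (1 / 2)) :=
    hcont.isOpen_inter_preimage (isOpen_extChartAt_target s₀) isOpen_Ioi
  have hlap : ∀ z ∈ (extChartAt (𝓡 2) s₀).target ∩ heightIn F s₀ ⁻¹' Set.Ioi (1 / 2),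
      0 ≤ laplacian planeBasis (chartForm (pullback (𝓡 2) g.inner F) s₀) (heightIn F s₀) z := by
    rintro z ⟨hz, hz1⟩
    obtain ⟨s, hs⟩ : ∃ s, s = (extChartAt (𝓡 2) s₀).symm z := ⟨_, rfl⟩
    have hsz : extChartAt (𝓡 2) s₀ s = z := by rw [hs, (extChartAt (𝓡 2) s₀).right_inv hz]
    have hs1 : s ∈ (chartAt Plane s₀).source := by
      rw [← extChartAt_source (𝓡 2), hs]
      exact (extChartAt (𝓡 2) s₀).map_target hz
    rw [← hsz, ← laplacian_heightIn_eq g hF hi hs1]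
    obtain ⟨n, w, hw, -, -, hl⟩ := laplacian_height γ hL hr hr0 hp hq hrh hM s
    have hz1' : 1 / 2 < (F s).2 := by rw [hs]; exact hz1
    obtain ⟨a1, a2, a3⟩ := h0 _ hz1' (hle s)
    rw [hg, hl, a2, a3]
    have hw0 : 0 ≤ w := hw ▸ sq_nonneg _
    have : 0 ≤ h (F s).2 / (2 * L) * (1 + w) := by positivity
    linarith
  have hz₀ : heightIn F s₀ (extChartAt (𝓡 2) s₀ s₀) = 1 := by
    rw [heightIn, extChartAt_to_inv, hs₀]
  have hev := eventually_eq_of_laplacian_nonneg (b := planeBasis)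
    ((metricOn_pullback g hF hi s₀).mono hU Set.inter_subset_left)
    (fun z hz => contDiffAt_heightIn hF s₀ hz.1) (fun z _ => hle _) hlap
    (y₀ := extChartAt (𝓡 2) s₀ s₀) ⟨mem_extChartAt_target s₀, by
      rw [Set.mem_preimage, hz₀, Set.mem_Ioi]; norm_num⟩ hz₀
  filter_upwards [(continuousAt_extChartAt s₀).eventually hev,
    extChartAt_source_mem_nhds (I := 𝓡 2) s₀] with s hs hs'
  rwa [heightIn, (extChartAt (𝓡 2) s₀).left_inv hs'] at hs

/-- The witness is a highest point of the compact surface, wherever it lies in `S × ℝ`. -/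
theorem exists_height_le_abs [CompactSpace N] [Nonempty N]
    (hrh : ∀ t, deriv r t = L / 2 * h t * r t)
    (hM : (profileData γ hL hr hr0 hp hq).IsMOTS (𝓡 2) cylBasis planeBasis F ν) :
    ∃ s, h (F s).2 ≤ |p (F s).2| := by
  obtain ⟨s, -, hs⟩ := isCompact_univ.exists_isMaxOn Set.univ_nonempty
    (continuous_snd.comp hM.smooth.continuous).continuousOn
  exact ⟨s, le_abs_of_isLocalMax γ hL hr hr0 hp hq hrh hM
    (Filter.Eventually.of_forall fun x => hs (Set.mem_univ x))⟩

/-- The points at height `1` form an open and closed set. On its complement, also compact, a highest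
point is a local maximum on all of `N`; at a height strictly between `0` and `1` this would
contradict `|p| < h`. -/
theorem height_eq_zero_or_one [CompactSpace N] (hrh : ∀ t, deriv r t = L / 2 * h t * r t)
    (hM : (profileData γ hL hr hr0 hp hq).IsMOTS (𝓡 2) cylBasis planeBasis F ν)
    (hF : ∀ s, F s ∈ cylinder S) (hlt : ∀ t, 0 < t → t < 1 → |p t| < h t)
    (h0 : ∀ t, 1 / 2 < t → t ≤ 1 → 0 ≤ h t ∧ p t = 0 ∧ q t = 0) (s : N) :
    (F s).2 = 0 ∨ (F s).2 = 1 := by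
  have hc : Continuous fun s => (F s).2 := continuous_snd.comp hM.smooth.continuous
  by_contra! hs
  have hZ : IsClosed {s | (F s).2 = 1}ᶜ := by
    rw [isClosed_compl_iff, isOpen_iff_mem_nhds]
    exact fun s₀ hs₀ =>
      eventually_height_eq_one γ hL hr hr0 hp hq hrh hM (fun s => (hF s).2) h0 hs₀
  have hZ' : IsOpen {s | (F s).2 = 1}ᶜ := (isClosed_singleton.preimage hc).isOpen_compl
  obtain ⟨m, hm, hmax⟩ := hZ.isCompact.exists_isMaxOn ⟨s, hs.2⟩ hc.continuousOn
  have h1 := le_abs_of_isLocalMax γ hL hr hr0 hp hq hrh hM (hmax.isLocalMax (hZ'.mem_nhds hm))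
  have h2 : 0 < (F m).2 := ((hF s).1.lt_of_ne' hs.1).trans_le (hmax hs.2)
  have h3 : (F m).2 < 1 := (hF m).2.lt_of_ne hm
  exact (hlt _ h2 h3).not_ge h1

end Exclusion

/-! ### The profiles -/

section Profiles

theorem contDiff_integral {f : ℝ → ℝ} (hf : ContDiff ℝ ∞ f) :
    ContDiff ℝ ∞ fun t => ∫ x in (0 : ℝ)..t, f x := by
  have h (t : ℝ) : HasDerivAt (fun t => ∫ x in (0 : ℝ)..t, f x) (f t) t :=
    intervalIntegral.integral_hasDerivAt_right (hf.continuous.intervalIntegrable _ _)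
      hf.continuous.aestronglyMeasurable.stronglyMeasurableAtFilter hf.continuous.continuousAt
  refine contDiff_infty_iff_deriv.2 ⟨fun t => (h t).differentiableAt, ?_⟩
  rwa [funext fun t => (h t).deriv]

/-- The radius function of a foliation with mean curvature `h`. -/
theorem exists_radius {h : ℝ → ℝ} {ε : ℝ} (hε : 0 < ε) (hh : ContDiff ℝ ∞ h)
    (h0 : ∀ t, 0 ≤ t → t ≤ 1 → 0 ≤ h t) (hI : 0 < ∫ x in (0 : ℝ)..1, h x) :
    ∃ r : ℝ → ℝ, ContDiff ℝ ∞ r ∧ (∀ t, 0 < r t) ∧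
      (∀ t, deriv r t = 2 * Real.log (1 + ε) / (∫ x in (0 : ℝ)..1, h x) / 2 * h t * r t) ∧
      r 0 = 1 ∧ r 1 = 1 + ε ∧ ∀ t, 0 ≤ t → t ≤ 1 → r t ≤ 1 + ε := by
  -- The equation `r' = ½ L h r` with `r(0) = 1` gives `r = exp(½ L ∫ h)`; this `L` is the one for
  -- which `r(1) = 1 + ε`.
  set L := 2 * Real.log (1 + ε) / ∫ x in (0 : ℝ)..1, h x with hL
  have hlog : 0 < Real.log (1 + ε) := Real.log_pos (by linarith)
  have hL0 : 0 < L := by positivity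
  have hd (t : ℝ) : HasDerivAt (fun t => ∫ x in (0 : ℝ)..t, h x) (h t) t :=
    intervalIntegral.integral_hasDerivAt_right (hh.continuous.intervalIntegrable _ _)
      hh.continuous.aestronglyMeasurable.stronglyMeasurableAtFilter hh.continuous.continuousAt
  have hr (t : ℝ) : deriv (fun t => Real.exp (L / 2 * ∫ x in (0 : ℝ)..t, h x)) t =
      L / 2 * h t * Real.exp (L / 2 * ∫ x in (0 : ℝ)..t, h x) := by
    rw [((hd t).const_mul (L / 2)).exp.deriv]
    ring
  have hs : ContDiff ℝ ∞ fun t => Real.exp (L / 2 * ∫ x in (0 : ℝ)..t, h x) :=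
    (contDiff_const.mul (contDiff_integral hh)).exp
  have h1 : Real.exp (L / 2 * ∫ x in (0 : ℝ)..1, h x) = 1 + ε := by
    rw [hL, show 2 * Real.log (1 + ε) / (∫ x in (0 : ℝ)..1, h x) / 2 * ∫ x in (0 : ℝ)..1, h x =
      Real.log (1 + ε) by field_simp, Real.exp_log (by linarith)]
  refine ⟨_, hs, fun t => Real.exp_pos _, hr, by simp, h1, fun t ht ht' => ?_⟩
  rw [← h1]
  refine monotoneOn_of_deriv_nonneg (convex_Icc 0 1) hs.continuous.continuousOn
    (hs.differentiable (by simp)).differentiableOn (fun x hx => ?_) ⟨ht, ht'⟩ ⟨zero_le_one, le_rfl⟩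
    ht'
  rw [interior_Icc] at hx
  rw [hr]
  have := h0 x hx.1.le hx.2.le
  positivity

theorem hasDerivAt_mul_one_sub (t : ℝ) : HasDerivAt (fun t : ℝ => t * (1 - t)) (1 - 2 * t) t := by
  have h : HasDerivAt (fun t : ℝ => t * (1 - t)) _ t :=
    (hasDerivAt_id t).mul ((hasDerivAt_id t).const_sub 1)
  convert h using 1
  simp
  ring

/-- A smooth function that decreases from `1` to `0` and vanishes for `t ≥ 1 / 2`. -/
def cutoff (t : ℝ) : ℝ := Real.smoothTransition (1 - 2 * t)

theorem contDiff_cutoff : ContDiff ℝ ∞ cutoff :=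
  Real.smoothTransition.contDiff.comp (contDiff_const.sub (contDiff_const.mul contDiff_id))

theorem cutoff_nonneg (t : ℝ) : 0 ≤ cutoff t := Real.smoothTransition.nonneg _

theorem cutoff_le_one (t : ℝ) : cutoff t ≤ 1 := Real.smoothTransition.le_one _

theorem cutoff_zero : cutoff 0 = 1 := by simp [cutoff]

theorem cutoff_of_le {t : ℝ} (h : 1 / 2 ≤ t) : cutoff t = 0 :=
  Real.smoothTransition.zero_of_nonpos (by linarith)

theorem deriv_cutoff_nonpos (t : ℝ) : deriv cutoff t ≤ 0 := by
  have h : Antitone cutoff := fun a b hab => Real.smoothTransition.monotone (by linarith)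
  exact h.deriv_nonpos

end Profiles

/-! ### The collars -/

section Collars

variable {S : Type u} [TopologicalSpace S] [ChartedSpace Plane S] [IsManifold (𝓡 2) ∞ S]
  (γ : Bundle.ContMDiffRiemannianMetric (𝓡 2) ∞ Plane (fun x : S => TangentSpace (𝓡 2) x))
  {A m P ε c : ℝ}

theorem le_div_sq_of_mul_sq_le {a R x y : ℝ} (ha : 0 ≤ a) (hx : 0 < x) (hxy : x ≤ y)
    (h : a * y ^ 2 ≤ R) : a ≤ R / x ^ 2 := by
  rw [le_div_iff₀ (by positivity)]
  refine le_trans ?_ h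
  gcongr

theorem modelForm_smul (c : ℝ) (T : Tensor₂ (𝓡 2) S) (s : S) (v w : Plane) :
    modelForm (fun p => c • T p) s v w = c * modelForm T s v w := rfl

/-- The collar whose slices have positive Hawking energy. -/
theorem exists_collar_of_pos (hm : 0 < m) (hε : 0 < ε)
    (hR : ∀ s : S, (3 / 2) * (1 + ε) ^ 2 * m ^ 2 ≤ scalarCurvature planeBasis γ.inner s) :
    ∃ D : InitialData cylModel (S × ℝ), D.DEC cylBasis (cylinder S) ∧
      SliceData D 0 γ.inner (fun _ => √(m ^ 2 + P ^ 2)) (fun _ => P) (fun _ => 0) ∧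
      SliceData D 1 (fun p => (1 + ε) ^ 2 • γ.inner p) (fun _ => m) (fun _ => 0) (fun _ => 0) ∧
      ∀ (N : Type u) [TopologicalSpace N] [CompactSpace N] [Nonempty N]
        [ChartedSpace Plane N] [IsManifold (𝓡 2) ∞ N] (F : N → S × ℝ)
        (ν : ∀ s : N, TangentSpace cylModel (F s)),
        ¬ D.IsMOTS (𝓡 2) cylBasis planeBasis F ν := by
  -- `p` decreases linearly to `0` while `h² - p² = m²` is kept constant.
  set p : ℝ → ℝ := fun t => P * (1 - t) with hp
  set h : ℝ → ℝ := fun t => √(m ^ 2 + p t ^ 2) with hh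
  have hps : ContDiff ℝ ∞ p := contDiff_const.mul (contDiff_const.sub contDiff_id)
  have hpos (t : ℝ) : 0 < m ^ 2 + p t ^ 2 := by positivity
  have hhs : ContDiff ℝ ∞ h := (contDiff_const.add (hps.pow 2)).sqrt fun t => (hpos t).ne'
  have hh0 (t : ℝ) : 0 < h t := Real.sqrt_pos.2 (hpos t)
  have hsq (t : ℝ) : h t ^ 2 = m ^ 2 + p t ^ 2 := Real.sq_sqrt (hpos t).le
  have hdp (t : ℝ) : HasDerivAt p (-P) t := by
    have := ((hasDerivAt_id t).const_sub 1).const_mul P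
    simpa using this
  have hdh (t : ℝ) : deriv h t = -(P * p t) / h t := by
    have h1 : HasDerivAt h _ t := (((hdp t).pow 2).const_add (m ^ 2)).sqrt (hpos t).ne'
    rw [h1.deriv]
    change _ / (2 * h t) = _
    have := (hh0 t).ne'
    simp only [Nat.cast_ofNat, Nat.add_one_sub_one, pow_one]
    field_simp
  have hI : 0 < ∫ x in (0 : ℝ)..1, h x :=
    intervalIntegral.intervalIntegral_pos_of_pos (hhs.continuous.intervalIntegrable _ _) hh0
      zero_lt_one
  obtain ⟨r, hr, hr0, hrh, hr_zero, hr_one, hr_le⟩ :=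
    exists_radius hε hhs (fun t _ _ => (hh0 t).le) hI
  have hL : 0 < 2 * Real.log (1 + ε) / ∫ x in (0 : ℝ)..1, h x :=
    div_pos (mul_pos two_pos (Real.log_pos (by linarith))) hI
  set L := 2 * Real.log (1 + ε) / ∫ x in (0 : ℝ)..1, h x
  -- The function `p/2 - P/(L h)` is the value of `q` solving `J = 0`, since `p' = -P`.
  have hqs : ContDiff ℝ ∞ fun t => p t / 2 - P / (L * h t) :=
    (hps.div_const 2).sub (contDiff_const.div (contDiff_const.mul hhs) fun t =>
      (mul_pos hL (hh0 t)).ne')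
  have hrh : ∀ t, deriv r t = L / 2 * h t * r t := hrh
  refine ⟨profileData γ hL hr hr0 hps hqs, ?_, ?_, ?_, ?_⟩
  · refine profileData_DEC γ hL hr hr0 hps hqs (hhs.differentiable (by simp)) hrh
      fun s t ht ht' => ?_
    have h1 := (hh0 t).ne'
    have e1 : h t * (p t / 2 - P / (L * h t)) - h t * p t / 2 - deriv p t / L = 0 := by
      rw [(hdp t).deriv]
      field_simp
      ring
    -- `h h' = p p'` makes the part of `2qp` containing `1/(L h)` cancel `-2h'/L`; the rest is
    -- `-(3/2)(h² - p²) = -(3/2) m²`.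
    have e2 : scalarCurvature planeBasis γ.inner s / r t ^ 2 - 2 * deriv h t / L -
        3 / 2 * h t ^ 2 + 2 * (p t / 2 - P / (L * h t)) * p t + p t ^ 2 / 2 =
        scalarCurvature planeBasis γ.inner s / r t ^ 2 - 3 / 2 * m ^ 2 := by
      rw [hdh, hsq]
      field_simp
      ring
    rw [e1, e2, abs_zero]
    have := le_div_sq_of_mul_sq_le (a := 3 / 2 * m ^ 2) (by positivity) (hr0 t) (hr_le t ht ht')
      (le_trans (le_of_eq (by ring)) (hR s))
    linarith
  · have := sliceData_profileData γ hL hr hr0 hps hqs hrh 0 γ.inner fun s v w => by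
      rw [hr_zero]; ring
    simpa [hh, hp] using this
  · have := sliceData_profileData γ hL hr hr0 hps hqs hrh 1 (fun p => (1 + ε) ^ 2 • γ.inner p)
      fun s v w => by rw [hr_one, modelForm_smul]
    simpa [hh, hp, Real.sqrt_sq hm.le] using this
  · intro N _ _ _ _ _ F ν hM
    obtain ⟨s, hs⟩ := exists_height_le_abs γ hL hr hr0 hps hqs hrh hM
    refine hs.not_gt ?_
    rw [← Real.sqrt_sq_eq_abs]
    exact Real.sqrt_lt_sqrt (sq_nonneg _) (by nlinarith)

theorem deriv_cutoff_add (A η t : ℝ) :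
    deriv (fun t => A * cutoff t + η * (t * (1 - t))) t =
      A * deriv cutoff t + η * (1 - 2 * t) :=
  ((((contDiff_cutoff.differentiable (by simp)) t).hasDerivAt.const_mul A).add
    ((hasDerivAt_mul_one_sub t).const_mul η)).deriv

/-- Since the squares of `A χ` cancel, every remaining term carries a factor `η`. The bounds `χ ≤
1`, `0 ≤ t(1 - t) ≤ 1/4` and `η² ≤ η` bring the total below `η (2/L + A + 1)`. -/
theorem cutoff_profile_le {η R x y L t : ℝ} (hA : 0 ≤ A) (hη : 0 < η)
    (hη1 : η ≤ 1) (hx : 0 < x) (hxy : x ≤ y) (hL : 0 < L)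
    (hR : η * (2 / L + A + 1) * y ^ 2 ≤ R) (ht : 0 ≤ t) (ht' : t ≤ 1) :
    2 * (η * (1 - 2 * t)) / L + 3 / 2 * (A * cutoff t + η * (t * (1 - t))) ^ 2 -
      3 / 2 * (A * cutoff t) ^ 2 ≤ R / x ^ 2 := by
  have h1 := le_div_sq_of_mul_sq_le (a := η * (2 / L + A + 1)) (by positivity) hx hxy hR
  refine le_trans ?_ h1
  have hc := cutoff_nonneg t
  have hc' := cutoff_le_one t
  have hψ : 0 ≤ t * (1 - t) := mul_nonneg ht (by linarith)
  have hψ' : t * (1 - t) ≤ 1 / 4 := by nlinarith [sq_nonneg (t - 1 / 2)]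
  have a1 : 2 * (η * (1 - 2 * t)) / L ≤ η * (2 / L) := by
    rw [mul_div_assoc', mul_comm η 2]
    gcongr
    nlinarith
  have a2 : cutoff t * (t * (1 - t)) ≤ 1 / 4 := by nlinarith
  have a3 : A * η * (cutoff t * (t * (1 - t))) ≤ A * η * (1 / 4) := by gcongr
  have a4 : (t * (1 - t)) ^ 2 ≤ 1 / 16 := by nlinarith
  have a5 : η ^ 2 * (t * (1 - t)) ^ 2 ≤ η * (1 / 16) := by
    have : η ^ 2 ≤ η := by nlinarith
    gcongr
  nlinarith [mul_nonneg hA hη.le]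

/-- The collar of marginally trapped data, where the mean curvature is `|P|`. -/
theorem exists_collar_of_abs (hP : 0 < |P|) (hε : 0 < ε) (hc : 0 < c)
    (hR : ∀ s : S, c ≤ scalarCurvature planeBasis γ.inner s) :
    ∃ D : InitialData cylModel (S × ℝ), D.DEC cylBasis (cylinder S) ∧
      SliceData D 0 γ.inner (fun _ => |P|) (fun _ => P) (fun _ => 0) ∧
      SliceData D 1 (fun p => (1 + ε) ^ 2 • γ.inner p) (fun _ => 0) (fun _ => 0) (fun _ => 0) ∧
      ∀ (N : Type u) [TopologicalSpace N] [CompactSpace N]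
        [ChartedSpace Plane N] [IsManifold (𝓡 2) ∞ N] (F : N → S × ℝ)
        (ν : ∀ s : N, TangentSpace cylModel (F s)),
        D.IsMOTS (𝓡 2) cylBasis planeBasis F ν → (∀ s, F s ∈ cylinder S) →
        ∀ s, (F s).2 = 0 ∨ (F s).2 = 1 := by
  have hlog : 0 < Real.log (1 + ε) := Real.log_pos (by linarith)
  -- `η` must precede `h`, hence `L`. The quotient `(|P| + 1) / log(1 + ε)` stands for `2/L`, which
  -- it bounds because `∫ h ≤ |P| + 1` as soon as `η ≤ 1`.
  obtain ⟨η, hη, hη1, hηc⟩ : ∃ η : ℝ, 0 < η ∧ η ≤ 1 ∧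
      η * ((|P| + 1) / Real.log (1 + ε) + |P| + 1) * (1 + ε) ^ 2 ≤ c := by
    set B := ((|P| + 1) / Real.log (1 + ε) + |P| + 1) * (1 + ε) ^ 2 with hB
    have hB0 : 0 < B := by positivity
    refine ⟨min 1 (c / B), lt_min one_pos (by positivity), min_le_left _ _, ?_⟩
    rw [mul_assoc, ← hB]
    calc min 1 (c / B) * B ≤ c / B * B := by gcongr; exact min_le_right _ _
      _ = c := by field_simp
  set p : ℝ → ℝ := fun t => P * cutoff t with hp
  -- With `h = |p|` every slice would be marginally trapped; the bump `η t(1 - t)` makes the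
  -- interior slices untrapped without changing the two boundary values.
  set h : ℝ → ℝ := fun t => |P| * cutoff t + η * (t * (1 - t)) with hh
  have hps : ContDiff ℝ ∞ p := contDiff_const.mul contDiff_cutoff
  have hhs : ContDiff ℝ ∞ h := (contDiff_const.mul contDiff_cutoff).add
    (contDiff_const.mul (contDiff_id.mul (contDiff_const.sub contDiff_id)))
  have hpa (t : ℝ) : |p t| = |P| * cutoff t := by
    rw [hp, abs_mul, abs_of_nonneg (cutoff_nonneg t)]
  have hψ (t : ℝ) (ht : 0 ≤ t) (ht' : t ≤ 1) : 0 ≤ t * (1 - t) := mul_nonneg ht (by linarith)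
  have hlt (t : ℝ) (ht : 0 < t) (ht' : t < 1) : |p t| < h t := by
    rw [hpa, hh]
    have : 0 < η * (t * (1 - t)) := mul_pos hη (mul_pos ht (by linarith))
    linarith
  have hh0 (t : ℝ) (ht : 0 ≤ t) (ht' : t ≤ 1) : 0 ≤ h t :=
    add_nonneg (mul_nonneg hP.le (cutoff_nonneg t)) (mul_nonneg hη.le (hψ t ht ht'))
  have hI : 0 < ∫ x in (0 : ℝ)..1, h x :=
    intervalIntegral.intervalIntegral_pos_of_pos_on (hhs.continuous.intervalIntegrable _ _)
      (fun t ht => (abs_nonneg _).trans_lt (hlt t ht.1 ht.2)) zero_lt_one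
  have hI' : ∫ x in (0 : ℝ)..1, h x ≤ |P| + 1 := by
    have := intervalIntegral.integral_mono_on (μ := MeasureTheory.volume) (g := fun _ => |P| + 1) zero_le_one
      (hhs.continuous.intervalIntegrable _ _) (continuous_const.intervalIntegrable _ _)
      fun t ht => by
        have h1 := mul_le_mul_of_nonneg_left (cutoff_le_one t) hP.le
        have h2 : t * (1 - t) ≤ 1 := by nlinarith [sq_nonneg (t - 1 / 2)]
        have h3 := mul_le_mul hη1 h2 (hψ t ht.1 ht.2) zero_le_one
        change |P| * cutoff t + η * (t * (1 - t)) ≤ |P| + 1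
        linarith
    simpa using this
  obtain ⟨r, hr, hr0, hrh, hr_zero, hr_one, hr_le⟩ := exists_radius hε hhs hh0 hI
  have hL : 0 < 2 * Real.log (1 + ε) / ∫ x in (0 : ℝ)..1, h x :=
    div_pos (mul_pos two_pos hlog) hI
  have hL' : 2 / (2 * Real.log (1 + ε) / ∫ x in (0 : ℝ)..1, h x) ≤
      (|P| + 1) / Real.log (1 + ε) := by
    rw [div_div_eq_mul_div, mul_div_mul_left _ _ two_ne_zero]
    gcongr
  set L := 2 * Real.log (1 + ε) / ∫ x in (0 : ℝ)..1, h x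
  have hqs : ContDiff ℝ ∞ fun t => p t / 2 := hps.div_const 2
  have hrh : ∀ t, deriv r t = L / 2 * h t * r t := hrh
  refine ⟨profileData γ hL hr hr0 hps hqs, ?_, ?_, ?_, ?_⟩
  · refine profileData_DEC γ hL hr hr0 hps hqs (hhs.differentiable (by simp)) hrh
      fun s t ht ht' => ?_
    have e1 : h t * (p t / 2) - h t * p t / 2 - deriv p t / L = -(P * deriv cutoff t / L) := by
      rw [hp, deriv_const_mul _ ((contDiff_cutoff.differentiable (by simp)) t)]
      ring
    -- Since the cutoff decreases, `|J|` is exactly half of the contribution of `|P| χ` to `-2h'/L`,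
    -- and both drop out of the inequality.
    have e2 : |-(P * deriv cutoff t / L)| = -(|P| * deriv cutoff t / L) := by
      rw [abs_neg, abs_div, abs_mul, abs_of_nonpos (deriv_cutoff_nonpos t), abs_of_pos hL]
      ring
    have e3 : deriv h t = |P| * deriv cutoff t + η * (1 - 2 * t) := deriv_cutoff_add _ _ _
    have e4 : p t ^ 2 = (|P| * cutoff t) ^ 2 := by rw [← hpa, sq_abs]
    have h1 := cutoff_profile_le (A := |P|) (η := η) (R := scalarCurvature planeBasis γ.inner s)
      hP.le hη hη1 (hr0 t) (hr_le t ht ht') hL ((by gcongr : _ ≤ _).trans (hηc.trans (hR s))) ht ht'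
    have e5 : 2 * (|P| * deriv cutoff t + η * (1 - 2 * t)) / L =
        2 * (|P| * deriv cutoff t / L) + 2 * (η * (1 - 2 * t)) / L := by ring
    have e6 : 2 * (p t / 2) * p t = p t ^ 2 := by ring
    rw [e1, e2, e3, e5, e6, e4]
    change _ ≤ 1 / 2 * (_ - _ - 3 / 2 * (|P| * cutoff t + η * (t * (1 - t))) ^ 2 + _ + _)
    linarith
  · have := sliceData_profileData γ hL hr hr0 hps hqs hrh 0 γ.inner fun s v w => by
      rw [hr_zero]; ring
    simpa [hh, hp, cutoff_zero] using this
  · have := sliceData_profileData γ hL hr hr0 hps hqs hrh 1 (fun p => (1 + ε) ^ 2 • γ.inner p)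
      fun s v w => by rw [hr_one, modelForm_smul]
    simpa [hh, hp, cutoff_of_le (show (1 / 2 : ℝ) ≤ 1 by norm_num)] using this
  · intro N _ _ _ _ F ν hM hF s
    refine height_eq_zero_or_one γ hL hr hr0 hps hqs hrh hM hF hlt (fun t ht ht' => ?_) s
    have : p t = 0 := by rw [hp]; simp only; rw [cutoff_of_le ht.le, mul_zero]
    exact ⟨hh0 t (by linarith) ht', this, by rw [this, zero_div]⟩

end Collars

end BartnikCollar

end

/-! ### Assembly of the two cases -/

theorem mainTheorem5 {S : Type u} [TopologicalSpace S]
    [ChartedSpace (EuclideanSpace ℝ (Fin 2)) S] [IsManifold (𝓡 2) ∞ S]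
    (hS : Nonempty (S ≃ₘ⟮𝓡 2, 𝓡 2⟯ Metric.sphere (0 : EuclideanSpace ℝ (Fin 3)) 1))
    (γ : Bundle.ContMDiffRiemannianMetric (𝓡 2) ∞ (EuclideanSpace ℝ (Fin 2))
      (fun x : S => TangentSpace (𝓡 2) x))
    (Ho Po : ℝ) (hP : 0 < |Po|) (hH : |Po| ≤ Ho)
    (hR : ∀ p : S, (3 / 2) * √(Ho ^ 2 - Po ^ 2) ^ 2 <
      BartnikCollar.scalarCurvature BartnikCollar.planeBasis γ.inner p) :
    ∃ ε₀ > 0, ∀ ε : ℝ, 0 < ε →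
      (ε < ε₀ ∨ ∀ p : S, (3 / 2) * (1 + ε) ^ 2 * √(Ho ^ 2 - Po ^ 2) ^ 2 ≤
        BartnikCollar.scalarCurvature BartnikCollar.planeBasis γ.inner p) →
      ∃ D : BartnikCollar.InitialData BartnikCollar.cylModel (S × ℝ),
        D.DEC BartnikCollar.cylBasis (BartnikCollar.cylinder S) ∧
        BartnikCollar.SliceData D 0 γ.inner (fun _ => Ho) (fun _ => Po) (fun _ => 0) ∧
        BartnikCollar.SliceData D 1 (fun p => (1 + ε) ^ 2 • γ.inner p)
          (fun _ => √(Ho ^ 2 - Po ^ 2)) (fun _ => 0) (fun _ => 0) ∧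
        ∀ (N : Type u) [TopologicalSpace N] [CompactSpace N] [T2Space N] [Nonempty N]
          [ChartedSpace (EuclideanSpace ℝ (Fin 2)) N] [IsManifold (𝓡 2) ∞ N]
          (F : N → S × ℝ)
          (ν : ∀ s : N, TangentSpace BartnikCollar.cylModel (F s)),
          D.IsMOTS (𝓡 2) BartnikCollar.cylBasis BartnikCollar.planeBasis F ν →
          (∀ s, F s ∈ BartnikCollar.cylinder S) →
          Ho = |Po| ∧ ∀ s, (F s).2 = 0 ∨ (F s).2 = 1 := by
  have : CompactSpace S := hS.some.toHomeomorph.symm.compactSpace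
  have : Nonempty S :=
    ⟨hS.some.symm ⟨EuclideanSpace.single 0 1, by simp⟩⟩
  -- Compactness turns the pointwise strict bound into a strict bound at the minimum of the
  -- curvature, which persists for small `ε` by continuity in `ε`.
  obtain ⟨s₀, -, hs₀⟩ := isCompact_univ.exists_isMinOn Set.univ_nonempty
    (BartnikCollar.continuous_scalarCurvature (b := BartnikCollar.planeBasis) γ).continuousOn
  have hmin : ∀ s, BartnikCollar.scalarCurvature BartnikCollar.planeBasis γ.inner s₀ ≤
      BartnikCollar.scalarCurvature BartnikCollar.planeBasis γ.inner s := fun s =>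
    hs₀ (Set.mem_univ s)
  have hcont : Continuous fun x : ℝ => (3 / 2) * (1 + x) ^ 2 * √(Ho ^ 2 - Po ^ 2) ^ 2 := by
    fun_prop
  have hev : ∀ᶠ x : ℝ in nhds 0, (3 / 2) * (1 + x) ^ 2 * √(Ho ^ 2 - Po ^ 2) ^ 2 <
      BartnikCollar.scalarCurvature BartnikCollar.planeBasis γ.inner s₀ :=
    hcont.continuousAt.eventually_lt_const (by simpa using hR s₀)
  obtain ⟨ε₀, hε₀, hball⟩ := Metric.eventually_nhds_iff.1 hev
  refine ⟨ε₀, hε₀, fun ε hε hor => ?_⟩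
  -- Both alternatives for `ε` lead to the same curvature bound, the only one used in the untrapped
  -- case.
  have hRε : ∀ s : S, (3 / 2) * (1 + ε) ^ 2 * √(Ho ^ 2 - Po ^ 2) ^ 2 ≤
      BartnikCollar.scalarCurvature BartnikCollar.planeBasis γ.inner s := by
    rcases hor with h | h
    · refine fun s => (hball ?_).le.trans (hmin s)
      rwa [Real.dist_0_eq_abs, abs_of_pos hε]
    · exact h
  have hsq : Po ^ 2 ≤ Ho ^ 2 := by
    rw [← sq_abs Po]
    exact pow_le_pow_left₀ hP.le hH 2
  -- If `H_o = |P_o|`, then `𝓗_o = 0` and only `R_γ > 0` matters, so every `ε > 0` is admissible;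
  -- otherwise the collar contains no MOTS at all.
  rcases hH.eq_or_lt with heq | hlt
  · have h0 : √(Ho ^ 2 - Po ^ 2) = 0 := by rw [← heq, sq_abs, sub_self, Real.sqrt_zero]
    have hc := hR s₀
    rw [h0, zero_pow two_ne_zero, mul_zero] at hc
    obtain ⟨D, hD, hD0, hD1, hN⟩ := BartnikCollar.exists_collar_of_abs γ hP hε hc hmin
    rw [h0, ← heq]
    exact ⟨D, hD, hD0, hD1, fun N _ _ _ _ _ _ F ν hM hF => ⟨rfl, hN N F ν hM hF⟩⟩
  · have hm : 0 < √(Ho ^ 2 - Po ^ 2) := by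
      refine Real.sqrt_pos.2 (sub_pos.2 ?_)
      rw [← sq_abs Po]
      exact pow_lt_pow_left₀ hlt hP.le two_ne_zero
    obtain ⟨D, hD, hD0, hD1, hN⟩ := BartnikCollar.exists_collar_of_pos (P := Po) γ hm hε hRε
    have hHo : √(√(Ho ^ 2 - Po ^ 2) ^ 2 + Po ^ 2) = Ho := by
      rw [Real.sq_sqrt (sub_nonneg.2 hsq), sub_add_cancel, Real.sqrt_sq (hP.le.trans hH)]
    rw [hHo] at hD0
    exact ⟨D, hD, hD0, hD1, fun N _ _ _ _ _ _ F ν hM _ => (hN N F ν hM).elim⟩
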